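/- Let $N\ge 1$ and let $q\in\mathbb C^\times$ be generic, meaning $q^{2k}\neq 1$ for $1\le k\le N$. Put $[n]=(q^n-q^{-n})/(q-q^{-1})$ and $\begin{bmatrix}N\\ r\end{bmatrix}=\frac{[N][N-1]\cdots[N-r+1]}{[r][r-1]\cdots[1]}$. Let $\mathcal H=(\mathbb C^2)^{\otimes N}$ with basis given by the configurations of spins $\uparrow,\downarrow$, and let $$\check R(u)=\begin{pmatrix}1&0&0&0\\0&u\,g(u)&f(u)&0\\0&f(u)&g(u)&0\\0&0&0&1\end{pmatrix},\qquad f(u)=\frac{u-1}{q\,u-q^{-1}},\quad g(u)=\frac{q-q^{-1}}{q\,u-q^{-1}},$$ in the basis $\uparrow\uparrow,\uparrow\downarrow,\downarrow\uparrow,\downarrow\downarrow$ of $\mathbb C^2\otimes\mathbb C^2$; $\check R_{k,k+1}$ acts on sites $k,k+1$. For $J=\{j_1<\dots<j_r\}\subseteq\{1,\dots,N\}$ let $\check R_J(\mathbf z)=L_{j_r}\cdots L_{j_1}$, where $L_j$ is the product, over all $i<j$ with $i\notin J$ and with $i$ increasing from left to right, of $\check R_{k,k+1}(z_i/z_j)$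 with $k=i+\#\{j'\in J: i<j'<j\}$. Let $(\hat p_J\Psi)(\mathbf z)$ be $\Psi$ with $z_j$ replaced by $p\,z_j$ for all $j\in J$, and let $$\widetilde D_r=\sum_{\#J=r}A_J\,\check R_J^{-1}\,\hat p_J\,\check R_J,\qquad A_J=\prod_{j\in J,\;i\notin J}\frac{q\,z_j-q^{-1}z_i}{z_j-z_i},$$ be the spin-Macdonald operators. For $1\le r\le N$ the spin-chain Hamiltonian $H_r$ on $\mathcal H$ is $$H_r=\mathrm{ev}\,\widetilde H_r,\qquad \widetilde H_r=\frac1{q-q^{-1}}\,\frac{\partial}{\partial p}\Big|_{p=1}\Bigl(\widetilde D_r-\frac rN\begin{bmatrix}N\\ r\end{bmatrix}\widetilde D_N\Bigr),\qquad \mathrm{ev}\colon z_j\mapsto e^{2\pi i j/N},$$ that is, $H_r v$ is the value at $z_j=e^{2\pi i j/N}$ of $\widetilde H_r$ applied to the constant function $v$ (upon evaluation the derivatives $z_j\partial_{z_j}$ cancel from $\widetilde H_r$). A motif is a set $\mu=\{\mu_1<\dots<\mu_M\}\subseteq\{1,\dots,N-1\}$ with $\mu_{m+1}>\mu_m+1$;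 $\mathcal M_N$ is the set of motifs. The motif of a spin configuration is the set of all $n\in\{1,\dots,N-1\}$ with spin $\downarrow$ at site $n$ and spin $\uparrow$ at site $n+1$, and $\bar{\mathcal H}^\mu$ is the span of the configurations with motif $\mu$. By a motif decomposition we mean subspaces $\mathcal H^\mu=\mathcal H^\mu(q)$, for $\mu\in\mathcal M_N$ and all generic $q$, such that $\mathcal H=\bigoplus_{\mu\in\mathcal M_N}\mathcal H^\mu$, every $\mathcal H^\mu$ is a (nonzero, full) joint eigenspace of $H_1,\dots,H_N$, and the projection onto $\mathcal H^\mu$ along the other summands depends continuously on $q$ and tends, as $q\to\infty$ in $\mathbb C$, to the projection onto $\bar{\mathcal H}^\mu$ along the span of the configurations with other motifs. **Theorem.** For every $N\ge1$ a motif decomposition exists. For every motif decomposition, all generic $q$, all $\mu=\{\mu_1<\dots<\mu_M\}\in\mathcal M_N$ and all $1\le r\le N$, the Hamiltonian $H_r$ acts on $\mathcal H^\mu$ as the scalar $$\varepsilon_r(\mu)=\sum_{m=1}^M\varepsilon_r(\mu_m),\qquad \varepsilon_r(n)=\frac1{q-q^{-1}}\Biggl(\sum_{s=1}^r(-1)^{s-1}\begin{bmatrix}N\\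 r-s\end{bmatrix}q^{s(N-n)}\frac{[s\,n]}{[s]}-\frac rN\begin{bmatrix}N\\ r\end{bmatrix}n\Biggr).$$ -/

import Mathlib

open scoped BigOperators Topology

noncomputable section

namespace QHS

/-! Sites are `0, …, N-1` in `Fin N`, standing for the sites `1, …, N`. Spins are elements of
`Fin 2`, with `0` for spin up and `1` for spin down. -/

/-- Spin configurations of the chain; they label the coordinate basis. -/
abbrev Config (N : ℕ) : Type := Fin N → Fin 2

/-- The spin-chain Hilbert space, the `N`-fold tensor power of `ℂ²` in its coordinate basis. -/
abbrev State (N : ℕ) : Type := Config N → ℂ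

/-- Operators on the spin-chain Hilbert space. -/
abbrev Op (N : ℕ) : Type := Matrix (Config N) (Config N) ℂ

/-- The `q`-number `[n] = (q^n - q^(-n)) / (q - q^(-1))`. -/
def qInt (q : ℂ) (n : ℕ) : ℂ := (q ^ n - q⁻¹ ^ n) / (q - q⁻¹)

/-- The `q`-binomial `[n] [n-1] ⋯ [n-r+1] / ([r] [r-1] ⋯ [1])`. -/
def qBinom (q : ℂ) (n r : ℕ) : ℂ :=
  (∏ k ∈ Finset.range r, qInt q (n - k)) / ∏ k ∈ Finset.range r, qInt q (k + 1)

/-- The weight `f(u)` of the six-vertex model. -/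
def fWeight (q u : ℂ) : ℂ := (u - 1) / (q * u - q⁻¹)

/-- The weight `g(u)` of the six-vertex model. -/
def gWeight (q u : ℂ) : ℂ := (q - q⁻¹) / (q * u - q⁻¹)

/-- The `R`-matrix in the basis up-up, up-down, down-up, down-down. -/
def rMatrix (q u : ℂ) : Matrix (Fin 4) (Fin 4) ℂ :=
  !![1, 0, 0, 0;
     0, u * gWeight q u, fWeight q u, 0;
     0, fWeight q u, gWeight q u, 0;
     0, 0, 0, 1]

/-- `rMatrix` acting on the neighbouring sites `k` and `k + 1` (the index of the pair of spins
`(a, b)` in `Fin 4` is `2 a + b`). The value for `k + 1 ≥ N` is never used. -/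
def siteR (N : ℕ) (q : ℂ) (k : ℕ) (u : ℂ) : Op N :=
  if h : k + 1 < N then
    Matrix.of fun σ τ =>
      if ∀ i : Fin N, (i : ℕ) ≠ k → (i : ℕ) ≠ k + 1 → σ i = τ i then
        rMatrix q u
          (finProdFinEquiv (σ ⟨k, Nat.lt_of_succ_lt h⟩, σ ⟨k + 1, h⟩))
          (finProdFinEquiv (τ ⟨k, Nat.lt_of_succ_lt h⟩, τ ⟨k + 1, h⟩))
      else 0
  else 1

/-- One layer of `R`-matrices: the line with coordinate `z j`, for `j ∈ J`, is transported to the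
left past all lines `i < j` with `i ∉ J` (leftmost factor: smallest `i`). When it meets the line
`i`, that line has already been shifted to the right by the lines `j' ∈ J` with `i < j' < j`. -/
def layer (N : ℕ) (q : ℂ) (J : Finset (Fin N)) (z : Fin N → ℂ) (j : Fin N) : Op N :=
  (((List.finRange N).filter fun i : Fin N => i < j ∧ i ∉ J).map fun i : Fin N =>
    siteR N q ((i : ℕ) + (J.filter fun j' => i < j' ∧ j' < j).card) (z i / z j)).prod

/-- For `J = {j₁ < ⋯ < j_r}`, the product of `R`-matrices that transports the lines
`j₁, …, j_r` to the sites `1, …, r`: first `j₁` (rightmost factor), then `j₂`, and so on. -/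
def transport (N : ℕ) (q : ℂ) (J : Finset (Fin N)) (z : Fin N → ℂ) : Op N :=
  ((J.sort (fun a b => b ≤ a)).map (layer N q J z)).prod

/-- The coefficient `A_J`, the product of `(q z_j - q⁻¹ z_i) / (z_j - z_i)` over `j ∈ J ∌ i`. -/
def coeffA (N : ℕ) (q : ℂ) (J : Finset (Fin N)) (z : Fin N → ℂ) : ℂ :=
  ∏ j ∈ J, ∏ i ∈ Jᶜ, (q * z j - q⁻¹ * z i) / (z j - z i)

/-- The coordinates `z` with `z j` replaced by `p * z j` for all `j ∈ J`. -/
def shift (N : ℕ) (p : ℂ) (J : Finset (Fin N)) (z : Fin N → ℂ) : Fin N → ℂ :=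
  fun j => if j ∈ J then p * z j else z j

/-- The multiplicative difference operator `p̂_J`, acting on functions of the coordinates with
values in the spin-chain Hilbert space: `(p̂_J Ψ)(z) = Ψ(…, p z_j, …)`. -/
def shiftOp (N : ℕ) (p : ℂ) (J : Finset (Fin N)) (Ψ : (Fin N → ℂ) → State N) :
    (Fin N → ℂ) → State N :=
  fun z => Ψ (shift N p J z)

/-- The spin-Macdonald operator
`D̃_r = ∑_{#J = r} A_J Ř_J⁻¹ p̂_J Ř_J`, with `Ř_J = transport J`. -/
def spinMacdonald (N : ℕ) (q p : ℂ) (r : ℕ) (Ψ : (Fin N → ℂ) → State N) :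
    (Fin N → ℂ) → State N :=
  fun z => ∑ J ∈ (Finset.univ : Finset (Fin N)).powersetCard r,
    coeffA N q J z • ((transport N q J z)⁻¹).mulVec
      (shiftOp N p J (fun w => (transport N q J w).mulVec (Ψ w)) z)

/-- The operator
`H̃_r = (q - q⁻¹)⁻¹ ∂/∂p|_{p = 1} (D̃_r - (r / N) [N choose r] D̃_N)`. -/
def hamTilde (N : ℕ) (q : ℂ) (r : ℕ) (Ψ : (Fin N → ℂ) → State N) :
    (Fin N → ℂ) → State N :=
  fun z => (q - q⁻¹)⁻¹ •
    deriv (fun p : ℂ => spinMacdonald N q p r Ψ z -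
      ((r : ℂ) / (N : ℂ) * qBinom q N r) • spinMacdonald N q p N Ψ z) 1

/-- The evaluation point `z_j = exp (2 π i j / N)`, `j = 1, …, N`. -/
def evPoint (N : ℕ) : Fin N → ℂ :=
  fun j => Complex.exp (2 * Real.pi * Complex.I * (((j : ℕ) : ℂ) + 1) / (N : ℂ))

/-- The spin-chain Hamiltonian `H_r = ev H̃_r`. On shell the derivatives `z_j ∂/∂z_j` cancel from
`H̃_r`, so that `ev H̃_r` is a matrix; its columns are the values at the evaluation point of `H̃_r`
on the constant functions given by the coordinate basis (that is, all `p̂`s are moved to the right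
and then dropped). -/
def ham (N : ℕ) (q : ℂ) (r : ℕ) : Op N :=
  Matrix.of fun σ τ => hamTilde N q r (fun _ => Pi.single τ 1) (evPoint N) σ

/-- Motifs: subsets of `{1, …, N-1}` without two consecutive elements. -/
abbrev Motif (N : ℕ) : Type :=
  {μ : Finset ℕ // (∀ n ∈ μ, 1 ≤ n ∧ n < N) ∧ ∀ n ∈ μ, n + 1 ∉ μ}

/-- The motif of a configuration: the set of all `n ∈ {1, …, N-1}` such that the spin at the
`n`-th site is down and the spin at the next site is up. -/
def domainWalls (N : ℕ) (σ : Config N) : Finset ℕ :=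
  (Finset.range N).filter fun n =>
    ∃ i j : Fin N, (i : ℕ) + 1 = n ∧ (j : ℕ) = n ∧ σ i = 1 ∧ σ j = 0

/-- The projection onto the crystal eigenspace of `μ`, the span of the configurations with motif
`μ`, along the other configurations. -/
def crystalProj (N : ℕ) (μ : Motif N) : Op N :=
  Matrix.diagonal fun σ => if domainWalls N σ = μ.1 then 1 else 0

/-- Generic values of the deformation parameter: no `q`-number `[k]`, `1 ≤ k ≤ N`, vanishes and
`q² ≠ 1`. -/
def Generic (N : ℕ) (q : ℂ) : Prop := q ≠ 0 ∧ ∀ k : ℕ, 1 ≤ k → k ≤ N → q ^ (2 * k) ≠ 1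

/-- `V` is a joint eigenspace of the Hamiltonians `H_1, …, H_N`. -/
def IsJointEigenspace (N : ℕ) (q : ℂ) (V : Submodule ℂ (State N)) : Prop :=
  V ≠ ⊥ ∧ ∃ χ : ℕ → ℂ, ∀ v : State N,
    v ∈ V ↔ ∀ r : ℕ, 1 ≤ r → r ≤ N → (ham N q r).mulVec v = χ r • v

/-- The labelling of the joint eigenspaces by motifs. For every generic `q` the Hilbert space is
the direct sum of the joint eigenspaces `W q μ`, they depend continuously on `q`, and in the
crystal limit `q → ∞` they become the crystal eigenspaces. Continuity and limit are those of the
projections `P q μ` onto `W q μ` along the other summands. -/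
structure IsMotifDecomposition (N : ℕ) (W : ℂ → Motif N → Submodule ℂ (State N)) : Prop where
  internal : ∀ q, Generic N q → DirectSum.IsInternal (W q)
  jointEigenspace : ∀ q, Generic N q → ∀ μ, IsJointEigenspace N q (W q μ)
  continuity : ∃ P : ℂ → Motif N → Op N,
    (∀ q, Generic N q → ∀ μ ν, ∀ v ∈ W q ν, (P q μ).mulVec v = if ν = μ then v else 0) ∧
    (∀ μ, ContinuousOn (fun q => P q μ) {q | Generic N q}) ∧
    ∀ μ, Filter.Tendsto (fun q => P q μ) (Bornology.cobounded ℂ) (𝓝 (crystalProj N μ))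

/-- The one-particle energy `ε_r(n)`. -/
def dispersion (N : ℕ) (q : ℂ) (r n : ℕ) : ℂ :=
  (q - q⁻¹)⁻¹ *
    ((∑ s ∈ Finset.Icc 1 r, (-1) ^ (s - 1) * qBinom q N (r - s) *
        q ^ ((s : ℤ) * ((N : ℤ) - (n : ℤ))) * (qInt q (s * n) / qInt q s)) -
      (r : ℂ) / (N : ℂ) * qBinom q N r * (n : ℂ))

end QHS

end

open scoped BigOperators Topology

noncomputable section

namespace QHS

/-! ### Six-vertex operators on neighbouring sites -/

/-! The Hamiltonians are studied by lifting them from the spin chain to polynomials. A polynomial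
vector is physical if permuting its coordinates amounts to applying `R`-matrices. The values of such
vectors at any generic point fill the whole Hilbert space (`exists_physical`), so an operator on the
chain can be examined through an operator on physical polynomials that induces it at the evaluation
point.

Only the first-order part of the spin-Macdonald operators at `p = 1` is needed, and it preserves
physical polynomials (`exists_macdonald`): a sum over cosets of a Young subgroup is symmetric, and
its apparent poles cancel because a skew physical vector is divisible by the Vandermonde determinant
(`exists_cosetSum`). At the roots of unity, rotation invariance turns the derivative terms into a
multiple of the total Euler operator, which can be subtracted (`lifts_logSum`). Along rays where the
coordinates are widely separated the lifted operator is triangular, with explicit diagonal entries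
(`macdonald_leading`). A descent on the leading monomials shows that every eigenvalue on the chain
is such a diagonal entry (`Lifts.eigenvalue`).

The matrix relating the Hamiltonians to the single Euler operators is inverted explicitly, which
gives mode operators with diagonal entries `d m - (∑ d) / N`, hence with eigenvalues in `N⁻¹ ℤ`
(`lifts_mode`). For real `q > 1` the modes are Hermitian (`mode_isHermitian`). The commutator of two
modes lifts with diagonal entries zero, so, being `-i` times a Hermitian matrix whose only
eigenvalue is zero, it vanishes (`mode_comm_of_real`).

In the variable `Q = q⁻¹` the modes are analytic up to and including the crystal point `Q = 0`,
where they are diagonal and their entries are read off from the domain walls (`modeQ_zero`). Joint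
moments of the modes and of a combination `levelQ` separating the motifs are, after scaling,
integers for `0 < Q < 1`; being continuous, they keep their crystal values (`trace_word`). A
Hermitian matrix with zero trace square vanishes, so the spectral identities hold for `0 < Q < 1`,
and analytic continuation carries them to all generic `q` (`aeval_levelQ_eq_zero`,
`modeQ_mul_aeval`). Lagrange polynomials in `levelQ` are then the required projections, and
`dispersion_eq` turns mode eigenvalues into energies.

For uniqueness, each summand of any motif decomposition is one of the constructed eigenspaces. The
trace of the product of the two projections with the same label is an integer depending continuously
on `q` on a connected set, with nonzero limit, so the labels agree
(`IsMotifDecomposition.eq_motifSpace`). -/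

/-- A `4 × 4` matrix acting on the sites `k` and `k + 1`. -/
def siteMat (N k : ℕ) (R : Matrix (Fin 4) (Fin 4) ℂ) : Op N :=
  if h : k + 1 < N then
    Matrix.of fun σ τ =>
      if ∀ i : Fin N, (i : ℕ) ≠ k → (i : ℕ) ≠ k + 1 → σ i = τ i then
        R (finProdFinEquiv (σ ⟨k, Nat.lt_of_succ_lt h⟩, σ ⟨k + 1, h⟩))
          (finProdFinEquiv (τ ⟨k, Nat.lt_of_succ_lt h⟩, τ ⟨k + 1, h⟩))
      else 0
  else 1

/-- Six-vertex weights. -/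
def ice (d a b c : ℂ) : Matrix (Fin 4) (Fin 4) ℂ :=
  !![d, 0, 0, 0; 0, a, b, 0; 0, b, c, 0; 0, 0, 0, d]

theorem siteR_eq (N : ℕ) (q : ℂ) (k : ℕ) (u : ℂ) :
    siteR N q k u = siteMat N k (ice 1 (u * gWeight q u) (fWeight q u) (gWeight q u)) := rfl

/-- The transposition of the sites `k` and `k + 1`. -/
def adj {N : ℕ} (k : ℕ) (h : k + 1 < N) : Equiv.Perm (Fin N) :=
  Equiv.swap ⟨k, Nat.lt_of_succ_lt h⟩ ⟨k + 1, h⟩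

section adj
variable {N : ℕ}

theorem adj_left (k : ℕ) (h : k + 1 < N) : adj k h ⟨k, Nat.lt_of_succ_lt h⟩ = ⟨k + 1, h⟩ :=
  Equiv.swap_apply_left _ _

theorem adj_right (k : ℕ) (h : k + 1 < N) : adj k h ⟨k + 1, h⟩ = ⟨k, Nat.lt_of_succ_lt h⟩ :=
  Equiv.swap_apply_right _ _

theorem adj_of_ne (k : ℕ) (h : k + 1 < N) (i : Fin N) (h1 : (i : ℕ) ≠ k) (h2 : (i : ℕ) ≠ k + 1) :
    adj k h i = i :=
  Equiv.swap_apply_of_ne_of_ne (fun e => h1 (by rw [e])) (fun e => h2 (by rw [e]))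

theorem adj_adj (k : ℕ) (h : k + 1 < N) (i : Fin N) : adj k h (adj k h i) = i :=
  (adj k h).symm_apply_apply i

theorem adj_braid (k : ℕ) (h : k + 1 + 1 < N) :
    adj k (by omega) * adj (k + 1) h * adj k (by omega) =
      adj (k + 1) h * adj k (by omega) * adj (k + 1) h := by
  have hk : k + 1 < N := by omega
  ext1 i
  simp only [Equiv.Perm.mul_apply]
  by_cases i0 : (i : ℕ) = k
  · have : i = ⟨k, by omega⟩ := Fin.ext i0
    rw [this, adj_left, adj_left, adj_of_ne (k + 1) h ⟨k, _⟩ (by simp) (by simp; omega),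
      adj_left, adj_of_ne k hk ⟨k + 1 + 1, h⟩ (by simp; omega) (by simp), adj_left]
  · by_cases i1 : (i : ℕ) = k + 1
    · have : i = ⟨k + 1, by omega⟩ := Fin.ext i1
      rw [this, adj_left, adj_right, adj_of_ne (k + 1) h ⟨k, _⟩ (by simp) (by simp; omega),
        adj_left, adj_of_ne k hk ⟨k + 1 + 1, h⟩ (by simp; omega) (by simp), adj_right]
    · by_cases i2 : (i : ℕ) = k + 1 + 1
      · have : i = ⟨k + 1 + 1, by omega⟩ := Fin.ext i2
        rw [this, adj_right, adj_of_ne k hk ⟨k + 1 + 1, h⟩ (by simp; omega) (by simp), adj_right,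
          adj_right, adj_of_ne (k + 1) h ⟨k, _⟩ (by simp) (by simp; omega)]
      · rw [adj_of_ne k hk i i0 i1, adj_of_ne (k + 1) h i i1 i2, adj_of_ne k hk i i0 i1,
          adj_of_ne (k + 1) h i i1 i2]

theorem adj_comm (k l : ℕ) (hkl : k + 1 < l) (hl : l + 1 < N) :
    adj k (by omega) * adj l hl = adj l hl * adj k (by omega) := by
  have hk : k + 1 < N := by omega
  apply Equiv.Perm.Disjoint.commute
  intro i
  by_cases h : (i : ℕ) = k ∨ (i : ℕ) = k + 1
  · right; exact adj_of_ne l hl i (by omega) (by omega)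
  · left; exact adj_of_ne k hk i (by omega) (by omega)

theorem adj_mul_self (k : ℕ) (h : k + 1 < N) : adj k h * adj k h = 1 :=
  Equiv.ext fun i => adj_adj k h i

end adj

/-- The ice rule leaves at most two nonzero entries in each row: the diagonal one and the one with
the two neighbouring spins exchanged. This formula reduces operator identities to case checks on the
two or three spins involved. -/
theorem siteMat_ice_mulVec {N : ℕ} (k : ℕ) (h : k + 1 < N) (d a b c : ℂ) (v : State N)
    (σ : Config N) :
    (siteMat N k (ice d a b c)).mulVec v σ =
      if σ ⟨k, Nat.lt_of_succ_lt h⟩ = σ ⟨k + 1, h⟩ then d * v σ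
      else (if σ ⟨k, Nat.lt_of_succ_lt h⟩ = 0 then a else c) * v σ + b * v (σ ∘ adj k h) := by
  classical
  set i0 : Fin N := ⟨k, Nat.lt_of_succ_lt h⟩ with hi0
  set i1 : Fin N := ⟨k + 1, h⟩ with hi1
  have h01 : i0 ≠ i1 := by simp [hi0, hi1]
  have key : ∀ τ : Config N, τ ∉ ({σ, σ ∘ adj k h} : Finset (Config N)) →
      siteMat N k (ice d a b c) σ τ = 0 := by
    intro τ hτ
    simp only [siteMat, h, dif_pos, Matrix.of_apply]
    split_ifs with hc
    · simp only [Finset.mem_insert, Finset.mem_singleton, not_or] at hτ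
      change ice d a b c (finProdFinEquiv (σ i0, σ i1)) (finProdFinEquiv (τ i0, τ i1)) = 0
      have e1 : ¬ (τ i0 = σ i0 ∧ τ i1 = σ i1) := by
        rintro ⟨ha, hb⟩
        apply hτ.1
        funext i
        by_cases hik : (i : ℕ) = k
        · have : i = i0 := Fin.ext hik
          rw [this, ha]
        · by_cases hik' : (i : ℕ) = k + 1
          · have : i = i1 := Fin.ext hik'
            rw [this, hb]
          · exact (hc i hik hik').symm
      have e2 : ¬ (τ i0 = σ i1 ∧ τ i1 = σ i0) := by
        rintro ⟨ha, hb⟩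
        apply hτ.2
        funext i
        simp only [Function.comp]
        by_cases hik : (i : ℕ) = k
        · have : i = i0 := Fin.ext hik
          rw [this, ha, hi0, adj_left]
        · by_cases hik' : (i : ℕ) = k + 1
          · have : i = i1 := Fin.ext hik'
            rw [this, hb, hi1, adj_right]
          · rw [adj_of_ne k h i hik hik']
            exact (hc i hik hik').symm
      generalize σ i0 = x at *
      generalize σ i1 = y at *
      generalize τ i0 = x' at *
      generalize τ i1 = y' at *
      fin_cases x <;> fin_cases y <;> fin_cases x' <;> fin_cases y' <;>
        first
          | (exfalso; revert e1 e2; decide)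
          | simp [ice, finProdFinEquiv]
    · rfl
  have hdiag : siteMat N k (ice d a b c) σ σ =
      ice d a b c (finProdFinEquiv (σ i0, σ i1)) (finProdFinEquiv (σ i0, σ i1)) := by
    rw [siteMat, dif_pos h]
    exact if_pos (fun _ _ _ => rfl)
  have hoff : siteMat N k (ice d a b c) σ (σ ∘ adj k h) =
      ice d a b c (finProdFinEquiv (σ i0, σ i1)) (finProdFinEquiv (σ i1, σ i0)) := by
    simp only [siteMat, h, dif_pos, Matrix.of_apply]
    rw [if_pos]
    · simp only [Function.comp, adj_left, adj_right, hi0, hi1]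
    · intro i h1 h2
      simp [adj_of_ne k h i h1 h2]
  have hsum : (siteMat N k (ice d a b c)).mulVec v σ =
      ∑ τ ∈ ({σ, σ ∘ adj k h} : Finset (Config N)), siteMat N k (ice d a b c) σ τ * v τ := by
    rw [Matrix.mulVec, dotProduct]
    symm
    apply Finset.sum_subset (Finset.subset_univ _)
    intro τ _ hτ
    rw [key τ hτ, zero_mul]
  rw [hsum]
  by_cases he : σ i0 = σ i1
  · have : σ ∘ adj k h = σ := by
      funext i
      simp only [Function.comp]
      by_cases hik : (i : ℕ) = k
      · have : i = i0 := Fin.ext hik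
        rw [this, hi0, adj_left]; exact he.symm
      · by_cases hik' : (i : ℕ) = k + 1
        · have : i = i1 := Fin.ext hik'
          rw [this, hi1, adj_right]; exact he
        · rw [adj_of_ne k h i hik hik']
    rw [this, if_pos he]
    simp only [Finset.pair_eq_singleton, Finset.sum_singleton]
    rw [hdiag, he]
    generalize σ i1 = y
    fin_cases y <;> simp [ice, finProdFinEquiv]
  · have hne : σ ≠ σ ∘ adj k h := by
      intro e
      apply he
      have := congrFun e i0
      simpa [hi0, adj_left] using this
    rw [Finset.sum_pair hne, hdiag, hoff, if_neg he]
    congr 2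
    · generalize σ i0 = x at *
      generalize σ i1 = y at *
      fin_cases x <;> fin_cases y <;>
        first
          | (exfalso; revert he; decide)
          | simp [ice, finProdFinEquiv]
    · generalize σ i0 = x at *
      generalize σ i1 = y at *
      fin_cases x <;> fin_cases y <;>
        first
          | (exfalso; revert he; decide)
          | simp [ice, finProdFinEquiv]

/-- The Hecke generator at the sites `k`, `k + 1`. -/
def hecke (N : ℕ) (q : ℂ) (k : ℕ) : Op N := siteMat N k (ice q (q - q⁻¹) 1 0)

theorem op_ext {N : ℕ} {A B : Op N} (h : ∀ v σ, A.mulVec v σ = B.mulVec v σ) : A = B :=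
  Matrix.ext_of_mulVec_single fun _ => funext fun σ => h _ σ

theorem fin2_cases (x : Fin 2) : x = 0 ∨ x = 1 := by fin_cases x <;> simp

theorem hecke_sq {N : ℕ} {q : ℂ} (hq : q ≠ 0) (k : ℕ) (h : k + 1 < N) :
    hecke N q k * hecke N q k = (q - q⁻¹) • hecke N q k + 1 := by
  apply op_ext
  intro v σ
  have h2 : (σ ∘ adj k h) ∘ adj k h = σ := by
    funext i; simp [adj_adj]
  rw [← Matrix.mulVec_mulVec, Matrix.add_mulVec, Matrix.smul_mulVec, Matrix.one_mulVec]
  simp only [hecke, Pi.add_apply, Pi.smul_apply, smul_eq_mul]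
  simp only [siteMat_ice_mulVec k h, h2]
  simp only [Function.comp, adj_left, adj_right]
  rcases fin2_cases (σ ⟨k, Nat.lt_of_succ_lt h⟩) with h0 | h0 <;>
  rcases fin2_cases (σ ⟨k + 1, h⟩) with h1 | h1 <;> simp [h0, h1] <;> field_simp <;> ring

theorem hecke_braid {N : ℕ} {q : ℂ} (hq : q ≠ 0) (k : ℕ) (h : k + 1 + 1 < N) :
    hecke N q k * hecke N q (k + 1) * hecke N q k =
      hecke N q (k + 1) * hecke N q k * hecke N q (k + 1) := by
  apply op_ext
  intro v σ
  have hk : k + 1 < N := by omega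
  have c1 : ((σ ∘ adj k hk) ∘ adj k hk) = σ := by funext i; simp [adj_adj]
  have c2 : ((σ ∘ adj (k + 1) h) ∘ adj (k + 1) h) = σ := by funext i; simp [adj_adj]
  have c3 : ∀ τ : Config N, ((τ ∘ adj k hk) ∘ adj (k + 1) h) ∘ adj k hk =
      ((τ ∘ adj (k + 1) h) ∘ adj k hk) ∘ adj (k + 1) h := by
    intro τ
    funext i
    exact congrArg τ (Equiv.congr_fun (adj_braid k h) i)
  simp only [← Matrix.mulVec_mulVec]
  simp only [hecke, siteMat_ice_mulVec k hk, siteMat_ice_mulVec (k + 1) h, c1, c2, c3]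
  have e1 : adj (k + 1) h ⟨k, by omega⟩ = ⟨k, by omega⟩ :=
    adj_of_ne _ _ _ (by simp) (by simp; omega)
  have e2 : adj k hk ⟨k + 1 + 1, h⟩ = ⟨k + 1 + 1, h⟩ :=
    adj_of_ne _ _ _ (by simp; omega) (by simp)
  simp only [Function.comp, adj_left, adj_right, e1, e2]
  rcases fin2_cases (σ ⟨k, by omega⟩) with h0 | h0 <;>
  rcases fin2_cases (σ ⟨k + 1, hk⟩) with h1 | h1 <;>
  rcases fin2_cases (σ ⟨k + 1 + 1, h⟩) with h2 | h2 <;> simp [h0, h1, h2] <;> field_simp <;> ring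

theorem siteMat_ice_comm {N : ℕ} (k l : ℕ) (hkl : k + 1 < l) (hl : l + 1 < N)
    (d a b c d' a' b' c' : ℂ) :
    siteMat N k (ice d a b c) * siteMat N l (ice d' a' b' c') =
      siteMat N l (ice d' a' b' c') * siteMat N k (ice d a b c) := by
  apply op_ext
  intro v σ
  have hk : k + 1 < N := by omega
  have c3 : (σ ∘ adj k hk) ∘ adj l hl = (σ ∘ adj l hl) ∘ adj k hk := by
    funext i
    exact congrArg σ (Equiv.congr_fun (adj_comm k l hkl hl) i)
  simp only [← Matrix.mulVec_mulVec, siteMat_ice_mulVec k hk, siteMat_ice_mulVec l hl, c3]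
  have e1 : adj l hl ⟨k, by omega⟩ = ⟨k, by omega⟩ :=
    adj_of_ne _ _ _ (by simp; omega) (by simp; omega)
  have e2 : adj l hl ⟨k + 1, hk⟩ = ⟨k + 1, hk⟩ :=
    adj_of_ne _ _ _ (by simp; omega) (by simp; omega)
  have e3 : adj k hk ⟨l, by omega⟩ = ⟨l, by omega⟩ :=
    adj_of_ne _ _ _ (by simp; omega) (by simp; omega)
  have e4 : adj k hk ⟨l + 1, hl⟩ = ⟨l + 1, hl⟩ :=
    adj_of_ne _ _ _ (by simp; omega) (by simp; omega)
  simp only [Function.comp, e1, e2, e3, e4]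
  split_ifs <;> ring

/-- Baxterization: up to a scalar the `R`-matrix is affine in the Hecke generator, so unitarity and
the Yang–Baxter equation follow from the quadratic and braid relations. -/
theorem siteR_eq_hecke {N : ℕ} {q u : ℂ} (k : ℕ) (h : k + 1 < N) (hu : q * u - q⁻¹ ≠ 0) :
    siteR N q k u = (q * u - q⁻¹)⁻¹ • ((u - 1) • hecke N q k + (q - q⁻¹) • 1) := by
  apply op_ext
  intro v σ
  rw [Matrix.smul_mulVec, Matrix.add_mulVec, Matrix.smul_mulVec, Matrix.smul_mulVec,
    Matrix.one_mulVec, siteR_eq]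
  simp only [hecke, siteMat_ice_mulVec k h, Pi.smul_apply, Pi.add_apply, smul_eq_mul, fWeight,
    gWeight]
  split_ifs
  · rw [eq_inv_mul_iff_mul_eq₀ hu]; ring
  · ring
  · ring

theorem siteR_mul_inv {N : ℕ} {q u : ℂ} (k : ℕ) (hq : q ≠ 0) (h0 : u ≠ 0)
    (hu : q * u - q⁻¹ ≠ 0) (hu' : q * u⁻¹ - q⁻¹ ≠ 0) :
    siteR N q k u * siteR N q k u⁻¹ = 1 := by
  by_cases h : k + 1 < N
  · rw [siteR_eq_hecke k h hu, siteR_eq_hecke k h hu', smul_mul_smul_comm]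
    have : ((u - 1) • hecke N q k + (q - q⁻¹) • (1 : Op N)) *
        ((u⁻¹ - 1) • hecke N q k + (q - q⁻¹) • (1 : Op N)) =
        ((q * u - q⁻¹) * (q * u⁻¹ - q⁻¹)) • (1 : Op N) := by
      simp only [add_mul, mul_add, smul_mul_assoc, mul_smul_comm, one_mul, mul_one,
        hecke_sq hq k h, smul_add]
      match_scalars <;> field_simp <;> ring
    rw [this, smul_smul, ← mul_inv, inv_mul_cancel₀ (mul_ne_zero hu hu'), one_smul]
  · simp [siteR, h]

/-- After expansion the quadratic and braid relations leave a linear combination of reduced words,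
and the two sides agree coefficient by coefficient. -/
theorem yang_baxter {A : Type*} [Ring A] [Algebra ℂ A] (a b : A) (h u v : ℂ)
    (ha : a * a = h • a + 1) (hb : b * b = h • b + 1) (hab : a * b * a = b * a * b) :
    ((u - 1) • a + h • (1 : A)) * ((u * v - 1) • b + h • (1 : A)) * ((v - 1) • a + h • (1 : A)) =
    ((v - 1) • b + h • (1 : A)) * ((u * v - 1) • a + h • (1 : A)) *
      ((u - 1) • b + h • (1 : A)) := by
  simp only [add_mul, mul_add, smul_mul_assoc, mul_smul_comm, one_mul, mul_one, ha, hb, hab,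
    smul_add]
  match_scalars <;> ring

theorem siteR_yang_baxter {N : ℕ} {q u v : ℂ} (k : ℕ) (h : k + 1 + 1 < N) (hq : q ≠ 0)
    (hu : q * u - q⁻¹ ≠ 0) (hv : q * v - q⁻¹ ≠ 0) (huv : q * (u * v) - q⁻¹ ≠ 0) :
    siteR N q k u * siteR N q (k + 1) (u * v) * siteR N q k v =
      siteR N q (k + 1) v * siteR N q k (u * v) * siteR N q (k + 1) u := by
  have hk : k + 1 < N := by omega
  rw [siteR_eq_hecke k hk hu, siteR_eq_hecke (k + 1) h huv, siteR_eq_hecke k hk hv,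
    siteR_eq_hecke k hk huv, siteR_eq_hecke (k + 1) h hu, siteR_eq_hecke (k + 1) h hv]
  simp only [smul_mul_smul_comm]
  rw [yang_baxter _ _ _ u v (hecke_sq hq k hk) (hecke_sq hq (k + 1) h) (hecke_braid hq k h)]
  congr 1
  ring

theorem siteR_comm {N : ℕ} {q u v : ℂ} (k l : ℕ) (hkl : k + 1 < l) (hl : l + 1 < N) :
    siteR N q k u * siteR N q l v = siteR N q l v * siteR N q k u := by
  rw [siteR_eq, siteR_eq, siteMat_ice_comm k l hkl hl]

/-- All spins up. -/
def allUp (N : ℕ) : State N := Pi.single (fun _ => 0) 1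

theorem siteR_mulVec_allUp {N : ℕ} (q u : ℂ) (k : ℕ) :
    (siteR N q k u).mulVec (allUp N) = allUp N := by
  by_cases hk : k + 1 < N
  · funext σ
    rw [siteR_eq, siteMat_ice_mulVec k hk]
    split_ifs with h1 h2
    · simp
    all_goals
      have e1 : σ ≠ fun _ => 0 := by rintro rfl; simp at h1
      have e2 : σ ∘ adj k hk ≠ fun _ => 0 := by
        intro e
        apply e1
        funext i
        have := congrFun e (adj k hk i)
        simpa [adj_adj] using this
      simp [allUp, e1, e2]
  · simp [siteR, hk]

theorem siteMat_ice_conjTranspose {N : ℕ} (k : ℕ) (d a b c : ℂ) :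
    (siteMat N k (ice d a b c)).conjTranspose =
      siteMat N k (ice (star d) (star a) (star b) (star c)) := by
  by_cases hk : k + 1 < N
  · ext σ τ
    simp only [Matrix.conjTranspose_apply, siteMat, hk, dif_pos, Matrix.of_apply]
    have : (∀ i : Fin N, (i : ℕ) ≠ k → (i : ℕ) ≠ k + 1 → τ i = σ i) ↔
        (∀ i : Fin N, (i : ℕ) ≠ k → (i : ℕ) ≠ k + 1 → σ i = τ i) :=
      ⟨fun h i a b => (h i a b).symm, fun h i a b => (h i a b).symm⟩
    simp only [this]
    split_ifs
    · generalize finProdFinEquiv (σ ⟨k, Nat.lt_of_succ_lt hk⟩, σ ⟨k + 1, hk⟩) = x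
      generalize finProdFinEquiv (τ ⟨k, Nat.lt_of_succ_lt hk⟩, τ ⟨k + 1, hk⟩) = y
      fin_cases x <;> fin_cases y <;> simp [ice]
    · simp
  · simp [siteMat, hk]

/-- The matrix is symmetric and its weights are rational in `u` with real coefficients, so the
adjoint only conjugates `u`, which inverts it on the unit circle. Together with `siteR_mul_inv` this
gives unitarity. -/
theorem siteR_conjTranspose {N : ℕ} {q : ℝ} {u : ℂ} (k : ℕ) (hu : ‖u‖ = 1) :
    (siteR N q k u).conjTranspose = siteR N q k u⁻¹ := by
  have hc : star u = u⁻¹ := by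
    rw [Complex.inv_def, Complex.normSq_eq_norm_sq, hu]; simp
  have hq : star (q : ℂ) = q := Complex.conj_ofReal q
  rw [siteR_eq, siteMat_ice_conjTranspose, siteR_eq]
  simp only [fWeight, gWeight, star_mul', star_div₀, star_sub, star_one, hc, hq, star_inv₀]

/-! ### Transport of lines -/

/-- `Ψ` satisfies the exchange relations on `U`. -/
def Exchange {N : ℕ} (q : ℂ) (U : Set (Fin N → ℂ)) (Ψ : (Fin N → ℂ) → State N) : Prop :=
  ∀ (k : ℕ) (h : k + 1 < N), ∀ z ∈ U, Ψ (z ∘ adj k h) =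
    (siteR N q k (z ⟨k, Nat.lt_of_succ_lt h⟩ / z ⟨k + 1, h⟩)).mulVec (Ψ z)

/-- `U` is stable under permutations of the coordinates. -/
def PermStable {N : ℕ} (U : Set (Fin N → ℂ)) : Prop :=
  ∀ z ∈ U, ∀ π : Equiv.Perm (Fin N), z ∘ π ∈ U

/-- The product of the factors `S k i j` that transports the line `j` to the left past the lines
`i < j` with `i ∉ J`. -/
def layerS {N : ℕ} (S : ℕ → Fin N → Fin N → Op N) (J : Finset (Fin N)) (j : Fin N) : Op N :=
  (((List.finRange N).filter fun i : Fin N => i < j ∧ i ∉ J).map fun i : Fin N =>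
    S ((i : ℕ) + (J.filter fun j' => i < j' ∧ j' < j).card) i j).prod

/-- The product of the factors `S k i j` that transports the lines in `J` to the front. -/
def transportS {N : ℕ} (S : ℕ → Fin N → Fin N → Op N) (J : Finset (Fin N)) : Op N :=
  ((J.sort (fun a b => b ≤ a)).map (layerS S J)).prod

/-- `Φ` satisfies the exchange relations with the factors `S k i j`. -/
def ExchangeS {N : ℕ} (S : ℕ → Fin N → Fin N → Op N) (Φ : Equiv.Perm (Fin N) → State N) : Prop :=
  ∀ (k : ℕ) (h : k + 1 < N) (π : Equiv.Perm (Fin N)), Φ (π * adj k h) =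
    (S k (π ⟨k, Nat.lt_of_succ_lt h⟩) (π ⟨k + 1, h⟩)).mulVec (Φ π)

/-- The sites strictly between `i` and `j` split into those in `J`, which have already pushed the
line `i` to the right, and those in `l`, which the line `j` has already passed. Hence the lines `i`
and `j` are neighbours exactly when their crossing is due. -/
theorem card_between {N : ℕ} (J : Finset (Fin N)) (i j : Fin N) (hij : i < j) (l : List (Fin N))
    (hl : l.Nodup) (hm : ∀ x, x ∈ l ↔ i < x ∧ x < j ∧ x ∉ J) :
    (i : ℕ) + (J.filter fun j' => i < j' ∧ j' < j).card + 1 + l.length = j := by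
  classical
  have h1 : l.length = (Finset.univ.filter fun x => i < x ∧ x < j ∧ x ∉ J).card := by
    rw [← List.toFinset_card_of_nodup hl]
    congr 1
    ext x
    simp [hm]
  have h2 : (J.filter fun j' => i < j' ∧ j' < j).card +
      (Finset.univ.filter fun x => i < x ∧ x < j ∧ x ∉ J).card = (Finset.Ioo i j).card := by
    rw [← Finset.card_union_of_disjoint]
    · congr 1
      ext x
      simp only [Finset.mem_union, Finset.mem_filter, Finset.mem_univ, true_and, Finset.mem_Ioo]
      tauto
    · rw [Finset.disjoint_left]
      intro x hx hx'
      simp only [Finset.mem_filter] at hx hx'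
      exact hx'.2.2.2 hx.1
  rw [Fin.card_Ioo] at h2
  have : (i : ℕ) < j := hij
  omega

/-- The permutation `ρ` records which line sits at each site. The remaining clauses are the loop
invariant: lines not yet passed keep their site, lines already passed have moved one site to the
right, and the line `j` sits `l.length` sites to the left of its start. -/
theorem layer_transport {N : ℕ} (J : Finset (Fin N)) (j : Fin N) (π : Equiv.Perm (Fin N))
    (hpos : ∀ i : Fin N, i < j → i ∉ J → ∀ p : Fin N,
      (p : ℕ) = i + (J.filter fun j' => i < j' ∧ j' < j).card → π p = i)
    (hfix : ∀ p, j ≤ p → π p = p) (l : List (Fin N)) (hs : l.Pairwise (· < ·))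
    (hl : ∀ x ∈ l, x < j ∧ x ∉ J) (hup : ∀ x ∈ l, ∀ i, x < i → i < j → i ∉ J → i ∈ l) :
    ∃ ρ : Equiv.Perm (Fin N),
      (∀ (S : ℕ → Fin N → Fin N → Op N) (Φ : Equiv.Perm (Fin N) → State N), ExchangeS S Φ →
        ((l.map fun i : Fin N => S ((i : ℕ) + (J.filter fun j' => i < j' ∧ j' < j).card)
          i j).prod).mulVec (Φ π) = Φ ρ) ∧
      (∀ p, j < p → ρ p = p) ∧
      (∀ i : Fin N, i < j → i ∉ J → i ∉ l → ∀ p : Fin N,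
        (p : ℕ) = i + (J.filter fun j' => i < j' ∧ j' < j).card → ρ p = i) ∧
      (∀ i ∈ l, ∀ p : Fin N,
        (p : ℕ) = i + (J.filter fun j' => i < j' ∧ j' < j).card + 1 → ρ p = i) ∧
      ∀ p : Fin N, (p : ℕ) + l.length = j → ρ p = j := by
  induction l with
  | nil =>
    refine ⟨π, fun S Φ _ => by simp, fun p hp => hfix p hp.le,
      fun i h1 h2 _ p hp => hpos i h1 h2 p hp, by simp, fun p hp => ?_⟩
    have : p = j := Fin.ext (by simpa using hp)
    rw [this, hfix j le_rfl]
  | cons i l ih =>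
    rw [List.pairwise_cons] at hs
    obtain ⟨ρ, h1, h2, h3, h4, h5⟩ := ih hs.2 (fun x hx => hl x (List.mem_cons_of_mem _ hx))
      (fun x hx y hxy hy hyJ => by
        rcases List.mem_cons.1 (hup x (List.mem_cons_of_mem _ hx) y hxy hy hyJ) with e | e
        · exact absurd (hs.1 x hx) (by rw [← e]; exact not_lt.2 hxy.le)
        · exact e)
    have hi := hl i List.mem_cons_self
    have hil : i ∉ l := fun h => lt_irrefl _ (hs.1 i h)
    have hcard := card_between J i j hi.1 l (hs.2.imp (fun h => ne_of_lt h)) (fun x =>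
      ⟨fun hx => ⟨hs.1 x hx, hl x (List.mem_cons_of_mem _ hx)⟩, fun hx => by
        rcases List.mem_cons.1 (hup i List.mem_cons_self x hx.1 hx.2.1 hx.2.2) with e | e
        · exact absurd hx.1 (by rw [e]; exact lt_irrefl _)
        · exact e⟩)
    set k := (i : ℕ) + (J.filter fun j' => i < j' ∧ j' < j).card with hk
    have hkN : k + 1 < N := by have := j.2; omega
    have e1 : ρ ⟨k, Nat.lt_of_succ_lt hkN⟩ = i := h3 i hi.1 hi.2 hil _ rfl
    have e2 : ρ ⟨k + 1, hkN⟩ = j := h5 _ hcard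
    have hadj : ∀ p : Fin N, ρ p ≠ i → ρ p ≠ j → (ρ * adj k hkN) p = ρ p := by
      intro p hpi hpj
      rw [Equiv.Perm.mul_apply, adj_of_ne]
      · intro e
        exact hpi (by rw [← e1]; congr 1; exact Fin.ext e)
      · intro e
        exact hpj (by rw [← e2]; congr 1; exact Fin.ext e)
    refine ⟨ρ * adj k hkN, ?_, ?_, ?_, ?_, ?_⟩
    · intro S Φ hΦ
      rw [List.map_cons, List.prod_cons, ← Matrix.mulVec_mulVec, h1 S Φ hΦ]
      have := hΦ k hkN ρ
      rw [e1, e2] at this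
      rw [← hk]
      exact this.symm
    · intro p hp
      have : ρ p = p := h2 p hp
      rw [hadj, this]
      · rw [this]; exact (hi.1.trans hp).ne'
      · rw [this]; exact hp.ne'
    · intro x hx hxJ hxl p hp
      rw [List.mem_cons, not_or] at hxl
      have := h3 x hx hxJ hxl.2 p hp
      rw [hadj, this]
      · rw [this]; exact hxl.1
      · rw [this]; exact hx.ne
    · intro x hx p hp
      rcases List.mem_cons.1 hx with e | e
      · subst e
        have : p = ⟨k + 1, hkN⟩ := Fin.ext hp
        rw [this, Equiv.Perm.mul_apply, adj_right, e1]
      · have := h4 x e p hp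
        rw [hadj, this]
        · rw [this]; rintro rfl; exact hil e
        · rw [this]; exact (hl x hx).1.ne
    · intro p hp
      have : p = ⟨k, Nat.lt_of_succ_lt hkN⟩ := Fin.ext (by
        rw [List.length_cons] at hp
        simp only
        omega)
      rw [this, Equiv.Perm.mul_apply, adj_left, e2]

/-- The permutation is chosen before the factors `S` and the function `Φ`, so the same one serves
the actual `R`-matrices and the diagonal factors of the crystal limit. -/
theorem transport_list {N : ℕ} (J : Finset (Fin N)) (l : List (Fin N)) (hs : l.Pairwise (· > ·))
    (hl : ∀ x ∈ l, x ∈ J) (hdown : ∀ x ∈ l, ∀ i ∈ J, i < x → i ∈ l) :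
    ∃ π : Equiv.Perm (Fin N),
      (∀ (S : ℕ → Fin N → Fin N → Op N) (Φ : Equiv.Perm (Fin N) → State N), ExchangeS S Φ →
        ((l.map (layerS S J)).prod).mulVec (Φ 1) = Φ π) ∧
      (∀ p, (∀ x ∈ l, x < p) → π p = p) ∧
      ∀ i ∉ J, ∀ p : Fin N, (p : ℕ) = i + (J.filter fun j' => i < j' ∧ j' ∈ l).card → π p = i := by
  induction l with
  | nil =>
    refine ⟨1, fun S Φ _ => by simp, fun _ _ => rfl, fun i _ p hp => ?_⟩
    simp only [List.not_mem_nil, and_false, Finset.filter_false, Finset.card_empty,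
      add_zero] at hp
    exact Fin.ext hp
  | cons j l ih =>
    rw [List.pairwise_cons] at hs
    obtain ⟨π, h1, h2, h3⟩ := ih hs.2 (fun x hx => hl x (List.mem_cons_of_mem _ hx))
      (fun x hx y hy hyx => by
        rcases List.mem_cons.1 (hdown x (List.mem_cons_of_mem _ hx) y hy hyx) with e | e
        · exact absurd (hs.1 x hx) (by rw [← e]; exact not_lt.2 hyx.le)
        · exact e)
    have hj : j ∈ J := hl j List.mem_cons_self
    have hmem : ∀ j' ∈ J, (j' ∈ l ↔ j' < j) := fun j' hj' =>
      ⟨fun h => hs.1 j' h, fun h => by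
        rcases List.mem_cons.1 (hdown j List.mem_cons_self j' hj' h) with e | e
        · exact absurd h (by rw [e]; exact lt_irrefl _)
        · exact e⟩
    have hfil : ∀ i : Fin N, (J.filter fun j' => i < j' ∧ j' ∈ l) =
        J.filter fun j' => i < j' ∧ j' < j := by
      intro i
      apply Finset.filter_congr
      intro x hx
      rw [hmem x hx]
    obtain ⟨ρ, g1, g2, -, g4, -⟩ := layer_transport J j π
      (fun i _ hiJ p hp => h3 i hiJ p (by rw [hfil]; exact hp))
      (fun p hp => h2 p (fun x hx => lt_of_lt_of_le (hs.1 x hx) hp))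
      ((List.finRange N).filter fun i : Fin N => i < j ∧ i ∉ J)
      ((List.pairwise_lt_finRange N).filter _)
      (fun x hx => by simpa using hx)
      (fun x _ i _ hij hiJ => by simp [hij, hiJ])
    refine ⟨ρ, ?_, ?_, ?_⟩
    · intro S Φ hΦ
      rw [List.map_cons, List.prod_cons, ← Matrix.mulVec_mulVec, h1 S Φ hΦ]
      exact g1 S Φ hΦ
    · intro p hp
      exact g2 p (hp j List.mem_cons_self)
    · intro i hiJ p hp
      rcases lt_trichotomy i j with hij | hij | hij
      · apply g4 i (by simp [hij, hiJ]) p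
        rw [hp, ← hfil, add_assoc]
        congr 1
        rw [← Finset.card_insert_of_notMem (a := j)]
        · congr 1
          ext x
          simp only [Finset.mem_filter, List.mem_cons, Finset.mem_insert]
          constructor
          · rintro ⟨a, b, c | c⟩
            · exact Or.inl c
            · exact Or.inr ⟨a, b, c⟩
          · rintro (rfl | ⟨a, b, c⟩)
            · exact ⟨hj, hij, Or.inl rfl⟩
            · exact ⟨a, b, Or.inr c⟩
        · simp only [Finset.mem_filter, not_and]
          intro _ _ h
          exact lt_irrefl _ (hs.1 j h)
      · exact absurd (hij ▸ hj) hiJ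
      · have : (J.filter fun j' => i < j' ∧ j' ∈ j :: l) = ∅ := by
          apply Finset.filter_eq_empty_iff.2
          rintro x hx ⟨hix, hxl⟩
          rcases List.mem_cons.1 hxl with e | e
          · rw [e] at hix; exact lt_asymm hix hij
          · exact lt_asymm (hix.trans (hs.1 x e)) hij
        rw [this, Finset.card_empty, add_zero] at hp
        have : p = i := Fin.ext hp
        rw [this]
        exact g2 i hij

theorem exists_transport_perm {N : ℕ} (J : Finset (Fin N)) :
    ∃ π : Equiv.Perm (Fin N),
      (∀ (S : ℕ → Fin N → Fin N → Op N) (Φ : Equiv.Perm (Fin N) → State N), ExchangeS S Φ →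
        (transportS S J).mulVec (Φ 1) = Φ π) ∧
      ∀ p : Fin N, π p ∈ J ↔ (p : ℕ) < J.card := by
  classical
  obtain ⟨π, h1, -, h3⟩ := transport_list J (J.sort (fun a b => b ≤ a))
    (by
      have h1 := J.pairwise_sort (fun a b => b ≤ a)
      have h2 := J.sort_nodup (fun a b => b ≤ a)
      exact (h1.and h2).imp (fun ⟨a, b⟩ => lt_of_le_of_ne a b.symm))
    (fun x hx => (Finset.mem_sort _).1 hx) (fun x _ i hi _ => (Finset.mem_sort _).2 hi)
  refine ⟨π, h1, ?_⟩
  -- A line `i ∉ J` ends at the site `i + #{j ∈ J : i < j}`. At most `i` elements of `J` lie below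
  -- `i`, so this site is at least `J.card`.
  have hlt : ∀ p : Fin N, (p : ℕ) < J.card → π p ∈ J := by
    intro p hp
    by_contra hJ
    set i := π p with hi
    have hc : (J.filter fun j' => j' < i).card + (J.filter fun j' => i < j').card = J.card := by
      rw [← Finset.card_union_of_disjoint]
      · congr 1
        ext x
        simp only [Finset.mem_union, Finset.mem_filter]
        constructor
        · rintro (h | h) <;> exact h.1
        · intro hx
          rcases lt_trichotomy x i with h | h | h
          · exact Or.inl ⟨hx, h⟩
          · exact absurd (h ▸ hx) hJ
          · exact Or.inr ⟨hx, h⟩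
      · rw [Finset.disjoint_left]
        intro x hx hx'
        simp only [Finset.mem_filter] at hx hx'
        exact lt_asymm hx.2 hx'.2
    have hb : (J.filter fun j' => j' < i).card ≤ i := by
      calc _ ≤ (Finset.Iio i).card := Finset.card_le_card (fun x hx => by
              simpa using (Finset.mem_filter.1 hx).2)
        _ = i := Fin.card_Iio i
    have hcN : (i : ℕ) + (J.filter fun j' => i < j').card < N := by
      have : (J.filter fun j' => i < j').card ≤ (Finset.Ioi i).card :=
        Finset.card_le_card (fun x hx => by simpa using (Finset.mem_filter.1 hx).2)
      rw [Fin.card_Ioi] at this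
      have := i.2
      omega
    have := h3 i hJ ⟨_, hcN⟩ (by
      change (i : ℕ) + _ = _
      congr 2
      apply Finset.filter_congr
      intro x hx
      simp [Finset.mem_sort, hx])
    have := congrArg Fin.val (π.injective (this.trans hi))
    simp only at this
    omega
  intro p
  refine ⟨fun hp => ?_, hlt p⟩
  have himg : (Finset.univ.filter fun p : Fin N => (p : ℕ) < J.card).map π.toEmbedding = J := by
    apply Finset.eq_of_subset_of_card_le
    · intro x hx
      simp only [Finset.mem_map, Finset.mem_filter, Finset.mem_univ, true_and] at hx
      obtain ⟨p, hp, rfl⟩ := hx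
      exact hlt p hp
    · rw [Finset.card_map]
      have hJN : J.card ≤ N := by simpa using J.card_le_univ
      rw [Fin.card_filter_val_lt]
      exact le_min hJN le_rfl
  rw [← himg] at hp
  simp only [Finset.mem_map, Finset.mem_filter, Finset.mem_univ, true_and] at hp
  obtain ⟨p', hp', e⟩ := hp
  rw [← π.injective e]
  exact hp'

/-- The permutation that moves the lines in `J` to the front. -/
def front {N : ℕ} (J : Finset (Fin N)) : Equiv.Perm (Fin N) := (exists_transport_perm J).choose

theorem transportS_mulVec {N : ℕ} (J : Finset (Fin N)) {S : ℕ → Fin N → Fin N → Op N}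
    {Φ : Equiv.Perm (Fin N) → State N} (hΦ : ExchangeS S Φ) :
    (transportS S J).mulVec (Φ 1) = Φ (front J) :=
  (exists_transport_perm J).choose_spec.1 S Φ hΦ

theorem transport_mulVec {N : ℕ} (J : Finset (Fin N)) {q : ℂ} {U : Set (Fin N → ℂ)}
    {Ψ : (Fin N → ℂ) → State N} (hU : PermStable U) (hΨ : Exchange q U Ψ) {z : Fin N → ℂ}
    (hz : z ∈ U) : (transport N q J z).mulVec (Ψ z) = Ψ (z ∘ front J) :=
  transportS_mulVec J (S := fun k i j => siteR N q k (z i / z j)) (Φ := fun π => Ψ (z ∘ π))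
    fun k h π => hΨ k h (z ∘ π) (hU z hz π)

theorem front_mem {N : ℕ} (J : Finset (Fin N)) (p : Fin N) :
    front J p ∈ J ↔ (p : ℕ) < J.card :=
  (exists_transport_perm J).choose_spec.2 p

/-! ### Symmetrizers from Coxeter relations -/

section Coxeter
variable {A : Type*} [Ring A]

/-- The product `s (n - l) ⋯ s (n - 1)`. -/
def chain (s : ℕ → A) (n : ℕ) : ℕ → A
  | 0 => 1
  | l + 1 => s (n - (l + 1)) * chain s n l

/-- The sum of all permutations of the first `n` letters. -/
def symmetrizer (s : ℕ → A) : ℕ → A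
  | 0 => 1
  | n + 1 => (∑ l ∈ Finset.range (n + 1), chain s n l) * symmetrizer s n

variable {s : ℕ → A} {N : ℕ}

theorem chain_comm (hc : ∀ k l, k + 1 < l → l + 1 < N → s k * s l = s l * s k)
    {n : ℕ} (hn : n < N) (k l : ℕ) (hkl : k + 1 < n - l) (hl : l ≤ n) :
    s k * chain s n l = chain s n l * s k := by
  induction l with
  | zero => simp [chain]
  | succ l ih =>
    rw [chain, ← mul_assoc, hc k _ hkl (by omega), mul_assoc, ih (by omega) (by omega), mul_assoc]

/-- A generator inside the range of a descending cycle passes through it by a single braid move and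
comes out with its index lowered by one. -/
theorem chain_shift (hb : ∀ k, k + 1 + 1 < N → s k * s (k + 1) * s k = s (k + 1) * s k * s (k + 1))
    (hc : ∀ k l, k + 1 < l → l + 1 < N → s k * s l = s l * s k)
    {n : ℕ} (hn : n < N) (k l : ℕ) (hkl : n - l < k) (hk : k < n) (hl : l ≤ n) :
    s k * chain s n l = chain s n l * s (k - 1) := by
  induction l with
  | zero => omega
  | succ l ih =>
    by_cases h : n - l < k
    · rw [chain, ← mul_assoc, ← hc _ k (by omega) (by omega), mul_assoc, ih h (by omega),
        mul_assoc]
    · obtain ⟨l, rfl⟩ : ∃ l', l = l' + 1 := ⟨l - 1, by omega⟩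
      obtain ⟨k, rfl⟩ : ∃ k', k = k' + 1 := ⟨k - 1, by omega⟩
      have e1 : n - (l + 1 + 1) = k := by omega
      have e2 : n - (l + 1) = k + 1 := by omega
      rw [chain, chain, e1, e2, Nat.add_sub_cancel]
      calc s (k + 1) * (s k * (s (k + 1) * chain s n l))
          = s (k + 1) * s k * s (k + 1) * chain s n l := by simp only [mul_assoc]
        _ = s k * s (k + 1) * (s k * chain s n l) := by
            rw [← hb k (by omega)]; simp only [mul_assoc]
        _ = _ := by
            rw [chain_comm hc hn k l (by omega) (by omega)]; simp only [mul_assoc]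

/-- The chains are coset representatives of the first `n` letters in the first `n + 1`. Left
multiplication by a generator exchanges two of them and passes through the others, where the smaller
symmetrizer absorbs it. -/
theorem mul_symmetrizer (hs : ∀ k, k + 1 < N → s k * s k = 1)
    (hb : ∀ k, k + 1 + 1 < N → s k * s (k + 1) * s k = s (k + 1) * s k * s (k + 1))
    (hc : ∀ k l, k + 1 < l → l + 1 < N → s k * s l = s l * s k)
    (n : ℕ) (hn : n ≤ N) : ∀ k, k + 1 < n → s k * symmetrizer s n = symmetrizer s n := by
  induction n with
  | zero => intro k hk; omega
  | succ n ih =>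
    intro k hk
    have hn' : n < N := hn
    have ih' := ih (by omega)
    rw [symmetrizer, Finset.sum_mul, Finset.mul_sum]
    -- The chains of lengths `a` and `a + 1` differ exactly by the leading factor `s k`.
    set a := n - k - 1 with ha
    have hterm : ∀ l ∈ Finset.range (n + 1), s k * (chain s n l * symmetrizer s n) =
        chain s n (Equiv.swap a (a + 1) l) * symmetrizer s n := by
      intro l hl
      have hl' : l ≤ n := by simpa [Nat.lt_succ_iff] using hl
      rcases lt_trichotomy l a with h | h | h
      · rw [Equiv.swap_apply_of_ne_of_ne (by omega) (by omega), ← mul_assoc,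
          chain_comm hc hn' k l (by omega) hl', mul_assoc, ih' k (by omega)]
      · rw [h, Equiv.swap_apply_left, ← mul_assoc, chain]
        congr 3
        omega
      · by_cases h2 : l = a + 1
        · rw [h2, Equiv.swap_apply_right, ← mul_assoc, chain]
          have : n - (a + 1) = k := by omega
          rw [this, ← mul_assoc, hs k (by omega), one_mul]
        · rw [Equiv.swap_apply_of_ne_of_ne (by omega) (by omega), ← mul_assoc,
            chain_shift hb hc hn' k l (by omega) (by omega) hl', mul_assoc,
            ih' (k - 1) (by omega)]
    rw [Finset.sum_congr rfl hterm]
    refine Finset.sum_bij' (fun l _ => Equiv.swap a (a + 1) l) (fun l _ => Equiv.swap a (a + 1) l)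
      ?_ ?_ ?_ ?_ ?_
    · intro l hl
      simp only [Finset.mem_range] at hl ⊢
      rw [Equiv.swap_apply_def]
      split_ifs <;> omega
    · intro l hl
      simp only [Finset.mem_range] at hl ⊢
      rw [Equiv.swap_apply_def]
      split_ifs <;> omega
    · intro l _; simp
    · intro l _; simp
    · intro l _; rfl

end Coxeter

/-! ### Generic points and physical polynomials -/

/-- Points with nonzero distinct coordinates where no `R`-matrix is singular. -/
def dom (N : ℕ) (q : ℂ) : Set (Fin N → ℂ) :=
  {z | (∀ i, z i ≠ 0) ∧ ∀ i j, i ≠ j → z i ≠ z j ∧ q * z i - q⁻¹ * z j ≠ 0}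

theorem dom_permStable (N : ℕ) (q : ℂ) : PermStable (dom N q) := fun _ hz π =>
  ⟨fun i => hz.1 (π i), fun i j hij => hz.2 (π i) (π j) (π.injective.ne hij)⟩

/-- Polynomials in the coordinates with values in the spin-chain Hilbert space. -/
abbrev PolyState (N : ℕ) : Type := Config N → MvPolynomial (Fin N) ℂ

/-- The value of a polynomial vector at a point. -/
def evalV {N : ℕ} (z : Fin N → ℂ) (Ψ : PolyState N) : State N :=
  fun σ => MvPolynomial.eval z (Ψ σ)

/-- Physical polynomial vectors. -/
def Phys {N : ℕ} (q : ℂ) (Ψ : PolyState N) : Prop :=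
  Exchange q (dom N q) fun z => evalV z Ψ

/-! ### The twisted action of the symmetric group on functions -/

section twist
variable {N : ℕ} {q : ℂ}

/-- The permutation action on generic points. -/
def permDom (z : dom N q) (π : Equiv.Perm (Fin N)) : dom N q :=
  ⟨(z : Fin N → ℂ) ∘ π, dom_permStable N q z z.2 π⟩

/-- The twisted action of the transposition of the sites `k`, `k + 1` on vector-valued
functions. -/
def twist (N : ℕ) (q : ℂ) (k : ℕ) : Module.End ℂ (dom N q → State N) :=
  if h : k + 1 < N then
    { toFun := fun Φ z => (siteR N q k (z.1 ⟨k + 1, h⟩ / z.1 ⟨k, Nat.lt_of_succ_lt h⟩)).mulVec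
        (Φ (permDom z (adj k h)))
      map_add' := fun Φ Φ' => by funext z; simp [Matrix.mulVec_add]
      map_smul' := fun c Φ => by funext z; simp [Matrix.mulVec_smul] }
  else 1

theorem twist_apply (k : ℕ) (h : k + 1 < N) (Φ : dom N q → State N) (z : dom N q) :
    twist N q k Φ z = (siteR N q k (z.1 ⟨k + 1, h⟩ / z.1 ⟨k, Nat.lt_of_succ_lt h⟩)).mulVec
        (Φ (permDom z (adj k h))) := by
  simp [twist, h]

theorem dom_weight_ne (z : dom N q) {i j : Fin N} (hij : i ≠ j) :
    q * (z.1 i / z.1 j) - q⁻¹ ≠ 0 := by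
  have h1 := z.2.1 j
  have h2 := (z.2.2 i j hij).2
  intro h
  apply h2
  have : q * z.1 i - q⁻¹ * z.1 j = (q * (z.1 i / z.1 j) - q⁻¹) * z.1 j := by
    field_simp
  rw [this, h, zero_mul]

theorem permDom_permDom (z : dom N q) (π ρ : Equiv.Perm (Fin N)) :
    permDom (permDom z π) ρ = permDom z (π * ρ) := rfl

theorem permDom_one (z : dom N q) : permDom z 1 = z := rfl

theorem twist_sq (hq : q ≠ 0) (k : ℕ) (h : k + 1 < N) : twist N q k * twist N q k = 1 := by
  apply LinearMap.ext
  intro Φ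
  funext z
  rw [Module.End.mul_apply, twist_apply k h, twist_apply k h, permDom_permDom, adj_mul_self,
    permDom_one, Matrix.mulVec_mulVec]
  have e : (permDom z (adj k h)).1 ⟨k + 1, h⟩ / (permDom z (adj k h)).1 ⟨k, Nat.lt_of_succ_lt h⟩ =
      (z.1 ⟨k + 1, h⟩ / z.1 ⟨k, Nat.lt_of_succ_lt h⟩)⁻¹ := by
    simp [permDom, adj_left, adj_right]
  have hne : (⟨k + 1, h⟩ : Fin N) ≠ ⟨k, Nat.lt_of_succ_lt h⟩ := by simp
  rw [e, siteR_mul_inv k hq (div_ne_zero (z.2.1 _) (z.2.1 _)) (dom_weight_ne z hne)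
    (by rw [inv_div]; exact dom_weight_ne z hne.symm)]
  simp

/-- Applying the successive permutations makes the arguments of the three `R`-matrices exactly those
of the Yang–Baxter equation. -/
theorem twist_braid (hq : q ≠ 0) (k : ℕ) (h : k + 1 + 1 < N) :
    twist N q k * twist N q (k + 1) * twist N q k =
      twist N q (k + 1) * twist N q k * twist N q (k + 1) := by
  apply LinearMap.ext
  intro Φ
  funext z
  have hk : k + 1 < N := by omega
  simp only [Module.End.mul_apply, twist_apply k hk, twist_apply (k + 1) h, permDom_permDom,
    Matrix.mulVec_mulVec]
  rw [adj_braid k h]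
  congr 1
  have e1 : adj (k + 1) h ⟨k, by omega⟩ = ⟨k, by omega⟩ :=
    adj_of_ne _ _ _ (by simp) (by simp; omega)
  have e2 : adj k hk ⟨k + 1 + 1, h⟩ = ⟨k + 1 + 1, h⟩ :=
    adj_of_ne _ _ _ (by simp; omega) (by simp)
  simp only [permDom, Function.comp, Equiv.Perm.mul_apply, e1, e2, adj_left, adj_right]
  set a : Fin N := ⟨k, by omega⟩
  set b : Fin N := ⟨k + 1, by omega⟩
  set c : Fin N := ⟨k + 1 + 1, by omega⟩
  have hab : b ≠ a := by simp [a, b]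
  have hbc : c ≠ b := by simp [b, c]
  have hac : c ≠ a := by simp [a, c]; omega
  have huv : z.1 c / z.1 a = (z.1 b / z.1 a) * (z.1 c / z.1 b) := by
    have := z.2.1 a
    have := z.2.1 b
    field_simp
  have := dom_weight_ne z hac
  rw [huv] at this ⊢
  rw [← mul_assoc, ← mul_assoc, siteR_yang_baxter k h hq (dom_weight_ne z hab) (dom_weight_ne z hbc) this]

theorem twist_comm (k l : ℕ) (hkl : k + 1 < l) (hl : l + 1 < N) :
    twist N q k * twist N q l = twist N q l * twist N q k := by
  apply LinearMap.ext
  intro Φ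
  funext z
  have hk : k + 1 < N := by omega
  simp only [Module.End.mul_apply, twist_apply k hk, twist_apply l hl, permDom_permDom,
    Matrix.mulVec_mulVec]
  rw [adj_comm k l hkl hl]
  congr 1
  have e1 : adj l hl ⟨k, by omega⟩ = ⟨k, by omega⟩ :=
    adj_of_ne _ _ _ (by simp; omega) (by simp; omega)
  have e2 : adj l hl ⟨k + 1, hk⟩ = ⟨k + 1, hk⟩ :=
    adj_of_ne _ _ _ (by simp; omega) (by simp; omega)
  have e3 : adj k hk ⟨l, by omega⟩ = ⟨l, by omega⟩ :=
    adj_of_ne _ _ _ (by simp; omega) (by simp; omega)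
  have e4 : adj k hk ⟨l + 1, hl⟩ = ⟨l + 1, hl⟩ :=
    adj_of_ne _ _ _ (by simp; omega) (by simp; omega)
  simp only [permDom, Function.comp, e1, e2, e3, e4]
  exact siteR_comm k l hkl hl

theorem chain_twist_apply (n l : ℕ) (hn : n < N) (hl : l ≤ n) (Φ : dom N q → State N)
    (z : dom N q) : ∃ (A : Op N) (c : Equiv.Perm (Fin N)),
      chain (twist N q) n l Φ z = A.mulVec (Φ (permDom z c)) ∧
      (∀ p : Fin N, (p : ℕ) = n → (c p : ℕ) = n - l) ∧ ∀ p : Fin N, n < (p : ℕ) → c p = p := by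
  induction l generalizing z with
  | zero => exact ⟨1, 1, by simp [chain, permDom_one], fun p hp => by simpa using hp,
      fun _ _ => rfl⟩
  | succ l ih =>
    have hk : n - (l + 1) + 1 < N := by omega
    obtain ⟨A, c, h1, h2, h3⟩ := ih (by omega) (permDom z (adj (n - (l + 1)) hk))
    refine ⟨siteR N q (n - (l + 1)) (z.1 ⟨n - (l + 1) + 1, hk⟩ / z.1 ⟨n - (l + 1), by omega⟩) * A,
      adj (n - (l + 1)) hk * c, ?_, ?_, ?_⟩
    · rw [chain, Module.End.mul_apply, twist_apply _ hk, h1, Matrix.mulVec_mulVec, permDom_permDom]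
    · intro p hp
      have := h2 p hp
      have : c p = ⟨n - (l + 1) + 1, hk⟩ := Fin.ext (by simp only; omega)
      rw [Equiv.Perm.mul_apply, this, adj_right]
    · intro p hp
      rw [Equiv.Perm.mul_apply, h3 p hp, adj_of_ne _ _ _ (by omega) (by omega)]

theorem symmetrizer_twist_eq_zero (n : ℕ) (hn : n ≤ N) (Φ : dom N q → State N) (z : dom N q)
    (h : ∀ π : Equiv.Perm (Fin N), (∀ p : Fin N, n ≤ (p : ℕ) → π p = p) → Φ (permDom z π) = 0) :
    symmetrizer (twist N q) n Φ z = 0 := by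
  induction n generalizing z with
  | zero =>
    have := h 1 (fun _ _ => rfl)
    rwa [permDom_one] at this
  | succ n ih =>
    rw [symmetrizer, Module.End.mul_apply, LinearMap.sum_apply, Finset.sum_apply]
    apply Finset.sum_eq_zero
    intro l hl
    obtain ⟨A, c, h1, -, h3⟩ := chain_twist_apply n l (by omega)
      (by simpa [Nat.lt_succ_iff] using hl) (symmetrizer (twist N q) n Φ) z
    rw [h1, ih (by omega), Matrix.mulVec_zero]
    intro π hπ
    rw [permDom_permDom]
    apply h
    intro p hp
    rw [Equiv.Perm.mul_apply, hπ p (by omega), h3 p (by omega)]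

/-- A term with a nonempty chain moves the letter `n`, so it involves only values of `Φ` at
nontrivial permutations of `z`. Only the identity term survives. -/
theorem symmetrizer_twist_eq_self (n : ℕ) (hn : n ≤ N) (Φ : dom N q → State N) (z : dom N q)
    (h : ∀ π : Equiv.Perm (Fin N), π ≠ 1 → Φ (permDom z π) = 0) :
    symmetrizer (twist N q) n Φ z = Φ z := by
  induction n with
  | zero => rfl
  | succ n ih =>
    rw [symmetrizer, Module.End.mul_apply, LinearMap.sum_apply, Finset.sum_apply,
      Finset.sum_eq_single_of_mem 0 (by simp)]
    · rw [chain, Module.End.one_apply, ih (by omega)]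
    · intro l hl hl0
      obtain ⟨A, c, h1, h2, h3⟩ := chain_twist_apply n l (by omega)
        (by simpa [Nat.lt_succ_iff] using hl) (symmetrizer (twist N q) n Φ) z
      rw [h1, symmetrizer_twist_eq_zero n (by omega), Matrix.mulVec_zero]
      intro π hπ
      rw [permDom_permDom]
      apply h
      intro e
      have e1 : (c * π) ⟨n, by omega⟩ = ⟨n, by omega⟩ := by rw [e]; rfl
      rw [Equiv.Perm.mul_apply, hπ ⟨n, by omega⟩ le_rfl] at e1
      have e2 := h2 ⟨n, by omega⟩ rfl
      rw [e1] at e2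
      simp only at e2
      have : l ≤ n := by simpa [Nat.lt_succ_iff] using hl
      omega

end twist

/-! ### Zariski density of the generic points -/

section density
variable {N : ℕ} {q : ℂ}

/-- The polynomial `a X_i - b X_j`. -/
def linPoly (a b : ℂ) (i j : Fin N) : MvPolynomial (Fin N) ℂ :=
  MvPolynomial.C a * MvPolynomial.X i - MvPolynomial.C b * MvPolynomial.X j

@[simp] theorem eval_linPoly (a b : ℂ) (i j : Fin N) (z : Fin N → ℂ) :
    MvPolynomial.eval z (linPoly a b i j) = a * z i - b * z j := by
  simp [linPoly]

theorem linPoly_ne_zero {a b : ℂ} (ha : a ≠ 0) {i j : Fin N} (hij : i ≠ j) :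
    linPoly a b i j ≠ 0 := by
  intro h
  have := congrArg (MvPolynomial.eval (Pi.single i 1)) h
  simp [hij.symm] at this
  exact ha this

/-- The excluded points form the zero set of a nonzero polynomial. Multiplying `P` by it gives a
polynomial vanishing everywhere, hence zero, and the polynomial ring is a domain. -/
theorem eq_zero_of_eval_dom (hq : q ≠ 0) {D : MvPolynomial (Fin N) ℂ} (hD : D ≠ 0)
    {P : MvPolynomial (Fin N) ℂ}
    (h : ∀ z ∈ dom N q, MvPolynomial.eval z D ≠ 0 → MvPolynomial.eval z P = 0) : P = 0 := by
  classical
  set G : MvPolynomial (Fin N) ℂ := (∏ i, MvPolynomial.X i) *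
    ∏ p ∈ (Finset.univ : Finset (Fin N)).offDiag, linPoly 1 1 p.1 p.2 * linPoly q q⁻¹ p.1 p.2
    with hG
  have hG0 : G ≠ 0 := by
    refine mul_ne_zero (Finset.prod_ne_zero_iff.2 fun i _ => MvPolynomial.X_ne_zero i)
      (Finset.prod_ne_zero_iff.2 fun p hp => ?_)
    have := (Finset.mem_offDiag.1 hp).2.2
    exact mul_ne_zero (linPoly_ne_zero one_ne_zero this) (linPoly_ne_zero hq this)
  have : P * (G * D) = 0 := by
    apply MvPolynomial.funext
    intro z
    rw [map_mul, map_mul, map_zero]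
    by_cases hz : MvPolynomial.eval z G = 0
    · rw [hz]; ring
    · by_cases hz' : MvPolynomial.eval z D = 0
      · rw [hz']; ring
      · rw [h z _ hz', zero_mul]
        rw [hG, map_mul, map_prod, map_prod] at hz
        obtain ⟨h1, h2⟩ := mul_ne_zero_iff.1 hz
        rw [Finset.prod_ne_zero_iff] at h1 h2
        refine ⟨fun i => by simpa using h1 i (Finset.mem_univ i), fun i j hij => ?_⟩
        have := h2 (i, j) (by simp [hij])
        rw [map_mul, eval_linPoly, eval_linPoly] at this
        obtain ⟨h3, h4⟩ := mul_ne_zero_iff.1 this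
        exact ⟨fun e => h3 (by simp [e]), h4⟩
  exact (mul_eq_zero.1 this).resolve_right (mul_ne_zero hG0 hD)

theorem eq_of_eval_dom (hq : q ≠ 0) {P P' : MvPolynomial (Fin N) ℂ}
    (h : ∀ z ∈ dom N q, MvPolynomial.eval z P = MvPolynomial.eval z P') : P = P' :=
  sub_eq_zero.1 (eq_zero_of_eval_dom hq one_ne_zero fun z hz _ => by
    rw [map_sub, h z hz, sub_self])

end density

/-! ### Clearing denominators and constructing physical polynomials -/

section regular
variable {N : ℕ} {q : ℂ}

/-- The product of all `q z_i - q⁻¹ z_j`. -/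
def qDisc (N : ℕ) (q : ℂ) : MvPolynomial (Fin N) ℂ :=
  ∏ p ∈ (Finset.univ : Finset (Fin N)).offDiag, linPoly q q⁻¹ p.1 p.2

theorem eval_qDisc (z : Fin N → ℂ) : MvPolynomial.eval z (qDisc N q) =
    ∏ p ∈ (Finset.univ : Finset (Fin N)).offDiag, (q * z p.1 - q⁻¹ * z p.2) := by
  simp [qDisc, map_prod]

theorem eval_qDisc_perm (z : Fin N → ℂ) (π : Equiv.Perm (Fin N)) :
    MvPolynomial.eval (z ∘ π) (qDisc N q) = MvPolynomial.eval z (qDisc N q) := by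
  rw [eval_qDisc, eval_qDisc]
  refine Finset.prod_bij' (fun p _ => (π p.1, π p.2)) (fun p _ => (π.symm p.1, π.symm p.2))
    ?_ ?_ ?_ ?_ ?_
  · intro p hp; simpa using hp
  · intro p hp; simpa using hp
  · intro p _; simp
  · intro p _; simp
  · intro p _; simp

theorem eval_qDisc_ne_zero {z : Fin N → ℂ} (hz : z ∈ dom N q) :
    MvPolynomial.eval z (qDisc N q) ≠ 0 := by
  rw [eval_qDisc]
  exact Finset.prod_ne_zero_iff.2 fun p hp => (hz.2 _ _ (Finset.mem_offDiag.1 hp).2.2).2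

/-- Functions that are polynomial up to a power of `qDisc`. -/
def Reg (f : dom N q → ℂ) : Prop :=
  ∃ (K : ℕ) (P : MvPolynomial (Fin N) ℂ), ∀ z : dom N q,
    MvPolynomial.eval z.1 (qDisc N q) ^ K * f z = MvPolynomial.eval z.1 P

theorem Reg.of_poly (P : MvPolynomial (Fin N) ℂ) :
    Reg fun z : dom N q => MvPolynomial.eval z.1 P := ⟨0, P, by simp⟩

theorem Reg.add {f g : dom N q → ℂ} (hf : Reg f) (hg : Reg g) : Reg fun z => f z + g z := by
  obtain ⟨K, P, hP⟩ := hf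
  obtain ⟨L, P', hP'⟩ := hg
  refine ⟨K + L, qDisc N q ^ L * P + qDisc N q ^ K * P', fun z => ?_⟩
  rw [map_add, map_mul, map_mul, map_pow, map_pow, ← hP, ← hP']
  ring

theorem Reg.mul {f g : dom N q → ℂ} (hf : Reg f) (hg : Reg g) : Reg fun z => f z * g z := by
  obtain ⟨K, P, hP⟩ := hf
  obtain ⟨L, P', hP'⟩ := hg
  refine ⟨K + L, P * P', fun z => ?_⟩
  rw [map_mul, ← hP, ← hP']
  ring

theorem Reg.inv {i j : Fin N} (hij : i ≠ j) :
    Reg fun z : dom N q => (q * z.1 i - q⁻¹ * z.1 j)⁻¹ := by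
  refine ⟨1, ∏ p ∈ (Finset.univ : Finset (Fin N)).offDiag.erase (i, j), linPoly q q⁻¹ p.1 p.2,
    fun z => ?_⟩
  rw [pow_one, eval_qDisc, ← Finset.mul_prod_erase _ _ (show (i, j) ∈ _ by simpa using hij),
    map_prod]
  simp only [eval_linPoly]
  rw [mul_comm (q * z.1 i - q⁻¹ * z.1 j), mul_assoc, mul_inv_cancel₀ (z.2.2 i j hij).2, mul_one]

theorem Reg.perm {f : dom N q → ℂ} (hf : Reg f) (π : Equiv.Perm (Fin N)) :
    Reg fun z => f (permDom z π) := by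
  obtain ⟨K, P, hP⟩ := hf
  refine ⟨K, MvPolynomial.rename π P, fun z => ?_⟩
  have := hP (permDom z π)
  change MvPolynomial.eval (z.1 ∘ π) _ ^ K * _ = MvPolynomial.eval (z.1 ∘ π) P at this
  rw [eval_qDisc_perm] at this
  rw [this, MvPolynomial.eval_rename]

theorem Reg.const (c : ℂ) : Reg fun _ : dom N q => c := by
  simpa using Reg.of_poly (q := q) (MvPolynomial.C c : MvPolynomial (Fin N) ℂ)

theorem Reg.coord (i : Fin N) : Reg fun z : dom N q => z.1 i := by
  simpa using Reg.of_poly (q := q) (MvPolynomial.X i : MvPolynomial (Fin N) ℂ)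

/-- Vector-valued regular functions. -/
def RegV (Φ : dom N q → State N) : Prop := ∀ σ, Reg fun z => Φ z σ

theorem weight_div (q : ℂ) {x y : ℂ} (hy : y ≠ 0) :
    q * (x / y) - q⁻¹ = (q * x - q⁻¹ * y) / y := by
  field_simp

theorem fWeight_div (q : ℂ) {x y : ℂ} (hy : y ≠ 0) :
    fWeight q (x / y) = (x - y) * (q * x - q⁻¹ * y)⁻¹ := by
  rw [fWeight, weight_div q hy, div_div_eq_mul_div, sub_mul, div_mul_cancel₀ _ hy, one_mul,
    div_eq_mul_inv]

theorem gWeight_div (q : ℂ) {x y : ℂ} (hy : y ≠ 0) :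
    gWeight q (x / y) = (q - q⁻¹) * y * (q * x - q⁻¹ * y)⁻¹ := by
  rw [gWeight, weight_div q hy, div_div_eq_mul_div, div_eq_mul_inv]

theorem mul_gWeight_div (q : ℂ) {x y : ℂ} (hy : y ≠ 0) :
    x / y * gWeight q (x / y) = (q - q⁻¹) * x * (q * x - q⁻¹ * y)⁻¹ := by
  rw [gWeight_div q hy]
  field_simp

theorem RegV.twist {Φ : dom N q → State N} (hΦ : RegV Φ) (k : ℕ) : RegV (twist N q k Φ) := by
  by_cases h : k + 1 < N
  · intro σ
    have hne : (⟨k + 1, h⟩ : Fin N) ≠ ⟨k, Nat.lt_of_succ_lt h⟩ := by simp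
    have hf : Reg fun z : dom N q => fWeight q (z.1 ⟨k + 1, h⟩ / z.1 ⟨k, Nat.lt_of_succ_lt h⟩) := by
      simp only [fWeight_div q ((Subtype.prop _ : _ ∈ dom N q).1 _), sub_eq_add_neg]
      exact ((Reg.coord _).add (by simpa using (Reg.const (-1)).mul (Reg.coord _))).mul
        (by simpa [sub_eq_add_neg] using Reg.inv hne)
    have hg : Reg fun z : dom N q => gWeight q (z.1 ⟨k + 1, h⟩ / z.1 ⟨k, Nat.lt_of_succ_lt h⟩) := by
      simp only [gWeight_div q ((Subtype.prop _ : _ ∈ dom N q).1 _)]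
      exact ((Reg.const _).mul (Reg.coord _)).mul (Reg.inv hne)
    have hu : Reg fun z : dom N q => z.1 ⟨k + 1, h⟩ / z.1 ⟨k, Nat.lt_of_succ_lt h⟩ *
        gWeight q (z.1 ⟨k + 1, h⟩ / z.1 ⟨k, Nat.lt_of_succ_lt h⟩) := by
      simp only [mul_gWeight_div q ((Subtype.prop _ : _ ∈ dom N q).1 _)]
      exact ((Reg.const _).mul (Reg.coord _)).mul (Reg.inv hne)
    simp only [twist_apply k h, siteR_eq, siteMat_ice_mulVec k h]
    split_ifs
    · simpa using (hΦ σ).perm (adj k h)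
    · exact (hu.mul ((hΦ σ).perm _)).add (hf.mul ((hΦ _).perm _))
    · exact (hg.mul ((hΦ σ).perm _)).add (hf.mul ((hΦ _).perm _))
  · simpa [QHS.twist, h] using hΦ

theorem RegV.sum {ι : Type*} (s : Finset ι) {Φ : ι → dom N q → State N} (h : ∀ i ∈ s, RegV (Φ i)) :
    RegV (∑ i ∈ s, Φ i) := by
  classical
  induction s using Finset.induction_on with
  | empty => intro σ; simpa using Reg.const 0
  | insert i s hi ih =>
    rw [Finset.sum_insert hi]
    intro σ
    exact (h i (Finset.mem_insert_self _ _) σ).add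
      (ih (fun j hj => h j (Finset.mem_insert_of_mem hj)) σ)

theorem RegV.chain {Φ : dom N q → State N} (hΦ : RegV Φ) (n l : ℕ) :
    RegV (QHS.chain (QHS.twist N q) n l Φ) := by
  induction l with
  | zero => exact hΦ
  | succ l ih => exact ih.twist _

theorem RegV.symmetrizer {Φ : dom N q → State N} (hΦ : RegV Φ) (n : ℕ) :
    RegV (QHS.symmetrizer (QHS.twist N q) n Φ) := by
  induction n with
  | zero => exact hΦ
  | succ n ih =>
    rw [QHS.symmetrizer, Module.End.mul_apply, LinearMap.sum_apply]
    exact RegV.sum _ fun l _ => ih.chain n l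

theorem exchange_of_twist_eq (hq : q ≠ 0) {Φ : dom N q → State N}
    (h : ∀ k, k + 1 < N → twist N q k Φ = Φ) (k : ℕ) (hk : k + 1 < N) (z : dom N q) :
    Φ (permDom z (adj k hk)) =
      (siteR N q k (z.1 ⟨k, Nat.lt_of_succ_lt hk⟩ / z.1 ⟨k + 1, hk⟩)).mulVec (Φ z) := by
  have hne : (⟨k + 1, hk⟩ : Fin N) ≠ ⟨k, Nat.lt_of_succ_lt hk⟩ := by simp
  rw [show (siteR N q k (z.1 ⟨k, Nat.lt_of_succ_lt hk⟩ / z.1 ⟨k + 1, hk⟩)).mulVec (Φ z) =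
    (siteR N q k (z.1 ⟨k, Nat.lt_of_succ_lt hk⟩ / z.1 ⟨k + 1, hk⟩)).mulVec (twist N q k Φ z) by
      rw [h k hk], twist_apply k hk, Matrix.mulVec_mulVec, ← inv_div (z.1 ⟨k, _⟩),
    siteR_mul_inv k hq (div_ne_zero (z.2.1 _) (z.2.1 _)) (dom_weight_ne z hne.symm)
      (by rw [inv_div]; exact dom_weight_ne z hne), Matrix.one_mulVec]

/-- At every generic point the values of physical polynomial vectors exhaust the Hilbert space. -/
theorem exists_physical (hq : q ≠ 0) {z₀ : Fin N → ℂ} (hz₀ : z₀ ∈ dom N q) (v : State N) :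
    ∃ Ψ : PolyState N, Phys q Ψ ∧ evalV z₀ Ψ = v := by
  classical
  -- This polynomial separates the orbit of `z₀`: it is nonzero at `z₀`, and at a nontrivial
  -- permutation of `z₀` some coordinate `i` takes the value `z₀ j` with `j ≠ i`. Symmetrizing `φ •
  -- v` therefore does not change the value at `z₀`.
  set φ : MvPolynomial (Fin N) ℂ := ∏ p ∈ (Finset.univ : Finset (Fin N)).offDiag,
    (MvPolynomial.X p.1 - MvPolynomial.C (z₀ p.2)) with hφ
  have hφe : ∀ z, MvPolynomial.eval z φ =
      ∏ p ∈ (Finset.univ : Finset (Fin N)).offDiag, (z p.1 - z₀ p.2) := by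
    intro z; simp [hφ, map_prod]
  have hφ0 : MvPolynomial.eval z₀ φ ≠ 0 := by
    rw [hφe]
    exact Finset.prod_ne_zero_iff.2 fun p hp =>
      sub_ne_zero.2 (hz₀.2 _ _ (Finset.mem_offDiag.1 hp).2.2).1
  set Φ : dom N q → State N := fun z => MvPolynomial.eval z.1 φ • v with hΦ
  have hreg : RegV Φ := fun σ => (Reg.of_poly φ).mul (Reg.const (v σ))
  set S := symmetrizer (twist N q) N Φ with hS
  have hinv : ∀ k, k + 1 < N → twist N q k S = S := by
    intro k hk
    rw [hS, ← Module.End.mul_apply, mul_symmetrizer (fun k hk => twist_sq hq k hk)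
      (fun k hk => twist_braid hq k hk) (fun k l hkl hl => twist_comm k l hkl hl) N le_rfl k hk]
  have hval : S ⟨z₀, hz₀⟩ = Φ ⟨z₀, hz₀⟩ := by
    apply symmetrizer_twist_eq_self N le_rfl
    intro π hπ
    obtain ⟨i, hi⟩ : ∃ i, π i ≠ i := by
      by_contra hcon
      push Not at hcon
      exact hπ (Equiv.ext hcon)
    simp only [hΦ]
    rw [hφe, Finset.prod_eq_zero (i := (i, π i)) (by simpa using hi.symm) (by simp [permDom]),
      zero_smul]
  choose K P hKP using hreg.symmetrizer N
  -- A common exponent for all components. The denominator `qDisc` is permutation-invariant, so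
  -- multiplying by a power of it keeps the exchange relations.
  set L := ∑ σ, K σ with hL
  set Ψ : PolyState N := fun σ => qDisc N q ^ (L - K σ) * P σ with hΨ
  have hΨe : ∀ z : dom N q, evalV z.1 Ψ = MvPolynomial.eval z.1 (qDisc N q) ^ L • S z := by
    intro z
    funext σ
    have hKL : K σ ≤ L := Finset.single_le_sum (fun _ _ => Nat.zero_le _) (Finset.mem_univ σ)
    simp only [evalV, hΨ, Pi.smul_apply, smul_eq_mul]
    rw [map_mul, map_pow, ← hKP, ← mul_assoc, ← pow_add, Nat.sub_add_cancel hKL]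
  have hphys : Phys q Ψ := by
    intro k hk z hz
    have h1 := hΨe ⟨z, hz⟩
    have h2 := hΨe (permDom ⟨z, hz⟩ (adj k hk))
    simp only [permDom] at h1 h2
    simp only
    rw [h1, h2, Matrix.mulVec_smul, eval_qDisc_perm]
    congr 1
    exact exchange_of_twist_eq hq hinv k hk ⟨z, hz⟩
  set c := MvPolynomial.eval z₀ (qDisc N q) ^ L * MvPolynomial.eval z₀ φ with hc
  have hc0 : c ≠ 0 := mul_ne_zero (pow_ne_zero _ (eval_qDisc_ne_zero hz₀)) hφ0
  have hz : evalV z₀ Ψ = c • v := by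
    rw [hΨe ⟨z₀, hz₀⟩, hval, hc, mul_smul]
  have hsmul : ∀ z, evalV z (fun σ => MvPolynomial.C c⁻¹ * Ψ σ) = c⁻¹ • evalV z Ψ := by
    intro z; funext σ; simp [evalV]
  refine ⟨fun σ => MvPolynomial.C c⁻¹ * Ψ σ, ?_, ?_⟩
  · intro k hk z hzd
    simp only
    rw [hsmul, hsmul, Matrix.mulVec_smul]
    congr 1
    exact hphys k hk z hzd
  · rw [hsmul, hz, smul_smul, inv_mul_cancel₀ hc0, one_smul]

end regular

/-! ### Divisibility by the Vandermonde determinant -/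

section divisibility
variable {N : ℕ}

/-- The substitution `X_b ↦ X_a`. -/
def collapse (a b : Fin N) : MvPolynomial (Fin N) ℂ →ₐ[ℂ] MvPolynomial (Fin N) ℂ :=
  MvPolynomial.aeval fun i => MvPolynomial.X (if i = b then a else i)

theorem eval_collapse (a b : Fin N) (z : Fin N → ℂ) (P : MvPolynomial (Fin N) ℂ) :
    MvPolynomial.eval z (collapse a b P) =
      MvPolynomial.eval (fun i => z (if i = b then a else i)) P := by
  induction P using MvPolynomial.induction_on with
  | C c => simp [collapse]
  | add P P' h h' => rw [map_add, map_add, h, h', map_add]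
  | mul_X P i h =>
    rw [map_mul, map_mul, h, map_mul]
    simp [collapse]

theorem dvd_sub_collapse (a b : Fin N) (P : MvPolynomial (Fin N) ℂ) :
    MvPolynomial.X b - MvPolynomial.X a ∣ P - collapse a b P := by
  induction P using MvPolynomial.induction_on with
  | C c => simp [collapse]
  | add P P' h h' =>
    rw [map_add, add_sub_add_comm]
    exact dvd_add h h'
  | mul_X P i h =>
    have e : P * MvPolynomial.X i - collapse a b (P * MvPolynomial.X i) =
        (P - collapse a b P) * MvPolynomial.X i +
          collapse a b P * (MvPolynomial.X i - collapse a b (MvPolynomial.X i)) := by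
      rw [map_mul]; ring
    rw [e]
    refine dvd_add (Dvd.dvd.mul_right h _) (Dvd.dvd.mul_left ?_ _)
    by_cases hi : i = b
    · simp [collapse, hi]
    · simp [collapse, hi]

theorem collapse_self (a b : Fin N) :
    collapse a b (MvPolynomial.X b - MvPolynomial.X a) = 0 := by
  by_cases h : a = b <;> simp [collapse, h]

theorem dvd_iff_collapse (a b : Fin N) (P : MvPolynomial (Fin N) ℂ) :
    MvPolynomial.X b - MvPolynomial.X a ∣ P ↔ collapse a b P = 0 := by
  constructor
  · rintro ⟨Q, rfl⟩
    rw [map_mul, collapse_self, zero_mul]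
  · intro h
    have := dvd_sub_collapse a b P
    rwa [h, sub_zero] at this

/-- The multiples of this linear form are the kernel of the substitution `collapse a b`, whose
target is a domain. -/
theorem prime_X_sub_X {a b : Fin N} (hab : a ≠ b) :
    Prime (MvPolynomial.X b - MvPolynomial.X a : MvPolynomial (Fin N) ℂ) := by
  refine ⟨?_, ?_, ?_⟩
  · intro h
    have := congrArg (MvPolynomial.eval (Pi.single b 1)) h
    simp [hab] at this
  · intro h
    have h1 := (dvd_iff_collapse a b 1).1 h.dvd
    simp at h1
  · intro x y h
    rw [dvd_iff_collapse, map_mul, mul_eq_zero] at h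
    rwa [dvd_iff_collapse, dvd_iff_collapse]

/-- The Vandermonde determinant as a polynomial. -/
def vandPoly (N : ℕ) : MvPolynomial (Fin N) ℂ := (Matrix.vandermonde MvPolynomial.X).det

theorem vandPoly_eq : vandPoly N =
    ∏ p ∈ (Finset.univ : Finset (Fin N)).sigma fun i => Finset.Ioi i,
      (MvPolynomial.X p.2 - MvPolynomial.X p.1) := by
  rw [vandPoly, Matrix.det_vandermonde, Finset.prod_sigma]

theorem eval_vandPoly (z : Fin N → ℂ) :
    MvPolynomial.eval z (vandPoly N) = (Matrix.vandermonde z).det := by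
  rw [vandPoly, Matrix.det_vandermonde, Matrix.det_vandermonde, map_prod]
  simp [map_prod]

theorem eval_vandPoly_perm (z : Fin N → ℂ) (π : Equiv.Perm (Fin N)) :
    MvPolynomial.eval (z ∘ π) (vandPoly N) =
      ((Equiv.Perm.sign π : ℤ) : ℂ) * MvPolynomial.eval z (vandPoly N) := by
  rw [eval_vandPoly, eval_vandPoly, ← Matrix.det_permute]
  rfl

/-- The factors of the Vandermonde determinant are pairwise coprime primes, so it is enough to
divide by each of them separately. -/
theorem vandPoly_dvd {P : MvPolynomial (Fin N) ℂ}
    (h : ∀ a b : Fin N, a < b → ∀ z : Fin N → ℂ, z a = z b → MvPolynomial.eval z P = 0) :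
    vandPoly N ∣ P := by
  rw [vandPoly_eq]
  apply Finset.prod_dvd_of_isRelPrime
  · rintro ⟨a, b⟩ hp ⟨c, d⟩ hp' hne
    simp only [Finset.coe_sigma, Set.mem_sigma_iff, Finset.coe_univ, Set.mem_univ, true_and,
      Finset.coe_Ioi, Set.mem_Ioi] at hp hp'
    change IsRelPrime _ _
    rw [(prime_X_sub_X hp.ne).irreducible.isRelPrime_iff_not_dvd, dvd_iff_collapse]
    intro h0
    by_cases hc : c = a ∨ c = b
    · have hd : d ≠ a ∧ d ≠ b := by
        constructor
        · rintro rfl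
          rcases hc with rfl | rfl
          · exact lt_irrefl _ hp'
          · exact lt_asymm hp hp'
        · rintro rfl
          rcases hc with rfl | rfl
          · exact hne rfl
          · exact lt_irrefl _ hp'
      have := congrArg (MvPolynomial.eval (Pi.single d 1)) h0
      rw [eval_collapse] at this
      have hcd : (if c = b then a else c) ≠ d := by
        split_ifs
        · exact hd.1.symm
        · exact hp'.ne
      simp [hd.2, hcd] at this
    · push Not at hc
      have := congrArg (MvPolynomial.eval (Pi.single c 1)) h0
      rw [eval_collapse] at this
      have hcd : (if d = b then a else d) ≠ c := by
        split_ifs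
        · exact hc.1.symm
        · exact hp'.ne'
      simp [hc.2, hcd] at this
  · rintro ⟨a, b⟩ hp
    simp only [Finset.mem_sigma, Finset.mem_univ, true_and, Finset.mem_Ioi] at hp
    rw [dvd_iff_collapse]
    apply MvPolynomial.funext
    intro z
    rw [eval_collapse, map_zero]
    apply h a b hp
    simp [hp.ne]

/-- The linear factor does not vanish identically on the hyperplane `z a = z b`; when `c = a` this
needs `q ≠ q⁻¹`. It can thus be cancelled after the substitution, where pointwise division would
fail on its zeros. -/
theorem eval_eq_zero_of_mul_linPoly {q : ℂ} (hq : q ≠ 0) (hq2 : q - q⁻¹ ≠ 0)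
    {P : MvPolynomial (Fin N) ℂ} {a b c : Fin N} (hcb : c ≠ b)
    (h : ∀ z : Fin N → ℂ, z a = z b → (q * z b - q⁻¹ * z c) * MvPolynomial.eval z P = 0)
    (z : Fin N → ℂ) (hz : z a = z b) : MvPolynomial.eval z P = 0 := by
  have h1 : collapse a b (linPoly q q⁻¹ b c) * collapse a b P = 0 := by
    apply MvPolynomial.funext
    intro w
    rw [map_mul, eval_collapse, eval_collapse, eval_linPoly, map_zero]
    have h0 := h (fun i => w (if i = b then a else i)) (by by_cases hab : a = b <;> simp [hab])
    exact h0
  have h2 : collapse a b (linPoly q q⁻¹ b c) ≠ 0 := by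
    intro h0
    have := congrArg (MvPolynomial.eval (Pi.single a 1)) h0
    rw [eval_collapse, eval_linPoly, map_zero] at this
    by_cases hca : c = a
    · simp [hca] at this
      exact hq2 (by simpa [sub_eq_zero] using this)
    · simp [hcb, hca] at this
      exact hq this
  have h3 := (mul_eq_zero.1 h1).resolve_left h2
  have h4 := congrArg (MvPolynomial.eval z) h3
  rw [eval_collapse, map_zero] at h4
  have h5 : (fun i => z (if i = b then a else i)) = z := by
    funext i
    split_ifs with hi
    · rw [hi, hz]
    · rfl
  rwa [h5] at h4

/-- Up to sign each pair with exactly one member in `J` contributes one Vandermonde factor. The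
proof pads all other pairs with the factor `1`. -/
theorem prod_cross_dvd_vandPoly (J : Finset (Fin N)) :
    (∏ j ∈ J, ∏ i ∈ Jᶜ, (MvPolynomial.X j - MvPolynomial.X i : MvPolynomial (Fin N) ℂ)) ∣
      vandPoly N := by
  classical
  set g : Fin N → Fin N → MvPolynomial (Fin N) ℂ := fun y x =>
    if x ∈ J ∧ y ∉ J then MvPolynomial.X x - MvPolynomial.X y else 1 with hg
  have e1 : (∏ j ∈ J, ∏ i ∈ Jᶜ, (MvPolynomial.X j - MvPolynomial.X i : MvPolynomial (Fin N) ℂ)) =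
      ∏ j, ∏ i ∈ {j}ᶜ, g i j := by
    rw [← Finset.prod_subset (Finset.subset_univ J)]
    · apply Finset.prod_congr rfl
      intro j hj
      rw [← Finset.prod_subset (s₁ := Jᶜ) (s₂ := {j}ᶜ)]
      · apply Finset.prod_congr rfl
        intro i hi
        simp [hg, hj, Finset.mem_compl.1 hi]
      · intro i hi
        simp only [Finset.mem_compl, Finset.mem_singleton] at hi ⊢
        rintro rfl
        exact hi hj
      · intro i _ hi
        simp only [Finset.mem_compl, not_not] at hi
        simp [hg, hi]
    · intro j _ hj
      apply Finset.prod_eq_one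
      intro i _
      simp [hg, hj]
  rw [e1, ← Finset.prod_prod_Ioi_mul_eq_prod_prod_off_diag, vandPoly, Matrix.det_vandermonde]
  apply Finset.prod_dvd_prod_of_dvd
  intro i _
  apply Finset.prod_dvd_prod_of_dvd
  intro j _
  simp only [hg]
  by_cases h1 : i ∈ J <;> by_cases h2 : j ∈ J <;> simp [h1, h2]
  rw [← neg_sub]
  exact (neg_dvd).2 dvd_rfl

end divisibility

/-! ### Polynomial form of the exchange relations -/

section exchange
variable {N : ℕ} {q : ℂ}

/-- The polynomial matrix `(q z_k - q⁻¹ z_{k+1}) R(z_k / z_{k+1})` applied to a polynomial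
vector. -/
def exPoly (q : ℂ) (k : ℕ) (h : k + 1 < N) (X : PolyState N) : PolyState N := fun σ =>
  if σ ⟨k, Nat.lt_of_succ_lt h⟩ = σ ⟨k + 1, h⟩ then
    linPoly q q⁻¹ ⟨k, Nat.lt_of_succ_lt h⟩ ⟨k + 1, h⟩ * X σ
  else
    (if σ ⟨k, Nat.lt_of_succ_lt h⟩ = 0 then
        MvPolynomial.C (q - q⁻¹) * MvPolynomial.X ⟨k, Nat.lt_of_succ_lt h⟩
      else MvPolynomial.C (q - q⁻¹) * MvPolynomial.X ⟨k + 1, h⟩) * X σ +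
      linPoly 1 1 ⟨k, Nat.lt_of_succ_lt h⟩ ⟨k + 1, h⟩ * X (σ ∘ adj k h)

theorem evalV_exPoly (k : ℕ) (h : k + 1 < N) (X : PolyState N) {z : Fin N → ℂ}
    (hz : z ∈ dom N q) :
    evalV z (exPoly q k h X) =
      (q * z ⟨k, Nat.lt_of_succ_lt h⟩ - q⁻¹ * z ⟨k + 1, h⟩) •
        (siteR N q k (z ⟨k, Nat.lt_of_succ_lt h⟩ / z ⟨k + 1, h⟩)).mulVec (evalV z X) := by
  funext σ
  have hy := hz.1 ⟨k + 1, h⟩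
  have hD := (hz.2 ⟨k, Nat.lt_of_succ_lt h⟩ ⟨k + 1, h⟩ (by simp)).2
  simp only [Pi.smul_apply, smul_eq_mul, siteR_eq, siteMat_ice_mulVec k h,
    fWeight_div q hy, mul_gWeight_div q hy, evalV, exPoly]
  simp only [gWeight_div q hy]
  split_ifs
  · simp
  all_goals
    simp only [map_add, map_mul, eval_linPoly, MvPolynomial.eval_C, MvPolynomial.eval_X]
    rw [mul_add]
    congr 1
    · rw [mul_comm _ (q * _ - _)⁻¹, ← mul_assoc, ← mul_assoc, mul_inv_cancel₀ hD, one_mul]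
    · rw [mul_comm _ (q * _ - _)⁻¹, ← mul_assoc, ← mul_assoc, mul_inv_cancel₀ hD, one_mul]
      ring

/-- The polynomial identity behind the exchange relations, up to a factor. -/
def PolyExchange (q ε : ℂ) (X : PolyState N) : Prop :=
  ∀ (k : ℕ) (h : k + 1 < N) (z : Fin N → ℂ),
    (q * z ⟨k, Nat.lt_of_succ_lt h⟩ - q⁻¹ * z ⟨k + 1, h⟩) • evalV (z ∘ adj k h) X =
      ε • evalV z (exPoly q k h X)

/-- With denominators cleared, the exchange relation is a polynomial identity, so density extends it
to all points, including those with coinciding coordinates that the divisibility argument needs. -/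
theorem polyExchange_of_generic (hq : q ≠ 0) {ε : ℂ} {X : PolyState N}
    {D : MvPolynomial (Fin N) ℂ} (hD : D ≠ 0)
    (hX : ∀ (k : ℕ) (h : k + 1 < N), ∀ z ∈ dom N q, MvPolynomial.eval z D ≠ 0 →
      evalV (z ∘ adj k h) X = ε • (siteR N q k
        (z ⟨k, Nat.lt_of_succ_lt h⟩ / z ⟨k + 1, h⟩)).mulVec (evalV z X)) :
    PolyExchange q ε X := by
  intro k h z
  funext σ
  have : linPoly q q⁻¹ ⟨k, Nat.lt_of_succ_lt h⟩ ⟨k + 1, h⟩ * MvPolynomial.rename (adj k h) (X σ) -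
      MvPolynomial.C ε * exPoly q k h X σ = 0 := by
    apply eq_zero_of_eval_dom hq hD
    intro w hw hwD
    have h1 := congrFun (hX k h w hw hwD) σ
    have h2 := congrFun (evalV_exPoly k h X hw) σ
    simp only [evalV, Pi.smul_apply, smul_eq_mul] at h1 h2
    rw [map_sub, map_mul, map_mul, eval_linPoly, MvPolynomial.eval_rename, MvPolynomial.eval_C,
      h1, h2]
    ring
  have h1 := congrArg (MvPolynomial.eval z) this
  rw [map_sub, map_mul, map_mul, eval_linPoly, MvPolynomial.eval_rename, MvPolynomial.eval_C,
    map_zero, sub_eq_zero] at h1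
  exact h1

theorem PolyExchange.exchange {ε : ℂ} {X : PolyState N} (hX : PolyExchange q ε X) (k : ℕ)
    (h : k + 1 < N) {z : Fin N → ℂ} (hz : z ∈ dom N q) :
    evalV (z ∘ adj k h) X = ε • (siteR N q k
        (z ⟨k, Nat.lt_of_succ_lt h⟩ / z ⟨k + 1, h⟩)).mulVec (evalV z X) := by
  have h1 := hX k h z
  have hD := (hz.2 ⟨k, Nat.lt_of_succ_lt h⟩ ⟨k + 1, h⟩ (by simp)).2
  rw [evalV_exPoly k h X hz, smul_comm ε] at h1
  exact smul_right_injective _ hD h1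

/-- At equal neighbouring coordinates the `R`-matrix is the identity, so a skew vector equals its
own negative. For distant coordinates an adjacent transposition brings them one step closer. -/
theorem PolyExchange.eval_eq_zero (hq : q ≠ 0) (hq2 : q - q⁻¹ ≠ 0) {X : PolyState N}
    (hX : PolyExchange q (-1) X) {a : Fin N} (b : ℕ) (hb : b < N) (hab : (a : ℕ) < b) :
    ∀ z : Fin N → ℂ, z a = z ⟨b, hb⟩ → evalV z X = 0 := by
  induction b with
  | zero => omega
  | succ k ih =>
    intro z hz
    funext σ
    have hk : k < N := by omega
    refine eval_eq_zero_of_mul_linPoly hq hq2 (a := a) (b := ⟨k + 1, hb⟩) (c := ⟨k, hk⟩)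
      (by simp) ?_ z hz
    intro z hz
    have h1 := congrFun (hX k hb (z ∘ adj k hb)) σ
    have h2 : (z ∘ adj k hb) ∘ adj k hb = z := by funext i; simp [adj_adj]
    rw [h2] at h1
    simp only [Function.comp, adj_left, adj_right] at h1
    by_cases hak : (a : ℕ) = k
    · have ha : a = ⟨k, hk⟩ := Fin.ext hak
      have hz' : z ∘ adj k hb = z := by
        funext i
        simp only [Function.comp]
        by_cases h3 : (i : ℕ) = k
        · have : i = ⟨k, hk⟩ := Fin.ext h3
          rw [this, adj_left, ← hz, ha]
        · by_cases h4 : (i : ℕ) = k + 1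
          · have : i = ⟨k + 1, hb⟩ := Fin.ext h4
            rw [this, adj_right, ← hz, ha]
          · rw [adj_of_ne k hb i h3 h4]
      change _ = (-1 : ℂ) * (evalV (z ∘ adj k hb) (exPoly q k hb X) σ) at h1
      rw [hz'] at h1
      have h5 : evalV z (exPoly q k hb X) σ =
          (q * z ⟨k + 1, hb⟩ - q⁻¹ * z ⟨k, hk⟩) * MvPolynomial.eval z (X σ) := by
        rw [ha] at hz
        simp only [evalV, exPoly]
        split_ifs
        all_goals
          simp only [map_add, map_mul, eval_linPoly, MvPolynomial.eval_C, MvPolynomial.eval_X, hz]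
          try ring
      rw [h5] at h1
      simp only [Pi.smul_apply, smul_eq_mul, evalV] at h1
      linear_combination (1 / 2) * h1
    · have h3 : evalV (z ∘ adj k hb) X = 0 := by
        apply ih hk (by omega)
        simp only [Function.comp]
        rw [adj_left, adj_of_ne k hb a hak (by omega), hz]
      have h4 : evalV (z ∘ adj k hb) (exPoly q k hb X) σ = 0 := by
        have h5 : ∀ τ, MvPolynomial.eval (z ∘ adj k hb) (X τ) = 0 := fun τ => congrFun h3 τ
        simp only [evalV, exPoly]
        split_ifs <;> simp only [map_add, map_mul, h5, mul_zero, add_zero]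
      change _ = (-1 : ℂ) * (evalV (z ∘ adj k hb) (exPoly q k hb X) σ) at h1
      rw [h4, mul_zero] at h1
      exact h1

end exchange

/-! ### Invariance under Young subgroups -/

section young
variable {N : ℕ} {α : Type*}

/-- A function on a permutation-stable set that is invariant under the adjacent transpositions of
the first `r` and of the last `N - r` coordinates is invariant under the Young subgroup. -/
theorem young_invariant {U : Set (Fin N → ℂ)} (hU : PermStable U) {G : (Fin N → ℂ) → α} {r : ℕ}
    (hG : ∀ (k : ℕ) (h : k + 1 < N), k + 1 ≠ r → ∀ y ∈ U, G (y ∘ adj k h) = G y)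
    (π : Equiv.Perm (Fin N)) (hπ : ∀ p : Fin N, (π p : ℕ) < r ↔ (p : ℕ) < r) :
    ∀ y ∈ U, G (y ∘ π) = G y := by
  have hmul : ∀ π ρ : Equiv.Perm (Fin N), (∀ y ∈ U, G (y ∘ π) = G y) →
      (∀ y ∈ U, G (y ∘ ρ) = G y) → ∀ y ∈ U, G (y ∘ (π * ρ : Equiv.Perm (Fin N))) = G y := by
    intro π ρ h1 h2 y hy
    have := h2 (y ∘ π) (hU y hy π)
    rw [h1 y hy] at this
    exact this
  -- A transposition inside one block is a conjugate of a shorter one by an adjacent transposition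
  -- of the same block.
  have hswap' : ∀ (d a : ℕ) (h : a + d + 1 < N), (a + d + 1 < r ∨ r ≤ a) → ∀ y ∈ U,
      G (y ∘ Equiv.swap (⟨a, by omega⟩ : Fin N) ⟨a + d + 1, h⟩) = G y := by
    intro d
    induction d with
    | zero =>
      intro a h hr y hy
      exact hG a h (by omega) y hy
    | succ d ih =>
      intro a h hr
      have h1 := ih a (by omega) (by omega)
      have h2 := hG (a + d + 1) h (by omega)
      have h3 := hmul _ _ (hmul _ _ h2 h1) h2
      have e : adj (a + d + 1) h * Equiv.swap (⟨a, by omega⟩ : Fin N) ⟨a + d + 1, by omega⟩ *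
          adj (a + d + 1) h = Equiv.swap (⟨a, by omega⟩ : Fin N) ⟨a + (d + 1) + 1, h⟩ := by
        have := Equiv.swap_apply_apply (adj (a + d + 1) h) (⟨a, by omega⟩ : Fin N)
          ⟨a + d + 1, by omega⟩
        rw [adj_left, adj_of_ne _ _ _ (by simp; omega) (by simp; omega)] at this
        exact this.symm
      rw [e] at h3
      exact h3
  have hswap : ∀ a b : Fin N, ((a : ℕ) < r ↔ (b : ℕ) < r) → ∀ y ∈ U,
      G (y ∘ Equiv.swap a b) = G y := by
    intro a b hab y hy
    rcases lt_trichotomy (a : ℕ) b with h | h | h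
    · obtain ⟨d, hd⟩ := Nat.exists_eq_add_of_lt h
      have := hswap' d a (by omega) (by omega) y hy
      have e : b = ⟨a + d + 1, by omega⟩ := Fin.ext hd
      rw [e]; exact this
    · rw [Fin.ext h, Equiv.swap_self]; rfl
    · obtain ⟨d, hd⟩ := Nat.exists_eq_add_of_lt h
      have := hswap' d b (by omega) (by omega) y hy
      have e : a = ⟨b + d + 1, by omega⟩ := Fin.ext hd
      rw [Equiv.swap_comm, e]; exact this
  -- Composing with the transposition of `x` and `π x` shrinks the support. Both letters lie in the
  -- same block because `π` preserves the blocks.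
  induction hn : π.support.card using Nat.strong_induction_on generalizing π with
  | _ n ih =>
    by_cases h1 : π = 1
    · intro y _; rw [h1]; rfl
    · obtain ⟨x, hx⟩ : ∃ x, π x ≠ x := by
        by_contra hcon
        push Not at hcon
        exact h1 (Equiv.ext hcon)
      have hlt := Equiv.Perm.card_support_swap_mul hx
      have hs := hswap x (π x) (hπ x).symm
      have hpr : ∀ p : Fin N, ((Equiv.swap x (π x) * π) p : ℕ) < r ↔ (p : ℕ) < r := by
        intro p
        rw [Equiv.Perm.mul_apply, ← hπ p, Equiv.swap_apply_def]
        split_ifs with h2 h3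
        · rw [h2]; exact hπ x
        · rw [h3]; exact (hπ x).symm
        · rfl
      have h2 := ih _ (hn ▸ hlt) (Equiv.swap x (π x) * π) hpr rfl
      have h3 := hmul _ _ hs h2
      rwa [← mul_assoc, Equiv.swap_mul_self, one_mul] at h3

theorem young_invariant' {U : Set (Fin N → ℂ)} (hU : PermStable U) {G : (Fin N → ℂ) → α} {r : ℕ}
    (hG : ∀ (k : ℕ) (h : k + 1 < N), k + 1 ≠ r → ∀ y ∈ U, G (y ∘ adj k h) = G y)
    (π ρ : Equiv.Perm (Fin N)) (J : Finset (Fin N)) (hπ : ∀ p : Fin N, π p ∈ J ↔ (p : ℕ) < r)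
    (hρ : ∀ p : Fin N, ρ p ∈ J ↔ (p : ℕ) < r) : ∀ y ∈ U, G (y ∘ π) = G (y ∘ ρ) := by
  intro y hy
  have := young_invariant hU hG (ρ⁻¹ * π) (fun p => by
    rw [← hρ, Equiv.Perm.mul_apply, ← Equiv.Perm.mul_apply, mul_inv_cancel, Equiv.Perm.one_apply, hπ]) (y ∘ ρ) (hU y hy ρ)
  rw [← this]
  congr 1
  funext i
  simp

end young

/-! ### The poles of the Macdonald coefficients -/

section polyfn
variable {N : ℕ} {q : ℂ}

/-- Functions that agree with a polynomial at generic points. -/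
def PolyFn (q : ℂ) (f : (Fin N → ℂ) → ℂ) : Prop :=
  ∃ P : MvPolynomial (Fin N) ℂ, ∀ z ∈ dom N q, f z = MvPolynomial.eval z P

theorem PolyFn.eval (P : MvPolynomial (Fin N) ℂ) : PolyFn q fun z => MvPolynomial.eval z P :=
  ⟨P, fun _ _ => rfl⟩

theorem PolyFn.congr {f g : (Fin N → ℂ) → ℂ} (hf : PolyFn q f) (h : ∀ z ∈ dom N q, g z = f z) :
    PolyFn q g := by
  obtain ⟨P, hP⟩ := hf
  exact ⟨P, fun z hz => (h z hz).trans (hP z hz)⟩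

theorem PolyFn.mul {f g : (Fin N → ℂ) → ℂ} (hf : PolyFn q f) (hg : PolyFn q g) :
    PolyFn q fun z => f z * g z := by
  obtain ⟨P, hP⟩ := hf
  obtain ⟨Q, hQ⟩ := hg
  exact ⟨P * Q, fun z hz => by simp only [hP z hz, hQ z hz, map_mul]⟩

theorem PolyFn.sum {ι : Type*} (s : Finset ι) {f : ι → (Fin N → ℂ) → ℂ}
    (hf : ∀ i ∈ s, PolyFn q (f i)) : PolyFn q fun z => ∑ i ∈ s, f i z := by
  choose! P hP using hf
  exact ⟨∑ i ∈ s, P i, fun z hz => by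
    rw [map_sum]; exact Finset.sum_congr rfl fun i hi => hP i hi z hz⟩

theorem PolyFn.const (c : ℂ) : PolyFn (N := N) q fun _ => c :=
  ⟨MvPolynomial.C c, fun z _ => by simp⟩

theorem PolyFn.coord (i : Fin N) : PolyFn q fun z => z i :=
  ⟨MvPolynomial.X i, fun z _ => by simp⟩

/-- Matrix-valued functions with polynomial entries. -/
def PolyOp (q : ℂ) (f : (Fin N → ℂ) → Op N) : Prop := ∀ σ τ, PolyFn q fun z => f z σ τ

theorem PolyOp.congr {f g : (Fin N → ℂ) → Op N} (hf : PolyOp q f)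
    (h : ∀ z ∈ dom N q, g z = f z) : PolyOp q g :=
  fun σ τ => (hf σ τ).congr fun z hz => by rw [h z hz]

theorem PolyOp.mul {f g : (Fin N → ℂ) → Op N} (hf : PolyOp q f) (hg : PolyOp q g) :
    PolyOp q fun z => f z * g z := fun σ τ => by
  simp only [Matrix.mul_apply]
  exact PolyFn.sum _ fun i _ => (hf σ i).mul (hg i τ)

theorem PolyOp.one : PolyOp (N := N) q fun _ => 1 := fun _ _ => PolyFn.const _

theorem PolyOp.list_prod_inv {ι : Type*} (l : List ι) (f : ι → (Fin N → ℂ) → ℂ)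
    (A : ι → (Fin N → ℂ) → Op N) (h : ∀ i ∈ l, PolyOp q fun z => f i z • (A i z)⁻¹) :
    PolyOp q fun z => (l.map fun i => f i z).prod • ((l.map fun i => A i z).prod)⁻¹ := by
  induction l with
  | nil => simpa using PolyOp.one
  | cons i l ih =>
    refine ((ih fun j hj => h j (List.mem_cons_of_mem _ hj)).mul (h i List.mem_cons_self)).congr
      fun z _ => ?_
    rw [List.map_cons, List.map_cons, List.prod_cons, List.prod_cons, Matrix.mul_inv_rev,
      smul_mul_smul_comm, mul_comm (f i z)]

theorem siteR_inv {k : ℕ} (hq : q ≠ 0) {z : Fin N → ℂ} (hz : z ∈ dom N q) {i j : Fin N}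
    (hij : i ≠ j) : (siteR N q k (z i / z j))⁻¹ = siteR N q k (z j / z i) := by
  apply Matrix.inv_eq_right_inv
  rw [← inv_div (z i) (z j)]
  exact siteR_mul_inv k hq (div_ne_zero (hz.1 _) (hz.1 _)) (dom_weight_ne ⟨z, hz⟩ hij)
    (by rw [inv_div]; exact dom_weight_ne ⟨z, hz⟩ hij.symm)

theorem PolyOp.siteR_inv (hq : q ≠ 0) (k : ℕ) {i j : Fin N} (hij : i ≠ j) :
    PolyOp q fun z : Fin N → ℂ => (q * z j - q⁻¹ * z i) • (siteR N q k (z i / z j))⁻¹ := by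
  have hL : PolyFn q fun z : Fin N → ℂ => (q * z j - q⁻¹ * z i) := by
    simpa using PolyFn.eval (q := q) (linPoly q q⁻¹ j i)
  have hf : PolyFn q fun z : Fin N → ℂ => (q * z j - q⁻¹ * z i) * fWeight q (z j / z i) := by
    refine (PolyFn.eval (q := q) (linPoly 1 1 j i)).congr fun z hz => ?_
    rw [fWeight_div q (hz.1 i), mul_comm (z j - z i), ← mul_assoc,
      mul_inv_cancel₀ (hz.2 j i hij.symm).2]
    simp
  have hg : PolyFn q fun z : Fin N → ℂ => (q * z j - q⁻¹ * z i) * gWeight q (z j / z i) := by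
    refine ((PolyFn.const (q - q⁻¹)).mul (PolyFn.coord i)).congr fun z hz => ?_
    rw [gWeight_div q (hz.1 i), mul_comm ((q - q⁻¹) * _), ← mul_assoc,
      mul_inv_cancel₀ (hz.2 j i hij.symm).2, one_mul]
  have hu : PolyFn q fun z : Fin N → ℂ =>
      (q * z j - q⁻¹ * z i) * (z j / z i * gWeight q (z j / z i)) := by
    refine ((PolyFn.const (q - q⁻¹)).mul (PolyFn.coord j)).congr fun z hz => ?_
    rw [mul_gWeight_div q (hz.1 i), mul_comm ((q - q⁻¹) * _), ← mul_assoc,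
      mul_inv_cancel₀ (hz.2 j i hij.symm).2, one_mul]
  refine PolyOp.congr (f := fun z => (q * z j - q⁻¹ * z i) • siteR N q k (z j / z i)) ?_
    fun z hz => by rw [QHS.siteR_inv hq hz hij]
  intro σ τ
  simp only [Matrix.smul_apply, smul_eq_mul, siteR_eq, siteMat]
  split_ifs with h
  · simp only [Matrix.of_apply]
    split_ifs
    · generalize finProdFinEquiv (σ ⟨k, Nat.lt_of_succ_lt h⟩, σ ⟨k + 1, h⟩) = x
      generalize finProdFinEquiv (τ ⟨k, Nat.lt_of_succ_lt h⟩, τ ⟨k + 1, h⟩) = y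
      have h0 : PolyFn q fun _ : Fin N → ℂ => (0 : ℂ) := PolyFn.const 0
      fin_cases x <;> fin_cases y <;> simp [ice] <;> assumption
    · simpa using PolyFn.const 0
  · exact hL.mul (PolyFn.const _)

/-- The inverse of the `R`-matrix at `z i / z j` is the one at `z j / z i`, whose denominator is the
numerator factor of `A_J` for the pair `(j, i)`. Pairs that are never crossed leave polynomial
factors. -/
theorem PolyOp.coeffA_transport_inv (hq : q ≠ 0) (J : Finset (Fin N)) :
    PolyOp q fun z => (∏ j ∈ J, ∏ i ∈ Jᶜ, (q * z j - q⁻¹ * z i)) • (transport N q J z)⁻¹ := by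
  classical
  have hL : ∀ i j : Fin N, PolyFn q fun z : Fin N → ℂ => (q * z j - q⁻¹ * z i) := fun i j => by
    simpa using PolyFn.eval (q := q) (linPoly q q⁻¹ j i)
  have hprod : ∀ (s : Finset (Fin N)) (j : Fin N), PolyFn q fun z : Fin N → ℂ =>
      ∏ i ∈ s, (q * z j - q⁻¹ * z i) := fun s j => by
    refine (PolyFn.eval (q := q) (∏ i ∈ s, linPoly q q⁻¹ j i)).congr fun z _ => ?_
    simp [map_prod]
  have hlayer : ∀ j ∈ J, PolyOp q fun z => (∏ i ∈ Jᶜ, (q * z j - q⁻¹ * z i)) •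
      (layer N q J z j)⁻¹ := by
    intro j hj
    set l := (List.finRange N).filter fun i : Fin N => i < j ∧ i ∉ J with hl
    have h1 := PolyOp.list_prod_inv l (fun i z => q * z j - q⁻¹ * z i) (fun i z =>
      siteR N q ((i : ℕ) + (J.filter fun j' => i < j' ∧ j' < j).card) (z i / z j))
      (fun i hi => by
        have : i < j := by
          have := (List.mem_filter.1 hi).2
          simp at this
          exact this.1
        exact PolyOp.siteR_inv hq _ this.ne)
    have h2 : ∀ z : Fin N → ℂ, (∏ i ∈ Jᶜ, (q * z j - q⁻¹ * z i)) =
        (∏ i ∈ Jᶜ.filter (fun i => ¬ i < j), (q * z j - q⁻¹ * z i)) *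
          (l.map fun i => q * z j - q⁻¹ * z i).prod := by
      intro z
      rw [← List.prod_toFinset _ ((List.nodup_finRange N).filter _),
        ← Finset.prod_filter_mul_prod_filter_not Jᶜ (fun i => i < j), mul_comm]
      congr 1
      apply Finset.prod_congr _ fun _ _ => rfl
      ext i
      simp [and_comm]
    intro σ τ
    refine ((hprod (Jᶜ.filter fun i => ¬ i < j) j).mul (h1 σ τ)).congr fun z _ => ?_
    simp only
    rw [h2 z, Matrix.smul_apply, Matrix.smul_apply, smul_eq_mul, smul_eq_mul, mul_assoc]
    rfl
  have h1 := PolyOp.list_prod_inv (J.sort (fun a b => b ≤ a))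
    (fun j z => ∏ i ∈ Jᶜ, (q * z j - q⁻¹ * z i)) (fun j z => layer N q J z j)
    (fun j hj => hlayer j ((Finset.mem_sort _).1 hj))
  refine h1.congr fun z _ => ?_
  rw [← List.prod_toFinset _ (Finset.sort_nodup _ _), Finset.sort_toFinset]
  rfl

theorem PolyFn.vand_mul_coeffA (hq : q ≠ 0) (J : Finset (Fin N)) (σ τ : Config N) :
    PolyFn q fun z => MvPolynomial.eval z (vandPoly N) *
      (coeffA N q J z * (transport N q J z)⁻¹ σ τ) := by
  obtain ⟨E, hE⟩ := prod_cross_dvd_vandPoly J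
  refine ((PolyFn.eval E).mul (PolyOp.coeffA_transport_inv hq J σ τ)).congr fun z hz => ?_
  have h1 : coeffA N q J z = (∏ j ∈ J, ∏ i ∈ Jᶜ, (q * z j - q⁻¹ * z i)) /
      ∏ j ∈ J, ∏ i ∈ Jᶜ, (z j - z i) := by
    simp only [coeffA, Finset.prod_div_distrib]
  have h2 : (∏ j ∈ J, ∏ i ∈ Jᶜ, (z j - z i)) ≠ 0 := by
    refine Finset.prod_ne_zero_iff.2 fun j hj => Finset.prod_ne_zero_iff.2 fun i hi => ?_
    refine sub_ne_zero.2 (hz.2 j i ?_).1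
    rintro rfl
    exact Finset.mem_compl.1 hi hj
  simp only [hE, map_mul, map_prod, h1, Matrix.smul_apply, smul_eq_mul, map_sub,
    MvPolynomial.eval_X]
  field_simp

end polyfn

/-! ### Coset sums preserve physical polynomials -/

section macdonald
variable {N : ℕ} {q : ℂ}

/-- The sum `∑_J A_J R_J⁻¹ Θ(z_J, z_{Jᶜ})` over the subsets of size `r`. -/
def cosetSum (N : ℕ) (q : ℂ) (r : ℕ) (Θ : PolyState N) (z : Fin N → ℂ) : State N :=
  ∑ J ∈ (Finset.univ : Finset (Fin N)).powersetCard r,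
    coeffA N q J z • ((transport N q J z)⁻¹).mulVec (evalV (z ∘ front J) Θ)

theorem coeffA_perm (J : Finset (Fin N)) (z : Fin N → ℂ) (π : Equiv.Perm (Fin N)) :
    coeffA N q J (z ∘ π) = coeffA N q (J.map π.toEmbedding) z := by
  simp only [coeffA, Finset.prod_map]
  apply Finset.prod_congr rfl
  intro j _
  have : (J.map π.toEmbedding)ᶜ = Jᶜ.map π.toEmbedding := by
    ext i; simp
  rw [this, Finset.prod_map]
  rfl

/-- In a frame of physical vectors the vector `Θ` has coordinates invariant under the Young
subgroup, and transport merely permutes the arguments of the frame. The sum over `J` is thus a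
symmetrization over cosets. Its only possible poles are at coinciding coordinates, and they cancel
because its product with the Vandermonde determinant is a skew physical polynomial. -/
theorem exists_cosetSum (hq : q ≠ 0) (hq2 : q - q⁻¹ ≠ 0) (hdom : (dom N q).Nonempty) (r : ℕ)
    (Θ : PolyState N)
    (hΘ : ∀ (k : ℕ) (h : k + 1 < N), k + 1 ≠ r → ∀ z ∈ dom N q, evalV (z ∘ adj k h) Θ =
      (siteR N q k (z ⟨k, Nat.lt_of_succ_lt h⟩ / z ⟨k + 1, h⟩)).mulVec (evalV z Θ)) :
    ∃ Ψ : PolyState N, Phys q Ψ ∧ ∀ z ∈ dom N q, evalV z Ψ = cosetSum N q r Θ z := by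
  classical
  obtain ⟨z₀, hz₀⟩ := hdom
  choose Ψ hΨ hΨ0 using fun v => exists_physical hq hz₀ v
  set MP : Matrix (Config N) (Config N) (MvPolynomial (Fin N) ℂ) :=
    Matrix.of fun σ τ => Ψ (Pi.single τ 1) σ with hMP
  set M : (Fin N → ℂ) → Op N := fun z => Matrix.of fun σ τ => evalV z (Ψ (Pi.single τ 1)) σ
    with hM
  have hMe : ∀ z, MvPolynomial.eval z MP.det = (M z).det := fun z => by
    rw [RingHom.map_det]; rfl
  have hcol : ∀ z τ, (M z).col τ = evalV z (Ψ (Pi.single τ 1)) := fun _ _ => rfl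
  have hMmul : ∀ (A : Op N) (z w), (∀ τ, A.mulVec (evalV z (Ψ (Pi.single τ 1))) =
      evalV w (Ψ (Pi.single τ 1))) → A * M z = M w := by
    intro A z w h
    ext σ τ
    exact congrFun (h τ) σ
  have hD0 : MP.det ≠ 0 := by
    intro h
    have h1 := hMe z₀
    have h2 : M z₀ = 1 := by
      ext σ τ
      simp only [hM, Matrix.of_apply, hΨ0, Matrix.one_apply, Pi.single_apply]
    rw [h, h2, map_zero, Matrix.det_one] at h1
    exact zero_ne_one h1
  -- The product over all permutations makes the locus where the frame is invertible stable under
  -- permutations.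
  set D : MvPolynomial (Fin N) ℂ := ∏ π : Equiv.Perm (Fin N), MvPolynomial.rename π MP.det with hD
  have hDne : D ≠ 0 := Finset.prod_ne_zero_iff.2 fun π _ h =>
    hD0 (MvPolynomial.rename_injective _ π.injective (by rw [h, map_zero]))
  have hDe : ∀ z, MvPolynomial.eval z D = ∏ π : Equiv.Perm (Fin N), (M (z ∘ π)).det := fun z => by
    rw [hD, map_prod]
    exact Finset.prod_congr rfl fun π _ => by rw [MvPolynomial.eval_rename, hMe]
  set U : Set (Fin N → ℂ) := {z | z ∈ dom N q ∧ MvPolynomial.eval z D ≠ 0} with hUdef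
  have hUdet : ∀ z ∈ U, (M z).det ≠ 0 := fun z hz => by
    have := hz.2
    rw [hDe, Finset.prod_ne_zero_iff] at this
    simpa using this 1 (Finset.mem_univ _)
  have hU : PermStable U := by
    intro z hz π
    refine ⟨dom_permStable N q z hz.1 π, ?_⟩
    have h1 := hz.2
    rw [hDe, Finset.prod_ne_zero_iff] at h1 ⊢
    intro ρ _
    exact h1 (π * ρ) (Finset.mem_univ _)
  have hMinv : ∀ z ∈ U, ∀ v w, (M z).mulVec v = (M z).mulVec w → v = w := fun z hz v w h =>
    Matrix.mulVec_injective_of_isUnit ((Matrix.isUnit_iff_isUnit_det _).2 (hUdet z hz).isUnit) h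
  obtain ⟨G, hMG⟩ : ∃ G : (Fin N → ℂ) → State N,
      ∀ y ∈ U, (M y).mulVec (G y) = evalV y Θ := by
    refine ⟨fun y => (M y)⁻¹.mulVec (evalV y Θ), fun y hy => ?_⟩
    rw [Matrix.mulVec_mulVec, Matrix.mul_nonsing_inv _ (hUdet y hy).isUnit,
      Matrix.one_mulVec]
  have hadj : ∀ (k : ℕ) (h : k + 1 < N), ∀ z ∈ dom N q,
      siteR N q k (z ⟨k, Nat.lt_of_succ_lt h⟩ / z ⟨k + 1, h⟩) * M z = M (z ∘ adj k h) :=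
    fun k h z hz => hMmul _ _ _ fun τ => (hΨ _ k h z hz).symm
  have hGadj : ∀ (k : ℕ) (h : k + 1 < N), k + 1 ≠ r → ∀ y ∈ U, G (y ∘ adj k h) = G y := by
    intro k h hkr y hy
    apply hMinv _ (hU y hy (adj k h))
    rw [hMG _ (hU y hy (adj k h)), ← hadj k h y hy.1, ← Matrix.mulVec_mulVec, hMG y hy,
      hΘ k h hkr y hy.1]
  have hcoset : ∀ z ∈ U, cosetSum N q r Θ z =
      ∑ J ∈ (Finset.univ : Finset (Fin N)).powersetCard r,
        coeffA N q J z • (M z).mulVec (G (z ∘ front J)) := by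
    intro z hz
    apply Finset.sum_congr rfl
    intro J _
    congr 1
    have h1 : transport N q J z * M z = M (z ∘ front J) :=
      hMmul _ _ _ fun τ => transport_mulVec J (dom_permStable N q) (hΨ _) hz.1
    have h2 : IsUnit (transport N q J z).det := by
      have := congrArg Matrix.det h1
      rw [Matrix.det_mul] at this
      have h3 := hUdet _ (hU z hz (front J))
      rw [← this] at h3
      exact (left_ne_zero_of_mul h3).isUnit
    rw [← hMG _ (hU z hz (front J)), ← h1, Matrix.mulVec_mulVec, ← mul_assoc,
      Matrix.nonsing_inv_mul _ h2, one_mul]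
  -- The sum is reindexed by the image of `J`. The permutations `adj k h * front J` and `front` of
  -- the image send the first `r` sites to the same set, so they differ by an element of the Young
  -- subgroup, which `G` does not see.
  have hsym : ∀ (k : ℕ) (h : k + 1 < N), ∀ z ∈ U, cosetSum N q r Θ (z ∘ adj k h) =
      (siteR N q k (z ⟨k, Nat.lt_of_succ_lt h⟩ / z ⟨k + 1, h⟩)).mulVec (cosetSum N q r Θ z) := by
    intro k h z hz
    rw [hcoset z hz, hcoset _ (hU z hz (adj k h)), Matrix.mulVec_sum]
    have hinv : ∀ J : Finset (Fin N),
        (J.map (adj k h).toEmbedding).map (adj k h).toEmbedding = J := by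
      intro J
      ext i
      simp only [Finset.mem_map, Equiv.coe_toEmbedding, exists_exists_and_eq_and, adj_adj,
        exists_eq_right]
    refine Finset.sum_bij' (fun J _ => J.map (adj k h).toEmbedding)
      (fun J _ => J.map (adj k h).toEmbedding) ?_ ?_ ?_ ?_ ?_
    · intro J hJ
      simpa [Finset.mem_powersetCard] using hJ
    · intro J hJ
      simpa [Finset.mem_powersetCard] using hJ
    · intro J _; exact hinv J
    · intro J _; exact hinv J
    · intro J hJ
      have hJc : J.card = r := (Finset.mem_powersetCard.1 hJ).2
      rw [coeffA_perm, Matrix.mulVec_smul, Matrix.mulVec_mulVec, hadj k h z hz.1]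
      congr 2
      refine young_invariant' hU hGadj (adj k h * front J) _ (J.map (adj k h).toEmbedding)
        (fun p => ?_) (fun p => ?_) z hz
      · rw [Equiv.Perm.mul_apply, ← hJc, ← front_mem J p]
        simp
      · rw [front_mem, Finset.card_map, hJc]
  have hpoly : ∀ σ, PolyFn q fun z => MvPolynomial.eval z (vandPoly N) * cosetSum N q r Θ z σ := by
    intro σ
    refine PolyFn.congr (f := fun z => ∑ J ∈ (Finset.univ : Finset (Fin N)).powersetCard r,
      ∑ τ, MvPolynomial.eval z (vandPoly N) * (coeffA N q J z * (transport N q J z)⁻¹ σ τ) *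
        MvPolynomial.eval z (MvPolynomial.rename (front J) (Θ τ))) ?_ fun z _ => ?_
    · exact PolyFn.sum _ fun J _ => PolyFn.sum _ fun τ _ =>
        (PolyFn.vand_mul_coeffA hq J σ τ).mul (PolyFn.eval _)
    · rw [cosetSum, Finset.sum_apply, Finset.mul_sum]
      apply Finset.sum_congr rfl
      intro J _
      rw [Pi.smul_apply, smul_eq_mul, Matrix.mulVec, dotProduct, Finset.mul_sum, Finset.mul_sum]
      apply Finset.sum_congr rfl
      intro τ _
      rw [MvPolynomial.eval_rename, evalV]
      ring
  choose X hX using hpoly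
  have hXe : ∀ z ∈ dom N q, evalV z X =
      MvPolynomial.eval z (vandPoly N) • cosetSum N q r Θ z := fun z hz => by
    funext σ
    exact (hX σ z hz).symm
  have hXex : PolyExchange q (-1) X := by
    refine polyExchange_of_generic hq hDne fun k h z hz hzD => ?_
    rw [hXe z hz, hXe _ (dom_permStable N q z hz _), eval_vandPoly_perm, hsym k h z ⟨hz, hzD⟩,
      Matrix.mulVec_smul, smul_smul]
    congr 1
    rw [adj, Equiv.Perm.sign_swap (by simp)]
    simp
  have hdvd : ∀ σ, vandPoly N ∣ X σ := fun σ => vandPoly_dvd fun a b hab z hz =>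
    congrFun (hXex.eval_eq_zero hq hq2 b b.2 hab z hz) σ
  choose Y hY using hdvd
  have hV : ∀ z ∈ dom N q, MvPolynomial.eval z (vandPoly N) ≠ 0 := fun z hz => by
    rw [eval_vandPoly]
    exact Matrix.det_vandermonde_ne_zero_iff.2 fun i j hij => by
      by_contra hne
      exact (hz.2 i j hne).1 hij
  have hYe : ∀ z ∈ dom N q, evalV z Y = cosetSum N q r Θ z := by
    intro z hz
    have h1 := hXe z hz
    apply smul_right_injective _ (hV z hz)
    simp only
    rw [← h1]
    funext σ
    simp only [evalV, Pi.smul_apply, smul_eq_mul, hY σ, map_mul]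
  refine ⟨Y, ?_, hYe⟩
  have hYex : PolyExchange q 1 Y := by
    refine polyExchange_of_generic hq hDne fun k h z hz hzD => ?_
    rw [hYe z hz, hYe _ (dom_permStable N q z hz _), hsym k h z ⟨hz, hzD⟩, one_smul]
  intro k h z hz
  have := hYex.exchange k h hz
  rw [one_smul] at this
  exact this

end macdonald

/-! ### Transport as an analytic function of `q⁻¹` and the coordinate ratios -/

section analytic
variable {N : ℕ} {E : Type*} [NormedAddCommGroup E] [NormedSpace ℂ E]

/-- Operator-valued functions with analytic matrix entries. -/
def AnOp (F : E → Op N) (x : E) : Prop := ∀ σ τ, AnalyticAt ℂ (fun y => F y σ τ) x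

theorem AnOp.mul {F G : E → Op N} {x : E} (hF : AnOp F x) (hG : AnOp G x) :
    AnOp (fun y => F y * G y) x := by
  intro σ τ
  simp only [Matrix.mul_apply]
  exact Finset.analyticAt_fun_sum _ fun ρ _ => (hF σ ρ).mul (hG ρ τ)

theorem AnOp.const (A : Op N) (x : E) : AnOp (fun _ => A) x := fun _ _ => analyticAt_const

theorem AnOp.list_prod {ι : Type*} (l : List ι) {F : ι → E → Op N} {x : E}
    (hF : ∀ i ∈ l, AnOp (F i) x) : AnOp (fun y => (l.map fun i => F i y).prod) x := by
  induction l with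
  | nil => simpa using AnOp.const 1 x
  | cons i l ih =>
    simp only [List.map_cons, List.prod_cons]
    exact (hF i List.mem_cons_self).mul (ih fun j hj => hF j (List.mem_cons_of_mem _ hj))

theorem AnOp.det {F : E → Op N} {x : E} (hF : AnOp F x) :
    AnalyticAt ℂ (fun y => (F y).det) x := by
  simp only [Matrix.det_apply']
  exact Finset.analyticAt_fun_sum _ fun π _ =>
    analyticAt_const.mul (Finset.analyticAt_fun_prod _ fun σ _ => hF (π σ) σ)

theorem AnOp.inv {F : E → Op N} {x : E} (hF : AnOp F x) (hx : IsUnit (F x)) :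
    AnOp (fun y => (F y)⁻¹) x := by
  classical
  intro σ τ
  simp only [Matrix.inv_def, Matrix.smul_apply, smul_eq_mul, Ring.inverse_eq_inv,
    Matrix.adjugate_apply]
  refine (hF.det.inv ((Matrix.isUnit_iff_isUnit_det _).1 hx).ne_zero).mul (AnOp.det ?_)
  intro ρ ρ'
  simp only [Matrix.updateRow_apply]
  split_ifs
  · exact analyticAt_const
  · exact hF ρ ρ'

theorem AnOp.smul {F : E → Op N} {f : E → ℂ} {x : E} (hf : AnalyticAt ℂ f x) (hF : AnOp F x) :
    AnOp (fun y => f y • F y) x := fun σ τ => hf.mul (hF σ τ)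

theorem AnOp.sum {ι : Type*} (s : Finset ι) {F : ι → E → Op N} {x : E}
    (hF : ∀ i ∈ s, AnOp (F i) x) : AnOp (fun y => ∑ i ∈ s, F i y) x := by
  intro σ τ
  simp only [Matrix.sum_apply]
  exact Finset.analyticAt_fun_sum _ fun i hi => hF i hi σ τ

theorem AnOp.pow {F : E → Op N} {x : E} (hF : AnOp F x) (n : ℕ) : AnOp (fun y => F y ^ n) x := by
  induction n with
  | zero => simpa using AnOp.const 1 x
  | succ n ih => simpa only [pow_succ] using ih.mul hF

theorem AnOp.comp {E' : Type*} [NormedAddCommGroup E'] [NormedSpace ℂ E'] {F : E → Op N}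
    {f : E' → E} {x : E'} (hF : AnOp F (f x)) (hf : AnalyticAt ℂ f x) :
    AnOp (fun y => F (f y)) x := fun σ τ => (hF σ τ).comp_of_eq hf rfl

theorem AnOp.siteMat_ice (k : ℕ) {a b c : E → ℂ} {x : E} (ha : AnalyticAt ℂ a x)
    (hb : AnalyticAt ℂ b x) (hc : AnalyticAt ℂ c x) :
    AnOp (fun y => siteMat N k (ice 1 (a y) (b y) (c y))) x := by
  intro σ τ
  have h : ∀ s t : Fin 4, AnalyticAt ℂ (fun y => ice 1 (a y) (b y) (c y) s t) x := by
    intro s t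
    fin_cases s <;> fin_cases t <;> simp [ice] <;> first | assumption | exact analyticAt_const
  unfold siteMat
  by_cases hk : k + 1 < N
  · simp only [hk, dite_true, Matrix.of_apply]
    split_ifs
    · exact h _ _
    · exact analyticAt_const
  · simp only [hk, dite_false]
    exact analyticAt_const

end analytic

theorem siteMat_ice_mul_eq_one {N : ℕ} (k : ℕ) {a b c a' b' c' : ℂ}
    (h1 : a * a' + b * b' = 1) (h2 : a * b' + b * c' = 0) (h3 : c * b' + b * a' = 0)
    (h4 : c * c' + b * b' = 1) :
    siteMat N k (ice 1 a b c) * siteMat N k (ice 1 a' b' c') = 1 := by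
  by_cases h : k + 1 < N
  · apply op_ext
    intro v σ
    have hadj : (σ ∘ adj k h) ∘ adj k h = σ := by
      funext i; simp [adj_adj]
    rw [← Matrix.mulVec_mulVec, siteMat_ice_mulVec k h, siteMat_ice_mulVec k h,
      siteMat_ice_mulVec k h, hadj, Matrix.one_mulVec]
    simp only [Function.comp_apply, adj_left, adj_right]
    rcases fin2_cases (σ ⟨k, Nat.lt_of_succ_lt h⟩) with e1 | e1 <;>
      rcases fin2_cases (σ ⟨k + 1, h⟩) with e2 | e2 <;> simp [e1, e2]
    · linear_combination (v σ) * h1 + v (σ ∘ adj k h) * h2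
    · linear_combination (v σ) * h4 + v (σ ∘ adj k h) * h3
  · simp [siteMat, h]

/-- The `R`-matrix in terms of `Q = q⁻¹` and `v = u⁻¹`. -/
def rV (Q v : ℂ) : Matrix (Fin 4) (Fin 4) ℂ :=
  ice 1 ((1 - Q ^ 2) / (1 - Q ^ 2 * v)) (Q * (1 - v) / (1 - Q ^ 2 * v))
    (v * (1 - Q ^ 2) / (1 - Q ^ 2 * v))

/-- These variables give access to two limits: `q → ∞` becomes `Q = 0`, and widely separated
coordinates become ratio `0`. -/
theorem siteR_eq_rV {N : ℕ} {q x y : ℂ} (k : ℕ) (hq : q ≠ 0) (hx : x ≠ 0) (hy : y ≠ 0) :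
    siteR N q k (x / y) = siteMat N k (rV q⁻¹ (y / x)) := by
  have hc : q⁻¹ * (y / x) ≠ 0 := mul_ne_zero (inv_ne_zero hq) (div_ne_zero hy hx)
  rw [siteR_eq, rV]
  congr 2
  · rw [gWeight, ← mul_div_assoc, ← mul_div_mul_right _ _ hc]
    congr 1 <;> field_simp
  · rw [fWeight, ← mul_div_mul_right _ _ hc]
    congr 1 <;> field_simp
  · rw [gWeight, ← mul_div_mul_right _ _ hc]
    congr 1 <;> field_simp

theorem isUnit_siteMat_rV {N : ℕ} {Q v : ℂ} (k : ℕ) (h1 : 1 - Q ^ 2 * v ≠ 0)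
    (h2 : v - Q ^ 2 ≠ 0) : IsUnit (siteMat N k (rV Q v)) := by
  have : siteMat N k (rV Q v) * siteMat N k (ice 1 (v * (1 - Q ^ 2) / (v - Q ^ 2))
      (-(Q * (1 - v)) / (v - Q ^ 2)) ((1 - Q ^ 2) / (v - Q ^ 2))) = 1 := by
    have h3 : (1 - Q ^ 2 * v) * (v - Q ^ 2) ≠ 0 := mul_ne_zero h1 h2
    apply siteMat_ice_mul_eq_one <;> rw [div_mul_div_comm, div_mul_div_comm, ← add_div]
    · rw [div_eq_one_iff_eq h3]; ring
    · rw [div_eq_zero_iff]; left; ring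
    · rw [div_eq_zero_iff]; left; ring
    · rw [div_eq_one_iff_eq h3]; ring
  exact IsUnit.of_mul_eq_one _ this

/-- Spectral data: the value of `q⁻¹` and the ratios `z j / z i`. -/
abbrev Spec (N : ℕ) : Type := ℂ × (Fin N → Fin N → ℂ)

/-- The operator `transport` in terms of `q⁻¹` and the ratios `z j / z i`. -/
def transportV (N : ℕ) (J : Finset (Fin N)) (x : Spec N) : Op N :=
  transportS (fun k i j => siteMat N k (rV x.1 (x.2 i j))) J

/-- The spectral data at which all factors of the transport operators are regular. -/
def Good {N : ℕ} (x : Spec N) : Prop :=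
  ∀ i j, i < j → 1 - x.1 ^ 2 * x.2 i j ≠ 0 ∧ x.2 i j - x.1 ^ 2 ≠ 0

/-! ### Transport operators and their logarithmic derivatives -/

section transportV
variable {N : ℕ}

theorem layerS_congr {S S' : ℕ → Fin N → Fin N → Op N} {J : Finset (Fin N)} {j : Fin N}
    (h : ∀ k i, i < j → i ∉ J → S k i j = S' k i j) : layerS S J j = layerS S' J j := by
  unfold layerS
  congr 1
  apply List.map_congr_left
  intro i hi
  simp only [List.mem_filter, List.mem_finRange, true_and, decide_eq_true_eq] at hi
  exact h _ i hi.1 hi.2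

theorem transportS_congr {S S' : ℕ → Fin N → Fin N → Op N} {J : Finset (Fin N)}
    (h : ∀ k i j, i < j → i ∉ J → j ∈ J → S k i j = S' k i j) :
    transportS S J = transportS S' J := by
  unfold transportS
  congr 1
  apply List.map_congr_left
  intro j hj
  exact layerS_congr fun k i h1 h2 => h k i j h1 h2 ((Finset.mem_sort _).1 hj)

theorem isUnit_transportS {S : ℕ → Fin N → Fin N → Op N} {J : Finset (Fin N)}
    (h : ∀ k i j, i < j → IsUnit (S k i j)) : IsUnit (transportS S J) := by
  have hl : ∀ l : List (Op N), (∀ A ∈ l, IsUnit A) → IsUnit l.prod := by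
    intro l
    induction l with
    | nil => simp
    | cons A l ih =>
      intro hA
      rw [List.prod_cons]
      exact (hA A List.mem_cons_self).mul (ih fun B hB => hA B (List.mem_cons_of_mem _ hB))
  apply hl
  intro A hA
  obtain ⟨j, -, rfl⟩ := List.mem_map.1 hA
  apply hl
  intro B hB
  obtain ⟨i, hi, rfl⟩ := List.mem_map.1 hB
  simp only [List.mem_filter, List.mem_finRange, true_and, decide_eq_true_eq] at hi
  exact h _ i j hi.1

theorem isUnit_transportV (J : Finset (Fin N)) {x : Spec N} (hx : Good x) :
    IsUnit (transportV N J x) :=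
  isUnit_transportS fun k i j hij => isUnit_siteMat_rV k (hx i j hij).1 (hx i j hij).2

theorem transportV_congr {J : Finset (Fin N)} {x y : Spec N} (h1 : x.1 = y.1)
    (h : ∀ i j, i < j → i ∉ J → j ∈ J → x.2 i j = y.2 i j) :
    transportV N J x = transportV N J y :=
  transportS_congr fun k i j h2 h3 h4 => by rw [h1, h i j h2 h3 h4]

/-- The ratios `z j / z i`. -/
def ratio (z : Fin N → ℂ) : Fin N → Fin N → ℂ := fun i j => z j / z i

theorem transport_eq_transportV {q : ℂ} (hq : q ≠ 0) (J : Finset (Fin N)) {z : Fin N → ℂ}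
    (hz : ∀ i, z i ≠ 0) : transport N q J z = transportV N J (q⁻¹, ratio z) :=
  transportS_congr fun k i j _ _ _ => siteR_eq_rV k hq (hz i) (hz j)

theorem shift_ne_zero {p : ℂ} (hp : p ≠ 0) (J : Finset (Fin N)) {z : Fin N → ℂ}
    (hz : ∀ i, z i ≠ 0) (i : Fin N) : shift N p J z i ≠ 0 := by
  unfold shift
  split_ifs
  · exact mul_ne_zero hp (hz i)
  · exact hz i

/-- Every crossing in the transport involves a line of `J` and a line outside it, so shifting the
coordinates in `J` scales every relevant ratio by `p`. The derivative in `p` is thus a radial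
derivative in the ratios. -/
theorem transportV_shift (Q p : ℂ) (J : Finset (Fin N)) (z : Fin N → ℂ) :
    transportV N J (Q, ratio (shift N p J z)) = transportV N J (Q, p • ratio z) :=
  transportV_congr rfl fun i j _ hi hj => by
    simp [ratio, shift, hi, hj, mul_div_assoc]

theorem anOp_transportV (J : Finset (Fin N)) {x : Spec N} (hx : Good x) :
    AnOp (transportV N J) x := by
  have hsite : ∀ k i j, i < j → AnOp (fun y : Spec N => siteMat N k (rV y.1 (y.2 i j))) x := by
    intro k i j hij
    have hQ : AnalyticAt ℂ (fun y : Spec N => y.1) x := analyticAt_fst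
    have hv : AnalyticAt ℂ (fun y : Spec N => y.2 i j) x := by
      have h1 : AnalyticAt ℂ (fun y : Spec N => y.2) x := analyticAt_snd
      have h2 := (analyticAt_pi_iff.1 h1) i
      exact (analyticAt_pi_iff.1 h2) j
    have h1 : AnalyticAt ℂ (fun y : Spec N => 1 - y.1 ^ 2 * y.2 i j) x :=
      analyticAt_const.sub ((hQ.pow 2).mul hv)
    have hne := (hx i j hij).1
    apply AnOp.siteMat_ice
    · exact (analyticAt_const.sub (hQ.pow 2)).div h1 hne
    · exact (hQ.mul (analyticAt_const.sub hv)).div h1 hne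
    · exact (hv.mul (analyticAt_const.sub (hQ.pow 2))).div h1 hne
  apply AnOp.list_prod
  intro j _
  apply AnOp.list_prod
  intro i hi
  simp only [List.mem_filter, List.mem_finRange, true_and, decide_eq_true_eq] at hi
  exact hsite _ i j hi.1

/-- The derivative of `p ↦ transportV N J (Q, p • v)` at `p = 1`. -/
def dTransport (N : ℕ) (J : Finset (Fin N)) (x : Spec N) : Op N :=
  Matrix.of fun σ τ => fderiv ℂ (fun y : Spec N => transportV N J y σ τ) x (0, x.2)

/-- The logarithmic derivative of `p ↦ transportV N J (Q, p • v)` at `p = 1`. -/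
def logDer (N : ℕ) (J : Finset (Fin N)) (x : Spec N) : Op N :=
  (transportV N J x)⁻¹ * dTransport N J x

theorem anOp_dTransport (J : Finset (Fin N)) {x : Spec N} (hx : Good x) :
    AnOp (dTransport N J) x := by
  intro σ τ
  have h1 := (anOp_transportV J hx σ τ).fderiv
  have h2 : AnalyticAt ℂ (fun y : Spec N => ((0, y.2) : Spec N)) x :=
    analyticAt_const.prod analyticAt_snd
  exact (ContinuousLinearMap.analyticAt_bilinear
    (ContinuousLinearMap.apply ℂ ℂ : Spec N →L[ℂ] (Spec N →L[ℂ] ℂ) →L[ℂ] ℂ) _).comp₂ h2 h1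

theorem anOp_logDer (J : Finset (Fin N)) {x : Spec N} (hx : Good x) :
    AnOp (logDer N J) x :=
  ((anOp_transportV J hx).inv (isUnit_transportV J hx)).mul (anOp_dTransport J hx)

/-- The radial derivative vanishes at the origin. This is why the spin part drops out of the leading
terms along rays. -/
theorem logDer_zero (J : Finset (Fin N)) (Q : ℂ) : logDer N J (Q, 0) = 0 := by
  have : dTransport N J (Q, 0) = 0 := by
    ext σ τ
    exact (fderiv ℂ (fun y : Spec N => transportV N J y σ τ) (Q, 0)).map_zero
  rw [logDer, this, mul_zero]

theorem hasDerivAt_transportV (J : Finset (Fin N)) {x : Spec N} (hx : Good x) (σ τ : Config N) :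
    HasDerivAt (fun p : ℂ => transportV N J (x.1, p • x.2) σ τ) (dTransport N J x σ τ) 1 := by
  have h1 := (anOp_transportV J hx σ τ).differentiableAt.hasFDerivAt
  have h2 : HasDerivAt (fun p : ℂ => ((x.1, p • x.2) : Spec N)) (0, x.2) 1 := by
    have := (hasDerivAt_id (1 : ℂ)).smul_const x.2
    rw [one_smul] at this
    exact (hasDerivAt_const (1 : ℂ) x.1).prodMk this
  have hx1 : x = (x.1, (1 : ℂ) • x.2) := by simp
  exact HasFDerivAt.comp_hasDerivAt_of_eq (1 : ℂ) h1 h2 hx1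

theorem hasDerivAt_transport {q : ℂ} (hq : q ≠ 0) (J : Finset (Fin N)) {z : Fin N → ℂ}
    (hz : ∀ i, z i ≠ 0) (hg : Good (q⁻¹, ratio z)) (σ τ : Config N) :
    HasDerivAt (fun p : ℂ => transport N q J (shift N p J z) σ τ)
      (dTransport N J (q⁻¹, ratio z) σ τ) 1 := by
  refine (hasDerivAt_transportV J hg σ τ).congr_of_eventuallyEq ?_
  filter_upwards [isOpen_ne.mem_nhds (one_ne_zero : (1 : ℂ) ≠ 0)] with p hp
  rw [transport_eq_transportV hq J (shift_ne_zero hp J hz), transportV_shift]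

end transportV

/-! ### The crystal limit of transport -/

section crystal
variable {N : ℕ}

/-- The products of the coordinates to the left of the domain walls. -/
def wallProd (y : Fin N → ℂ) (σ : Config N) : ℂ :=
  ∏ n ∈ domainWalls N σ, ∏ p ∈ Finset.univ.filter (fun p : Fin N => (p : ℕ) < n), y p

theorem mem_domainWalls_succ (k : ℕ) (h : k + 1 < N) (σ : Config N) :
    k + 1 ∈ domainWalls N σ ↔ σ ⟨k, Nat.lt_of_succ_lt h⟩ = 1 ∧ σ ⟨k + 1, h⟩ = 0 := by
  simp only [domainWalls, Finset.mem_filter, Finset.mem_range]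
  constructor
  · rintro ⟨-, i, j, hi, hj, h1, h2⟩
    have ei : i = ⟨k, Nat.lt_of_succ_lt h⟩ := Fin.ext (by simpa using hi)
    have ej : j = ⟨k + 1, h⟩ := Fin.ext hj
    exact ⟨ei ▸ h1, ej ▸ h2⟩
  · rintro ⟨h1, h2⟩
    exact ⟨h, _, _, rfl, rfl, h1, h2⟩

theorem prod_left_adj (y : Fin N → ℂ) (k : ℕ) (h : k + 1 < N) (n : ℕ) (hn : n ≠ k + 1) :
    ∏ p ∈ Finset.univ.filter (fun p : Fin N => (p : ℕ) < n), y (adj k h p) =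
      ∏ p ∈ Finset.univ.filter (fun p : Fin N => (p : ℕ) < n), y p := by
  refine Finset.prod_bij (fun p _ => adj k h p) ?_ (fun a _ b _ e => (adj k h).injective e) ?_
    fun _ _ => rfl
  · intro p hp
    simp only [Finset.mem_filter, Finset.mem_univ, true_and] at hp ⊢
    by_cases h1 : (p : ℕ) = k
    · have : p = ⟨k, Nat.lt_of_succ_lt h⟩ := Fin.ext h1
      rw [this, adj_left]; simp only; omega
    by_cases h2 : (p : ℕ) = k + 1
    · have : p = ⟨k + 1, h⟩ := Fin.ext h2
      rw [this, adj_right]; simp only; omega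
    rwa [adj_of_ne k h p h1 h2]
  · intro p hp
    refine ⟨adj k h p, ?_, adj_adj k h p⟩
    simp only [Finset.mem_filter, Finset.mem_univ, true_and] at hp ⊢
    by_cases h1 : (p : ℕ) = k
    · have : p = ⟨k, Nat.lt_of_succ_lt h⟩ := Fin.ext h1
      rw [this, adj_left]; simp only; omega
    by_cases h2 : (p : ℕ) = k + 1
    · have : p = ⟨k + 1, h⟩ := Fin.ext h2
      rw [this, adj_right]; simp only; omega
    rwa [adj_of_ne k h p h1 h2]

theorem prod_left_adj_self (y : Fin N → ℂ) (k : ℕ) (h : k + 1 < N)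
    (hy : y ⟨k, Nat.lt_of_succ_lt h⟩ ≠ 0) :
    ∏ p ∈ Finset.univ.filter (fun p : Fin N => (p : ℕ) < k + 1), y (adj k h p) =
      y ⟨k + 1, h⟩ / y ⟨k, Nat.lt_of_succ_lt h⟩ *
        ∏ p ∈ Finset.univ.filter (fun p : Fin N => (p : ℕ) < k + 1), y p := by
  have hs : Finset.univ.filter (fun p : Fin N => (p : ℕ) < k + 1) =
      insert ⟨k, Nat.lt_of_succ_lt h⟩ (Finset.univ.filter (fun p : Fin N => (p : ℕ) < k)) := by
    ext p
    simp only [Finset.mem_filter, Finset.mem_univ, true_and, Finset.mem_insert, Fin.ext_iff]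
    omega
  rw [hs, Finset.prod_insert (by simp), Finset.prod_insert (by simp), adj_left,
    prod_left_adj y k h k (by omega)]
  field_simp

/-- A transposition of neighbours changes only the product attached to a wall between them. The
resulting factor is the diagonal weight of the `R`-matrix at `Q = 0`, so `wallProd` solves the
exchange relations in the crystal limit. -/
theorem wallProd_adj (y : Fin N → ℂ) (k : ℕ) (h : k + 1 < N)
    (hy : y ⟨k, Nat.lt_of_succ_lt h⟩ ≠ 0) (σ : Config N) :
    wallProd (y ∘ adj k h) σ =
      (if k + 1 ∈ domainWalls N σ then y ⟨k + 1, h⟩ / y ⟨k, Nat.lt_of_succ_lt h⟩ else 1) *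
        wallProd y σ := by
  classical
  unfold wallProd
  by_cases hk : k + 1 ∈ domainWalls N σ
  · rw [if_pos hk, ← Finset.mul_prod_erase _ _ hk, ← Finset.mul_prod_erase _ _ hk, ← mul_assoc]
    congr 1
    · exact prod_left_adj_self y k h hy
    · exact Finset.prod_congr rfl fun n hn => prod_left_adj y k h n (Finset.ne_of_mem_erase hn)
  · rw [if_neg hk, one_mul]
    exact Finset.prod_congr rfl fun n hn => prod_left_adj y k h n fun e => hk (e ▸ hn)

theorem wallProd_ne_zero {y : Fin N → ℂ} (hy : ∀ i, y i ≠ 0) (σ : Config N) :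
    wallProd y σ ≠ 0 :=
  Finset.prod_ne_zero_iff.2 fun _ _ => Finset.prod_ne_zero_iff.2 fun p _ => hy p

/-- At `Q = 0` the `R`-matrices are diagonal and `wallProd` times any fixed vector satisfies their
exchange relations, so transport is evaluated by the permutation `front J` without multiplying out
the factors. -/
theorem transportV_crystal (J : Finset (Fin N)) {z : Fin N → ℂ} (hz : ∀ i, z i ≠ 0) :
    transportV N J (0, ratio z) =
      Matrix.diagonal fun σ => wallProd (z ∘ front J) σ / wallProd z σ := by
  have key : ∀ w : State N, (transportV N J (0, ratio z)).mulVec (fun σ => wallProd z σ * w σ) =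
      fun σ => wallProd (z ∘ front J) σ * w σ := by
    intro w
    refine transportS_mulVec J (Φ := fun π => fun σ => wallProd (z ∘ π) σ * w σ) ?_
    intro k h π
    funext σ
    have h1 := wallProd_adj (z ∘ π) k h (hz _) σ
    have h2 : (z ∘ (π * adj k h : Equiv.Perm (Fin N))) = (z ∘ π) ∘ adj k h := rfl
    simp only
    rw [h2, h1, rV, siteMat_ice_mulVec k h]
    have h3 := mem_domainWalls_succ k h σ
    rcases fin2_cases (σ ⟨k, Nat.lt_of_succ_lt h⟩) with e1 | e1 <;>
      rcases fin2_cases (σ ⟨k + 1, h⟩) with e2 | e2 <;> simp [e1, e2] at h3 <;>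
      simp [e1, e2, h3, ratio, mul_assoc]
  apply op_ext
  intro w σ
  have h1 := congrFun (key fun σ => (wallProd z σ)⁻¹ * w σ) σ
  have h2 : (fun σ => wallProd z σ * ((wallProd z σ)⁻¹ * w σ)) = w := by
    funext σ
    rw [mul_inv_cancel_left₀ (wallProd_ne_zero hz σ)]
  rw [h2] at h1
  rw [h1, Matrix.mulVec_diagonal]
  ring

theorem wallProd_shift (p : ℂ) (J : Finset (Fin N)) (y : Fin N → ℂ) (π : Equiv.Perm (Fin N))
    (σ : Config N) : wallProd (shift N p J y ∘ π) σ =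
      p ^ (∑ n ∈ domainWalls N σ,
        (Finset.univ.filter fun i : Fin N => (i : ℕ) < n ∧ π i ∈ J).card) *
        wallProd (y ∘ π) σ := by
  unfold wallProd
  rw [← Finset.prod_pow_eq_pow_sum, ← Finset.prod_mul_distrib]
  apply Finset.prod_congr rfl
  intro n _
  have h1 : ∀ i : Fin N, (shift N p J y ∘ π) i = (if π i ∈ J then p else 1) * (y ∘ π) i := by
    intro i
    simp only [shift, Function.comp_apply]
    split_ifs <;> ring
  rw [Finset.prod_congr rfl fun i _ => h1 i, Finset.prod_mul_distrib, Finset.prod_ite,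
    Finset.prod_const, Finset.prod_const_one, mul_one, Finset.filter_filter]

theorem good_crystal {z : Fin N → ℂ} (hz : ∀ i, z i ≠ 0) : Good ((0, ratio z) : Spec N) := by
  intro i j _
  simp only [ratio]
  refine ⟨by simp, ?_⟩
  simpa using ⟨hz j, hz i⟩

/-- The number of lines in `J` to the left of the domain walls, after and before transport. -/
def wallShift (J : Finset (Fin N)) (σ : Config N) : ℂ :=
  ∑ n ∈ domainWalls N σ, (((min J.card n : ℕ) : ℂ) - ((J.filter fun i : Fin N => (i : ℕ) < n).card : ℕ))

/-- The diagonal entries are powers of `p` times constants. The exponent counts the shifted lines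
left of each wall after transport minus before: with the lines of `J` at the front, `min J.card n`
of them are among the first `n` sites. -/
theorem logDer_crystal (J : Finset (Fin N)) {z : Fin N → ℂ} (hz : ∀ i, z i ≠ 0) :
    logDer N J (0, ratio z) = Matrix.diagonal (wallShift J) := by
  classical
  set D : Config N → ℂ := fun σ => wallProd (z ∘ front J) σ / wallProd z σ with hD
  have hDne : ∀ σ, D σ ≠ 0 := fun σ =>
    div_ne_zero (wallProd_ne_zero (fun i => hz _) σ) (wallProd_ne_zero hz σ)
  have hd : dTransport N J (0, ratio z) = Matrix.diagonal fun σ => D σ * wallShift J σ := by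
    ext σ τ
    refine (hasDerivAt_transportV J (good_crystal hz) σ τ).unique ?_
    set a := ∑ n ∈ domainWalls N σ,
        (Finset.univ.filter fun i : Fin N => (i : ℕ) < n ∧ front J i ∈ J).card with ha
    set b := ∑ n ∈ domainWalls N σ,
        (Finset.univ.filter fun i : Fin N => (i : ℕ) < n ∧ i ∈ J).card with hb
    have hab : wallShift J σ = (a : ℂ) - b := by
      rw [ha, hb, wallShift, Finset.sum_sub_distrib]
      push_cast
      congr 1
      · apply Finset.sum_congr rfl
        intro n hn
        have hnN : n < N := Finset.mem_range.1 (Finset.mem_filter.1 hn).1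
        congr 1
        simp only [front_mem]
        have : (Finset.univ.filter fun i : Fin N => (i : ℕ) < n ∧ (i : ℕ) < J.card) =
            Finset.univ.filter fun i : Fin N => (i : ℕ) < min J.card n := by
          ext i; simp [and_comm]
        rw [this, Fin.card_filter_val_lt]
        omega
      · apply Finset.sum_congr rfl
        intro n _
        congr 2
        ext i
        simp [and_comm]
    have h1 : HasDerivAt (fun p : ℂ => if σ = τ then p ^ a / p ^ b * D σ else 0)
        (Matrix.diagonal (fun σ => D σ * wallShift J σ) σ τ) 1 := by
      by_cases hst : σ = τ
      · subst hst
        simp only [if_true, Matrix.diagonal_apply_eq]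
        have h2 := ((hasDerivAt_pow a (1 : ℂ)).div (hasDerivAt_pow b (1 : ℂ)) (by simp)).mul_const
          (D σ)
        simp only [one_pow, mul_one, div_one, one_mul] at h2
        rw [hab, mul_comm]
        exact h2
      · simp only [hst, if_false, Matrix.diagonal_apply_ne _ hst]
        exact hasDerivAt_const _ _
    refine h1.congr_of_eventuallyEq ?_
    filter_upwards [isOpen_ne.mem_nhds (one_ne_zero : (1 : ℂ) ≠ 0)] with p hp
    have h3 := wallProd_shift p J z 1 σ
    have h4 := wallProd_shift p J z (front J) σ
    simp only [Equiv.Perm.coe_one, Function.comp_id, id_eq] at h3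
    rw [← transportV_shift, transportV_crystal J (shift_ne_zero hp J hz), Matrix.diagonal_apply,
      h3, h4]
    split_ifs
    · exact mul_div_mul_comm _ _ _ _
    · rfl
  rw [logDer, hd, transportV_crystal J hz]
  have : Matrix.diagonal (fun σ => D σ * wallShift J σ) =
      Matrix.diagonal D * Matrix.diagonal (wallShift J) := by
    rw [Matrix.diagonal_mul_diagonal]
  rw [this, ← mul_assoc, Matrix.nonsing_inv_mul, one_mul]
  rw [Matrix.det_diagonal]
  exact (Finset.prod_ne_zero_iff.2 fun σ _ => hDne σ).isUnit

end crystal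

/-! ### The evaluation point and the Hamiltonians -/

section evaluation
variable {N : ℕ}

theorem evPoint_eq (j : Fin N) :
    evPoint N j = Complex.exp (2 * Real.pi * Complex.I / N) ^ ((j : ℕ) + 1) := by
  rw [evPoint, ← Complex.exp_nat_mul]
  congr 1
  push_cast
  ring

theorem evPoint_ne_zero (j : Fin N) : evPoint N j ≠ 0 := Complex.exp_ne_zero _

theorem isPrimitiveRoot_ev (hN : 1 ≤ N) :
    IsPrimitiveRoot (Complex.exp (2 * Real.pi * Complex.I / N)) N :=
  Complex.isPrimitiveRoot_exp N (by omega)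

theorem evPoint_pow (hN : 1 ≤ N) (j : Fin N) : evPoint N j ^ N = 1 := by
  rw [evPoint_eq, pow_right_comm, (isPrimitiveRoot_ev hN).pow_eq_one, one_pow]

theorem norm_evPoint (hN : 1 ≤ N) (j : Fin N) : ‖evPoint N j‖ = 1 :=
  Complex.norm_eq_one_of_pow_eq_one (evPoint_pow hN j) (by omega)

theorem evPoint_injective (hN : 1 ≤ N) : Function.Injective (evPoint N) := by
  intro i j h
  rw [evPoint_eq, evPoint_eq, pow_succ, pow_succ] at h
  have h1 := mul_right_cancel₀ ((isPrimitiveRoot_ev hN).ne_zero (by omega)) h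
  exact Fin.ext ((isPrimitiveRoot_ev hN).pow_inj i.2 j.2 h1)

theorem good_evPoint (hN : 1 ≤ N) {Q : ℂ} (hQ : Q ^ (2 * N) ≠ 1) :
    Good ((Q, ratio (evPoint N)) : Spec N) := by
  have hv : ∀ i j, ratio (evPoint N) i j ^ N = 1 := fun i j => by
    rw [ratio, div_pow, evPoint_pow hN, evPoint_pow hN, div_one]
  intro i j _
  constructor
  · intro h
    apply hQ
    have h1 : Q ^ 2 * ratio (evPoint N) i j = 1 := (sub_eq_zero.1 h).symm
    have h2 := congrArg (· ^ N) h1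
    simp only [mul_pow, hv, one_pow, mul_one] at h2
    rwa [pow_mul]
  · intro h
    apply hQ
    have h2 := congrArg (· ^ N) (sub_eq_zero.1 h)
    simp only [hv] at h2
    rw [pow_mul, ← h2]

theorem Generic.sub_inv_ne_zero (hN : 1 ≤ N) {q : ℂ} (hq : Generic N q) : q - q⁻¹ ≠ 0 := by
  intro h
  apply hq.2 1 le_rfl hN
  have h1 : q = q⁻¹ := sub_eq_zero.1 h
  rw [mul_one, pow_two]
  nth_rewrite 2 [h1]
  exact mul_inv_cancel₀ hq.1

theorem evPoint_mem_dom (hN : 1 ≤ N) {q : ℂ} (hq : Generic N q) : evPoint N ∈ dom N q := by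
  refine ⟨evPoint_ne_zero, fun i j hij => ⟨fun h => hij (evPoint_injective hN h), fun h => ?_⟩⟩
  apply hq.2 N hN le_rfl
  have h1 : q ^ 2 * evPoint N i = evPoint N j := by
    have := sub_eq_zero.1 h
    have h2 := congrArg (fun x => q * x) this
    simp only [← mul_assoc, mul_inv_cancel₀ hq.1, one_mul] at h2
    rw [pow_two, h2]
  have h2 := congrArg (· ^ N) h1
  simp only [mul_pow, evPoint_pow hN, mul_one] at h2
  rwa [pow_mul]

theorem good_of_mem_dom {q : ℂ} (hq : q ≠ 0) {z : Fin N → ℂ} (hz : z ∈ dom N q) :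
    Good ((q⁻¹, ratio z) : Spec N) := by
  intro i j hij
  have hi := hz.1 i
  have h1 := (hz.2 i j hij.ne).2
  have h2 := (hz.2 j i hij.ne').2
  simp only [ratio]
  constructor
  · intro h
    apply h1
    field_simp at h ⊢
    linear_combination h
  · intro h
    apply h2
    field_simp at h ⊢
    linear_combination h

/-- With every line in `J` there are no crossings. Hence the subtracted multiple of `D̃_N`
contributes nothing on constant functions. -/
theorem dTransport_univ {x : Spec N} (hx : Good x) : dTransport N Finset.univ x = 0 := by
  ext σ τ
  refine (hasDerivAt_transportV Finset.univ hx σ τ).unique ?_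
  have h : (fun p : ℂ => transportV N Finset.univ (x.1, p • x.2) σ τ) =
      fun _ => transportV N Finset.univ x σ τ := by
    funext p
    rw [transportV_congr (x := (x.1, p • x.2)) (y := x) rfl]
    intro i j _ hi
    exact absurd (Finset.mem_univ i) hi
  rw [h]
  exact hasDerivAt_const _ _

theorem hasDerivAt_spinMacdonald_const {q : ℂ} (hq : q ≠ 0) {z : Fin N → ℂ} (hz : z ∈ dom N q)
    (r : ℕ) (v : State N) :
    HasDerivAt (fun p => spinMacdonald N q p r (fun _ => v) z)
      ((∑ J ∈ (Finset.univ : Finset (Fin N)).powersetCard r,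
        coeffA N q J z • logDer N J (q⁻¹, ratio z)).mulVec v) 1 := by
  have hg := good_of_mem_dom hq hz
  rw [hasDerivAt_pi]
  intro σ
  simp only [spinMacdonald, shiftOp, Finset.sum_apply, Pi.smul_apply, smul_eq_mul,
    Matrix.sum_mulVec, Matrix.smul_mulVec]
  refine HasDerivAt.fun_sum fun J _ => HasDerivAt.const_mul _ ?_
  rw [logDer, ← Matrix.mulVec_mulVec, ← transport_eq_transportV hq J hz.1]
  simp only [Matrix.mulVec, dotProduct]
  refine HasDerivAt.fun_sum fun ρ _ => HasDerivAt.const_mul _ ?_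
  exact HasDerivAt.fun_sum fun τ _ => (hasDerivAt_transport hq J hz.1 hg ρ τ).mul_const _

/-- The sum `∑_J A_J R_J⁻¹ (∂_p R_J)` over the subsets of size `r`. -/
def logSum (N : ℕ) (q : ℂ) (r : ℕ) (z : Fin N → ℂ) : Op N :=
  ∑ J ∈ (Finset.univ : Finset (Fin N)).powersetCard r,
    coeffA N q J z • logDer N J (q⁻¹, ratio z)

theorem logSum_full {q : ℂ} (hq : q ≠ 0) {z : Fin N → ℂ} (hz : z ∈ dom N q) :
    logSum N q N z = 0 := by
  have : (Finset.univ : Finset (Fin N)).powersetCard N = {Finset.univ} := by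
    have := Finset.powersetCard_self (Finset.univ : Finset (Fin N))
    rwa [Finset.card_fin] at this
  rw [logSum, this, Finset.sum_singleton, logDer, dTransport_univ (good_of_mem_dom hq hz),
    mul_zero, smul_zero]

/-- On constant functions only the transport operators depend on `p`, so the derivative at `p = 1`
is a sum of logarithmic derivatives. -/
theorem ham_eq (hN : 1 ≤ N) {q : ℂ} (hq : Generic N q) (r : ℕ) :
    ham N q r = (q - q⁻¹)⁻¹ • logSum N q r (evPoint N) := by
  have hz := evPoint_mem_dom hN hq
  ext σ τ
  rw [ham, Matrix.of_apply, hamTilde]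
  have h1 := hasDerivAt_spinMacdonald_const hq.1 hz r (Pi.single τ 1)
  have h2 := (hasDerivAt_spinMacdonald_const hq.1 hz N (Pi.single τ 1)).const_smul
    ((r : ℂ) / (N : ℂ) * qBinom q N r)
  have h3 := logSum_full hq.1 hz
  rw [logSum] at h3
  rw [h3] at h2
  have h4 := (h1.fun_sub h2).deriv
  simp only [Pi.smul_apply] at h4
  rw [h4, Matrix.zero_mulVec, smul_zero, sub_zero, Matrix.mulVec_single_one]
  rfl

end evaluation

/-! ### Euler operators and the first-order part of the spin-Macdonald operators -/

section euler
variable {N : ℕ}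

/-- The partial Euler operator `∑_{j ∈ J} z_j ∂/∂z_j`. -/
def euler (J : Finset (Fin N)) (P : MvPolynomial (Fin N) ℂ) : MvPolynomial (Fin N) ℂ :=
  ∑ j ∈ J, MvPolynomial.X j * MvPolynomial.pderiv j P

/-- The partial Euler operator on polynomial vectors. -/
def eulerV (J : Finset (Fin N)) (Ψ : PolyState N) : PolyState N := fun σ => euler J (Ψ σ)

theorem coeff_euler (J : Finset (Fin N)) (P : MvPolynomial (Fin N) ℂ) (d : Fin N →₀ ℕ) :
    (euler J P).coeff d = (∑ j ∈ J, (d j : ℂ)) * P.coeff d := by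
  rw [euler, MvPolynomial.coeff_sum, Finset.sum_mul]
  apply Finset.sum_congr rfl
  intro j _
  induction P using MvPolynomial.induction_on' with
  | monomial m a =>
    rw [MvPolynomial.X_mul_pderiv_monomial, MvPolynomial.coeff_smul, MvPolynomial.coeff_monomial]
    split_ifs with h
    · rw [h, nsmul_eq_mul]
    · simp
  | add P P' h h' =>
    rw [map_add, mul_add, MvPolynomial.coeff_add, h, h', MvPolynomial.coeff_add, mul_add]

theorem hasDerivAt_shift (J : Finset (Fin N)) (z : Fin N → ℂ) (P : MvPolynomial (Fin N) ℂ) :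
    HasDerivAt (fun p : ℂ => MvPolynomial.eval (shift N p J z) P)
      (MvPolynomial.eval z (euler J P)) 1 := by
  have h1 : ∀ z : Fin N → ℂ, shift N 1 J z = z := fun z => by
    funext j; simp [shift]
  induction P using MvPolynomial.induction_on with
  | C a => simpa [euler] using hasDerivAt_const (1 : ℂ) a
  | add P P' h h' => simpa [euler, mul_add, Finset.sum_add_distrib] using h.fun_add h'
  | mul_X P i h =>
    have h2 : HasDerivAt (fun p : ℂ => shift N p J z i) (if i ∈ J then z i else 0) 1 := by
      by_cases hi : i ∈ J
      · simpa [shift, hi] using (hasDerivAt_id (1 : ℂ)).mul_const (z i)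
      · simpa [shift, hi] using hasDerivAt_const (1 : ℂ) (z i)
    have h3 := h.fun_mul h2
    simp only [map_mul, MvPolynomial.eval_X]
    refine h3.congr_deriv (Eq.symm ?_)
    simp only [h1, euler, Derivation.leibniz, MvPolynomial.pderiv_X, smul_eq_mul, map_sum, map_mul,
      map_add, MvPolynomial.eval_X, mul_add, Finset.sum_add_distrib, Finset.sum_mul]
    rw [add_comm]
    congr 1
    · exact Finset.sum_congr rfl fun j _ => by ring
    · by_cases hi : i ∈ J
      · rw [Finset.sum_eq_single i]
        · simp [hi]; ring
        · intro j _ hj; simp [hj]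
        · exact fun h => absurd hi h
      · rw [Finset.sum_eq_zero]
        · simp [hi]
        · intro j hj
          have : j ≠ i := fun e => hi (e ▸ hj)
          simp [this]

theorem hasDerivAt_evalV_shift (J : Finset (Fin N)) (z : Fin N → ℂ) (Ψ : PolyState N) :
    HasDerivAt (fun p : ℂ => evalV (shift N p J z) Ψ) (evalV z (eulerV J Ψ)) 1 :=
  hasDerivAt_pi.2 fun σ => hasDerivAt_shift J z (Ψ σ)

theorem shift_one (J : Finset (Fin N)) (z : Fin N → ℂ) : shift N 1 J z = z := by
  funext j; simp [shift]

theorem eventually_shift_mem_dom {q : ℂ} (J : Finset (Fin N)) {z : Fin N → ℂ}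
    (hz : z ∈ dom N q) : ∀ᶠ p in 𝓝 (1 : ℂ), shift N p J z ∈ dom N q := by
  have hc : ∀ i, Filter.Tendsto (fun p : ℂ => shift N p J z i) (𝓝 1) (𝓝 (z i)) := by
    intro i
    have : Continuous fun p : ℂ => shift N p J z i := by
      unfold shift
      split_ifs <;> fun_prop
    simpa [shift_one] using this.tendsto 1
  have h1 : ∀ i, ∀ᶠ p in 𝓝 (1 : ℂ), shift N p J z i ≠ 0 := fun i =>
    (hc i).eventually_ne (hz.1 i)
  have h2 : ∀ i j, i ≠ j → ∀ᶠ p in 𝓝 (1 : ℂ), shift N p J z i ≠ shift N p J z j := by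
    intro i j hij
    filter_upwards [((hc i).sub (hc j)).eventually_ne (sub_ne_zero.2 (hz.2 i j hij).1)] with p hp
    exact sub_ne_zero.1 hp
  have h3 : ∀ i j, i ≠ j → ∀ᶠ p in 𝓝 (1 : ℂ), q * shift N p J z i - q⁻¹ * shift N p J z j ≠ 0 :=
    fun i j hij => (((hc i).const_mul q).sub ((hc j).const_mul q⁻¹)).eventually_ne (hz.2 i j hij).2
  filter_upwards [Filter.eventually_all.2 h1,
    Filter.eventually_all.2 fun i => Filter.eventually_all.2 fun j => Filter.eventually_imp_distrib_left.2 (h2 i j),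
    Filter.eventually_all.2 fun i => Filter.eventually_all.2 fun j => Filter.eventually_imp_distrib_left.2 (h3 i j)]
    with p a b c
  exact ⟨a, fun i j hij => ⟨b i j hij, c i j hij⟩⟩

/-- The first `r` sites. -/
def initial (N r : ℕ) : Finset (Fin N) := Finset.univ.filter fun i => (i : ℕ) < r

theorem shift_comp (p : ℂ) (J : Finset (Fin N)) (z : Fin N → ℂ) (π : Equiv.Perm (Fin N))
    (K : Finset (Fin N)) (h : ∀ i, π i ∈ J ↔ i ∈ K) :
    shift N p J z ∘ π = shift N p K (z ∘ π) := by
  funext i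
  simp [shift, h]

theorem hasDerivAt_mulVec_evalV (A : Op N) (J : Finset (Fin N)) (z : Fin N → ℂ) (Ψ : PolyState N) :
    HasDerivAt (fun p : ℂ => A.mulVec (evalV (shift N p J z) Ψ))
      (A.mulVec (evalV z (eulerV J Ψ))) 1 := by
  rw [hasDerivAt_pi]
  intro σ
  simp only [Matrix.mulVec, dotProduct]
  exact HasDerivAt.fun_sum fun τ _ => HasDerivAt.const_mul _ (hasDerivAt_shift J z (Ψ τ))

/-- Scaling the first `r` coordinates leaves `z k / z (k + 1)` unchanged unless the pair straddles
the boundary at `r`. Differentiating the exchange relation in the scale gives the claim, so the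
coset sum applies to this vector. -/
theorem Phys.euler_initial {q : ℂ} {Ψ : PolyState N} (hΨ : Phys q Ψ) (r k : ℕ) (h : k + 1 < N)
    (hk : k + 1 ≠ r) {z : Fin N → ℂ} (hz : z ∈ dom N q) :
    evalV (z ∘ adj k h) (eulerV (initial N r) Ψ) =
      (siteR N q k (z ⟨k, Nat.lt_of_succ_lt h⟩ / z ⟨k + 1, h⟩)).mulVec
        (evalV z (eulerV (initial N r) Ψ)) := by
  have hadj : ∀ i, adj k h i ∈ initial N r ↔ i ∈ initial N r := by
    intro i
    simp only [initial, Finset.mem_filter, Finset.mem_univ, true_and]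
    by_cases h1 : (i : ℕ) = k
    · have : i = ⟨k, Nat.lt_of_succ_lt h⟩ := Fin.ext h1
      rw [this, adj_left]; simp only; omega
    by_cases h2 : (i : ℕ) = k + 1
    · have : i = ⟨k + 1, h⟩ := Fin.ext h2
      rw [this, adj_right]; simp only; omega
    rw [adj_of_ne k h i h1 h2]
  refine (hasDerivAt_evalV_shift (initial N r) (z ∘ adj k h) Ψ).unique ?_
  refine (hasDerivAt_mulVec_evalV _ (initial N r) z Ψ).congr_of_eventuallyEq ?_
  filter_upwards [eventually_shift_mem_dom (initial N r) hz,
    isOpen_ne.mem_nhds (one_ne_zero : (1 : ℂ) ≠ 0)] with p hp hp0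
  rw [← shift_comp p (initial N r) z (adj k h) (initial N r) hadj]
  have h1 := hΨ k h _ hp
  simp only at h1
  rw [h1]
  congr 2
  by_cases hkr : k < r
  · have hkr' : k + 1 < r := by omega
    have hp0 : p ≠ 0 := hp0
    simp [shift, initial, hkr, hkr', mul_div_mul_left _ _ hp0]
  · have hkr' : ¬ k + 1 < r := by omega
    simp [shift, initial, hkr, hkr']

/-- This is the derivative at `p = 1` of the identity that transport of `Ψ` equals `Ψ` at the
permuted point, with the coordinates in `J` scaled by `p`. The product rule produces the logarithmic
derivative. -/
theorem Phys.euler_front {q : ℂ} (hq : q ≠ 0) {Ψ : PolyState N} (hΨ : Phys q Ψ)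
    (J : Finset (Fin N)) {z : Fin N → ℂ} (hz : z ∈ dom N q) :
    ((transport N q J z)⁻¹).mulVec (evalV (z ∘ front J) (eulerV (initial N J.card) Ψ)) =
      evalV z (eulerV J Ψ) + (logDer N J (q⁻¹, ratio z)).mulVec (evalV z Ψ) := by
  have hg := good_of_mem_dom hq hz
  have hfr : ∀ i, front J i ∈ J ↔ i ∈ initial N J.card := fun i => by
    rw [front_mem]; simp [initial]
  have h1 := hasDerivAt_evalV_shift (initial N J.card) (z ∘ front J) Ψ
  have h2 : HasDerivAt (fun p : ℂ => (transport N q J (shift N p J z)).mulVec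
      (evalV (shift N p J z) Ψ)) ((dTransport N J (q⁻¹, ratio z)).mulVec (evalV z Ψ) +
      (transport N q J z).mulVec (evalV z (eulerV J Ψ))) 1 := by
    rw [hasDerivAt_pi]
    intro σ
    simp only [Pi.add_apply, Matrix.mulVec, dotProduct, ← Finset.sum_add_distrib]
    refine HasDerivAt.fun_sum fun τ _ => ?_
    have := (hasDerivAt_transport hq J hz.1 hg σ τ).mul (hasDerivAt_shift J z (Ψ τ))
    rw [shift_one] at this
    exact this
  have h3 : evalV (z ∘ front J) (eulerV (initial N J.card) Ψ) =
      (dTransport N J (q⁻¹, ratio z)).mulVec (evalV z Ψ) +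
      (transport N q J z).mulVec (evalV z (eulerV J Ψ)) := by
    refine h1.unique (h2.congr_of_eventuallyEq ?_)
    filter_upwards [eventually_shift_mem_dom J hz] with p hp
    rw [← shift_comp p J z (front J) (initial N J.card) hfr]
    exact (transport_mulVec J (dom_permStable N q) hΨ hp).symm
  have hu : IsUnit (transport N q J z).det := by
    rw [transport_eq_transportV hq J hz.1]
    exact (Matrix.isUnit_iff_isUnit_det _).1 (isUnit_transportV J hg)
  rw [h3, Matrix.mulVec_add, Matrix.mulVec_mulVec, Matrix.mulVec_mulVec,
    Matrix.nonsing_inv_mul _ hu, Matrix.one_mulVec, add_comm, transport_eq_transportV hq J hz.1]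
  rfl

theorem exists_macdonald {q : ℂ} (hq : q ≠ 0) (hq2 : q - q⁻¹ ≠ 0) (hdom : (dom N q).Nonempty)
    (r : ℕ) {Ψ : PolyState N} (hΨ : Phys q Ψ) :
    ∃ Ψ' : PolyState N, Phys q Ψ' ∧ ∀ z ∈ dom N q, evalV z Ψ' =
      ∑ J ∈ (Finset.univ : Finset (Fin N)).powersetCard r, coeffA N q J z •
        (evalV z (eulerV J Ψ) + (logDer N J (q⁻¹, ratio z)).mulVec (evalV z Ψ)) := by
  obtain ⟨Ψ', h1, h2⟩ := exists_cosetSum hq hq2 hdom r (eulerV (initial N r) Ψ)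
    fun k h hk z hz => hΨ.euler_initial r k h hk hz
  refine ⟨Ψ', h1, fun z hz => ?_⟩
  rw [h2 z hz, cosetSum]
  apply Finset.sum_congr rfl
  intro J hJ
  rw [← (Finset.mem_powersetCard.1 hJ).2, hΨ.euler_front hq J hz]

theorem transport_mulVec_allUp (q : ℂ) (J : Finset (Fin N)) (z : Fin N → ℂ) :
    (transport N q J z).mulVec (allUp N) = allUp N :=
  transportS_mulVec J (S := fun k i j => siteR N q k (z i / z j)) (Φ := fun _ => allUp N)
    fun k _ _ => (siteR_mulVec_allUp q _ k).symm

/-- The coefficients of the Macdonald operator sum to a polynomial. -/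
theorem exists_sum_coeffA {q : ℂ} (hq : q ≠ 0) (hq2 : q - q⁻¹ ≠ 0) (hdom : (dom N q).Nonempty)
    (r : ℕ) : ∃ P : MvPolynomial (Fin N) ℂ, ∀ z ∈ dom N q, MvPolynomial.eval z P =
      ∑ J ∈ (Finset.univ : Finset (Fin N)).powersetCard r, coeffA N q J z := by
  have he : ∀ z, evalV z (fun σ => MvPolynomial.C (allUp N σ)) = allUp N := fun z => by
    funext σ; simp [evalV]
  -- Every `R`-matrix fixes the all-up state, so its coset sum is the scalar Macdonald sum times
  -- that state.
  obtain ⟨Ψ, -, h2⟩ := exists_cosetSum hq hq2 hdom r (fun σ => MvPolynomial.C (allUp N σ))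
    fun k h _ z _ => by rw [he, he, siteR_mulVec_allUp]
  refine ⟨Ψ fun _ => 0, fun z hz => ?_⟩
  have h3 := congrFun (h2 z hz) fun _ => 0
  rw [cosetSum] at h3
  refine h3.trans ?_
  rw [Finset.sum_apply]
  apply Finset.sum_congr rfl
  intro J _
  have hu : IsUnit (transport N q J z).det := by
    rw [transport_eq_transportV hq J hz.1]
    exact (Matrix.isUnit_iff_isUnit_det _).1 (isUnit_transportV J (good_of_mem_dom hq hz))
  have h4 : ((transport N q J z)⁻¹).mulVec (allUp N) = allUp N := by
    conv_lhs => rw [← transport_mulVec_allUp q J z]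
    rw [Matrix.mulVec_mulVec, Matrix.nonsing_inv_mul _ hu, Matrix.one_mulVec]
  rw [he, h4]
  simp [allUp]

end euler

/-! ### Leading terms along the rays `z_i = x_i t ^ (N - i)` -/

section ray
variable {N : ℕ}

/-- The weight of a monomial. -/
def wt (d : Fin N →₀ ℕ) : ℕ := ∑ i : Fin N, (N - i) * d i

/-- The polynomials all of whose monomials have weight less than `n`. -/
def LowP (n : ℕ) (P : MvPolynomial (Fin N) ℂ) : Prop := ∀ d, P.coeff d ≠ 0 → wt d < n

/-- The part of weight `n` of a polynomial. -/
def topPart (n : ℕ) (P : MvPolynomial (Fin N) ℂ) : MvPolynomial (Fin N) ℂ :=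
  ∑ d ∈ P.support.filter (fun d => wt d = n), MvPolynomial.monomial d (P.coeff d)

/-- The points of a ray. -/
def ray (x : Fin N → ℂ) (t : ℂ) : Fin N → ℂ := fun i => x i * t ^ (N - (i : ℕ))

theorem coeff_topPart (n : ℕ) (P : MvPolynomial (Fin N) ℂ) (d : Fin N →₀ ℕ) :
    (topPart n P).coeff d = if wt d = n then P.coeff d else 0 := by
  classical
  simp only [topPart, MvPolynomial.coeff_sum, MvPolynomial.coeff_monomial, Finset.sum_ite_eq',
    Finset.mem_filter, MvPolynomial.mem_support_iff]
  by_cases h : P.coeff d = 0 <;> simp [h]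

theorem eval_ray (x : Fin N → ℂ) (t : ℂ) (P : MvPolynomial (Fin N) ℂ) :
    MvPolynomial.eval (ray x t) P =
      ∑ d ∈ P.support, t ^ wt d * (P.coeff d * ∏ i, x i ^ d i) := by
  rw [MvPolynomial.eval_eq']
  apply Finset.sum_congr rfl
  intro d _
  simp only [ray, mul_pow, Finset.prod_mul_distrib, ← pow_mul, Finset.prod_pow_eq_pow_sum, wt]
  ring

theorem tendsto_pow_div (k n : ℕ) (h : k < n) :
    Filter.Tendsto (fun t : ℂ => (t ^ n)⁻¹ * t ^ k) (Bornology.cobounded ℂ) (𝓝 0) := by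
  have h1 : Filter.Tendsto (fun t : ℂ => t⁻¹ ^ (n - k)) (Bornology.cobounded ℂ) (𝓝 0) := by
    have := (Filter.tendsto_inv₀_cobounded (α := ℂ)).pow (n - k)
    rwa [zero_pow (by omega)] at this
  refine h1.congr' ?_
  filter_upwards [Bornology.eventually_ne_cobounded (0 : ℂ)] with t ht
  obtain ⟨m, rfl⟩ : ∃ m, n = k + m := ⟨n - k, by omega⟩
  rw [Nat.add_sub_cancel_left, pow_add, inv_pow]
  field_simp

theorem tendsto_eval_ray {n : ℕ} {P : MvPolynomial (Fin N) ℂ} (hP : LowP (n + 1) P)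
    (x : Fin N → ℂ) :
    Filter.Tendsto (fun t : ℂ => (t ^ n)⁻¹ * MvPolynomial.eval (ray x t) P)
      (Bornology.cobounded ℂ) (𝓝 (MvPolynomial.eval x (topPart n P))) := by
  simp only [eval_ray, Finset.mul_sum, ← mul_assoc]
  rw [topPart, map_sum, Finset.sum_filter]
  refine tendsto_finsetSum _ fun d hd => ?_
  rw [MvPolynomial.eval_monomial]
  split_ifs with h
  · refine tendsto_const_nhds.congr' ?_
    filter_upwards [Bornology.eventually_ne_cobounded (0 : ℂ)] with t ht
    rw [h, inv_mul_cancel₀ (pow_ne_zero _ ht), one_mul, Finsupp.prod_fintype _ _ fun i => pow_zero _]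
  · have h1 : wt d < n := lt_of_le_of_ne (Nat.lt_succ_iff.1
      (hP d (MvPolynomial.mem_support_iff.1 hd))) h
    have := ((tendsto_pow_div _ _ h1).mul_const (P.coeff d)).mul_const (∏ i, x i ^ d i)
    simpa using this

/-- A top part of weight above `n` would be the limit of a convergent quantity divided by a positive
power of `t`, hence zero at all generic points. Descending from the largest weight removes all
weights above `n`. -/
theorem low_of_tendsto {q : ℂ} (hq : q ≠ 0) {n : ℕ} {P : MvPolynomial (Fin N) ℂ}
    (L : (Fin N → ℂ) → ℂ)
    (h : ∀ x ∈ dom N q, Filter.Tendsto (fun t : ℂ => (t ^ n)⁻¹ * MvPolynomial.eval (ray x t) P)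
      (Bornology.cobounded ℂ) (𝓝 (L x))) : LowP (n + 1) P := by
  have hstep : ∀ k, LowP (n + 1 + k + 1) P → LowP (n + 1 + k) P := by
    intro k hk
    have h1 : topPart (n + 1 + k) P = 0 := by
      apply eq_of_eval_dom hq
      intro x hx
      rw [map_zero]
      refine tendsto_nhds_unique (tendsto_eval_ray hk x) ?_
      have h2 := (tendsto_pow_div n (n + 1 + k) (by omega)).mul (h x hx)
      rw [zero_mul] at h2
      refine h2.congr' ?_
      filter_upwards [Bornology.eventually_ne_cobounded (0 : ℂ)] with t ht
      rw [mul_assoc, mul_inv_cancel_left₀ (pow_ne_zero _ ht)]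
    intro d hd
    refine lt_of_le_of_ne (Nat.lt_succ_iff.1 (hk d hd)) fun e => hd ?_
    have := coeff_topPart (n + 1 + k) P d
    rwa [if_pos e, h1, MvPolynomial.coeff_zero, eq_comm] at this
  have hall : ∀ k, LowP (n + 1 + k) P → LowP (n + 1) P := by
    intro k
    induction k with
    | zero => exact id
    | succ k ih => exact fun hk => ih (hstep k hk)
  refine hall (P.support.sup wt) fun d hd => ?_
  have : wt d ≤ P.support.sup wt := Finset.le_sup (MvPolynomial.mem_support_iff.2 hd)
  omega

theorem exists_lowP (P : MvPolynomial (Fin N) ℂ) : ∃ n, LowP n P := by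
  refine ⟨P.support.sup wt + 1, fun d hd => ?_⟩
  exact Nat.lt_succ_of_le (Finset.le_sup (f := wt) (MvPolynomial.mem_support_iff.2 hd))

theorem topPart_eq_of_tendsto {q : ℂ} (hq : q ≠ 0) {n : ℕ} {P P' : MvPolynomial (Fin N) ℂ}
    (h : ∀ x ∈ dom N q, Filter.Tendsto (fun t : ℂ => (t ^ n)⁻¹ * MvPolynomial.eval (ray x t) P)
      (Bornology.cobounded ℂ) (𝓝 (MvPolynomial.eval x P'))) : topPart n P = P' :=
  eq_of_eval_dom hq fun x hx =>
    tendsto_nhds_unique (tendsto_eval_ray (low_of_tendsto hq _ h) x) (h x hx)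

theorem ray_div_tendsto {x : Fin N → ℂ} (hx : ∀ i, x i ≠ 0) {i j : Fin N} (hij : i < j) :
    Filter.Tendsto (fun t : ℂ => ray x t j / ray x t i) (Bornology.cobounded ℂ) (𝓝 0) := by
  have hij' : (i : ℕ) < j := hij
  have h1 := (tendsto_pow_div (N - (j : ℕ)) (N - (i : ℕ)) (by omega)).const_mul (x j / x i)
  rw [mul_zero] at h1
  refine h1.congr' ?_
  filter_upwards [Bornology.eventually_ne_cobounded (0 : ℂ)] with t ht
  have := hx i
  simp only [ray]
  field_simp

theorem ray_ne_zero {x : Fin N → ℂ} (hx : ∀ i, x i ≠ 0) {t : ℂ} (ht : t ≠ 0) (i : Fin N) :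
    ray x t i ≠ 0 := mul_ne_zero (hx i) (pow_ne_zero _ ht)

theorem ray_mem_dom {q : ℂ} (hq : q ≠ 0) {x : Fin N → ℂ} (hx : ∀ i, x i ≠ 0) :
    ∀ᶠ t in Bornology.cobounded ℂ, ray x t ∈ dom N q := by
  have h1 : ∀ a b : ℂ, a ≠ 0 → ∀ i j : Fin N, i < j → ∀ᶠ t in Bornology.cobounded ℂ,
      a * ray x t i - b * ray x t j ≠ 0 := by
    intro a b ha i j hij
    have h2 := ((ray_div_tendsto hx hij).const_mul b).const_sub a
    rw [mul_zero, sub_zero] at h2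
    filter_upwards [h2.eventually_ne ha, Bornology.eventually_ne_cobounded (0 : ℂ)] with t ht ht0 h
    apply ht
    have := ray_ne_zero hx ht0 i
    field_simp
    linear_combination h
  have hq' : q⁻¹ ≠ 0 := inv_ne_zero hq
  have h3 : ∀ i j : Fin N, ∀ᶠ t in Bornology.cobounded ℂ, i ≠ j →
      ray x t i ≠ ray x t j ∧ q * ray x t i - q⁻¹ * ray x t j ≠ 0 := by
    intro i j
    rcases lt_trichotomy i j with h | h | h
    · filter_upwards [h1 1 1 one_ne_zero i j h, h1 q q⁻¹ hq i j h] with t a b _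
      exact ⟨fun e => a (by rw [e]; ring), b⟩
    · filter_upwards with t h'
      exact absurd h h'
    · filter_upwards [h1 1 1 one_ne_zero j i h, h1 q⁻¹ q hq' j i h] with t a b _
      exact ⟨fun e => a (by rw [e]; ring), fun e => b (by linear_combination -e)⟩
  filter_upwards [Bornology.eventually_ne_cobounded (0 : ℂ),
    Filter.eventually_all.2 fun i => Filter.eventually_all.2 (h3 i)] with t ht h
  exact ⟨ray_ne_zero hx ht, h⟩

end ray

/-! ### Triangularity of the first-order Macdonald operators -/

section leading
variable {N : ℕ}

/-- The spectrum `q ^ (N - 1 - 2 j)`. -/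
def rho (N : ℕ) (q : ℂ) (j : Fin N) : ℂ := q ^ ((N : ℤ) - 1 - 2 * (j : ℕ))

/-- The elementary symmetric polynomials in `rho`. -/
def rhoSymm (N : ℕ) (q : ℂ) (r : ℕ) : ℂ :=
  ∑ J ∈ (Finset.univ : Finset (Fin N)).powersetCard r, ∏ j ∈ J, rho N q j

/-- The derivatives `ρ_j ∂/∂ρ_j` of the elementary symmetric polynomials in `rho`. -/
def rhoDer (N : ℕ) (q : ℂ) (r : ℕ) (j : Fin N) : ℂ :=
  ∑ J ∈ ((Finset.univ : Finset (Fin N)).powersetCard r).filter (fun J => j ∈ J),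
    ∏ i ∈ J, rho N q i

theorem prod_sign_rho {q : ℂ} (hq : q ≠ 0) (j : Fin N) :
    ∏ i ∈ Finset.univ.erase j, (if j < i then q else q⁻¹) = rho N q j := by
  rw [Finset.prod_ite, Finset.prod_const, Finset.prod_const]
  have h1 : (Finset.univ.erase j).filter (fun i => j < i) = Finset.Ioi j := by
    ext i; simp only [Finset.mem_filter, Finset.mem_erase, Finset.mem_univ, and_true,
      Finset.mem_Ioi]
    exact ⟨fun h => h.2, fun h => ⟨h.ne', h⟩⟩
  have h2 : (Finset.univ.erase j).filter (fun i => ¬ j < i) = Finset.Iio j := by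
    ext i; simp only [Finset.mem_filter, Finset.mem_erase, Finset.mem_univ, and_true,
      Finset.mem_Iio, not_lt]
    exact ⟨fun h => lt_of_le_of_ne h.2 h.1, fun h => ⟨h.ne, h.le⟩⟩
  rw [h1, h2, Fin.card_Ioi, Fin.card_Iio, rho, inv_pow, ← zpow_natCast, ← zpow_natCast,
    ← zpow_neg, ← zpow_add₀ hq]
  congr 1
  have := j.2
  omega

/-- Products over `J × Jᶜ` of a weight with `s j i * s i j = 1`. -/
theorem prod_compl_eq (s : Fin N → Fin N → ℂ) (hs : ∀ i j, i ≠ j → s j i * s i j = 1)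
    (J : Finset (Fin N)) :
    ∏ j ∈ J, ∏ i ∈ Jᶜ, s j i = ∏ j ∈ J, ∏ i ∈ Finset.univ.erase j, s j i := by
  classical
  have h1 : ∏ p ∈ J.offDiag, s p.1 p.2 = 1 := by
    refine Finset.prod_involution (fun p _ => p.swap) ?_ ?_ ?_ ?_
    · intro p hp
      exact hs p.2 p.1 (Finset.mem_offDiag.1 hp).2.2.symm
    · intro p hp _ e
      exact (Finset.mem_offDiag.1 hp).2.2 (congrArg Prod.snd e)
    · intro p hp
      have := Finset.mem_offDiag.1 hp
      exact Finset.mem_offDiag.2 ⟨this.2.1, this.1, this.2.2.symm⟩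
    · intro p _; exact Prod.swap_swap p
  have h2 : ∏ p ∈ J.offDiag, s p.1 p.2 = ∏ j ∈ J, ∏ i ∈ J.erase j, s j i := by
    rw [Finset.prod_sigma']
    refine Finset.prod_bij' (fun p _ => ⟨p.1, p.2⟩) (fun p _ => (p.1, p.2)) ?_ ?_ ?_ ?_ ?_
    · intro p hp
      have := Finset.mem_offDiag.1 hp
      simp [this.1, this.2.1, this.2.2.symm]
    · intro p hp
      simp only [Finset.mem_sigma, Finset.mem_erase] at hp
      exact Finset.mem_offDiag.2 ⟨hp.1, hp.2.2, hp.2.1.symm⟩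
    · intro _ _; rfl
    · intro _ _; rfl
    · intro _ _; rfl
  rw [← mul_one (∏ j ∈ J, ∏ i ∈ Jᶜ, _), ← h1, h2, ← Finset.prod_mul_distrib]
  apply Finset.prod_congr rfl
  intro j hj
  rw [← Finset.prod_union]
  · congr 1
    ext i
    simp only [Finset.mem_union, Finset.mem_compl, Finset.mem_erase, Finset.mem_univ, and_true]
    constructor
    · rintro (h | h)
      · exact fun e => h (e ▸ hj)
      · exact h.1
    · intro h
      by_cases hi : i ∈ J
      · exact Or.inr ⟨h, hi⟩
      · exact Or.inl hi
  · rw [Finset.disjoint_left]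
    intro i hi hi'
    exact Finset.mem_compl.1 hi (Finset.mem_of_mem_erase hi')

theorem prod_prod_sign {q : ℂ} (hq : q ≠ 0) (J : Finset (Fin N)) :
    ∏ j ∈ J, ∏ i ∈ Jᶜ, (if j < i then q else q⁻¹) = ∏ j ∈ J, rho N q j := by
  rw [prod_compl_eq (fun j i => if j < i then q else q⁻¹)]
  · exact Finset.prod_congr rfl fun j _ => prod_sign_rho hq j
  · intro i j hij
    rcases lt_or_gt_of_ne hij with h | h
    · simp [h, h.not_gt, inv_mul_cancel₀ hq]
    · simp [h, h.not_gt, mul_inv_cancel₀ hq]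

/-- Of two coordinates on a ray the one with the smaller index dominates, so each factor tends to
`q` or `q⁻¹`. The factors for pairs inside `J` would cancel in pairs, which makes the limit a
product over `J` alone. -/
theorem tendsto_coeffA {q : ℂ} (hq : q ≠ 0) (J : Finset (Fin N)) {x : Fin N → ℂ}
    (hx : ∀ i, x i ≠ 0) :
    Filter.Tendsto (fun t => coeffA N q J (ray x t)) (Bornology.cobounded ℂ)
      (𝓝 (∏ j ∈ J, rho N q j)) := by
  rw [← prod_prod_sign hq]
  refine tendsto_finsetProd _ fun j hj => tendsto_finsetProd _ fun i hi => ?_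
  have hne : i ≠ j := fun e => Finset.mem_compl.1 hi (e ▸ hj)
  rcases lt_or_gt_of_ne hne with h | h
  · rw [if_neg h.not_gt]
    have h1 := ray_div_tendsto hx h
    have h2 := ((h1.const_mul q).sub_const q⁻¹).div (h1.sub_const 1) (by norm_num)
    have e : (q * 0 - q⁻¹) / (0 - 1) = q⁻¹ := by rw [mul_zero, zero_sub, zero_sub, neg_div_neg_eq, div_one]
    rw [e] at h2
    refine h2.congr' ?_
    filter_upwards [Bornology.eventually_ne_cobounded (0 : ℂ)] with t ht
    have h0 := ray_ne_zero hx ht i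
    simp only [Pi.div_apply]
    rw [← mul_div_mul_right _ _ h0]
    congr 1 <;> field_simp
  · rw [if_pos h]
    have h1 := ray_div_tendsto hx h
    have h2 := ((h1.const_mul q⁻¹).const_sub q).div (h1.const_sub 1) (by norm_num)
    have e : (q - q⁻¹ * 0) / (1 - 0) = q := by rw [mul_zero, sub_zero, sub_zero, div_one]
    rw [e] at h2
    refine h2.congr' ?_
    filter_upwards [Bornology.eventually_ne_cobounded (0 : ℂ)] with t ht
    have h0 := ray_ne_zero hx ht j
    simp only [Pi.div_apply]
    rw [← mul_div_mul_right _ _ h0]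
    congr 1 <;> field_simp

theorem Good.congr {x y : Spec N} (hx : Good x) (h1 : x.1 = y.1)
    (h : ∀ i j, i < j → x.2 i j = y.2 i j) : Good y := fun i j hij => by
  rw [← h1, ← h i j hij]; exact hx i j hij

theorem logDer_congr {J : Finset (Fin N)} {x y : Spec N} (hx : Good x) (h1 : x.1 = y.1)
    (h : ∀ i j, i < j → x.2 i j = y.2 i j) : logDer N J x = logDer N J y := by
  have hd : dTransport N J x = dTransport N J y := by
    ext σ τ
    refine (hasDerivAt_transportV J hx σ τ).unique ?_
    have h2 := hasDerivAt_transportV J (hx.congr h1 h) σ τ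
    refine h2.congr_of_eventuallyEq (Filter.Eventually.of_forall fun p => ?_)
    simp only
    rw [transportV_congr (x := (x.1, p • x.2)) (y := (y.1, p • y.2)) h1]
    intro i j hij _ _
    simp [h i j hij]
  rw [logDer, logDer, hd, transportV_congr h1 fun i j hij _ _ => h i j hij]

theorem tendsto_logDer {q : ℂ} (hq : q ≠ 0) (J : Finset (Fin N)) {x : Fin N → ℂ}
    (hx : ∀ i, x i ≠ 0) (σ τ : Config N) :
    Filter.Tendsto (fun t => logDer N J (q⁻¹, ratio (ray x t)) σ τ) (Bornology.cobounded ℂ)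
      (𝓝 0) := by
  -- The ratios with `j < i` diverge along the ray but never enter the transport. Replacing them by
  -- `0` makes the whole array converge.
  set up : ℂ → Fin N → Fin N → ℂ :=
    fun t i j => if i < j then ray x t j / ray x t i else 0 with hup
  have hg0 : Good ((q⁻¹, 0) : Spec N) := fun i j _ => by simpa using hq
  have h1 : Filter.Tendsto up (Bornology.cobounded ℂ) (𝓝 0) := by
    rw [tendsto_pi_nhds]
    intro i
    rw [tendsto_pi_nhds]
    intro j
    simp only [hup, Pi.zero_apply]
    by_cases hij : i < j
    · simpa [hij] using ray_div_tendsto hx hij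
    · simp [hij]
  have h2 := (anOp_logDer J hg0 σ τ).continuousAt.tendsto.comp
    ((tendsto_const_nhds (x := q⁻¹)).prodMk_nhds h1)
  rw [logDer_zero] at h2
  refine h2.congr' ?_
  filter_upwards [ray_mem_dom hq hx] with t ht
  simp only [Function.comp_apply]
  rw [logDer_congr (good_of_mem_dom hq ht) (y := (q⁻¹, up t)) rfl]
  intro i j hij
  simp [hup, hij, ratio]

/-- The sum is a polynomial with a finite limit along every generic ray, so it has weight zero and
equals that constant limit. -/
theorem sum_coeffA {q : ℂ} (hq : q ≠ 0) (hq2 : q - q⁻¹ ≠ 0) (r : ℕ) {z : Fin N → ℂ}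
    (hz : z ∈ dom N q) :
    ∑ J ∈ (Finset.univ : Finset (Fin N)).powersetCard r, coeffA N q J z = rhoSymm N q r := by
  obtain ⟨P, hP⟩ := exists_sum_coeffA hq hq2 ⟨z, hz⟩ r
  have h1 : ∀ x ∈ dom N q, Filter.Tendsto (fun t : ℂ => (t ^ 0)⁻¹ * MvPolynomial.eval (ray x t) P)
      (Bornology.cobounded ℂ) (𝓝 (MvPolynomial.eval x (MvPolynomial.C (rhoSymm N q r)))) := by
    intro x hx
    rw [MvPolynomial.eval_C]
    have := tendsto_finsetSum ((Finset.univ : Finset (Fin N)).powersetCard r)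
      fun J _ => tendsto_coeffA hq J hx.1
    refine this.congr' ?_
    filter_upwards [ray_mem_dom hq hx.1] with t ht
    rw [pow_zero, inv_one, one_mul, hP _ ht]
  have h2 := topPart_eq_of_tendsto hq h1
  have h3 := low_of_tendsto hq _ h1
  have h4 : P = topPart 0 P := by
    ext d
    rw [coeff_topPart]
    split_ifs with h
    · rfl
    · by_contra hd
      exact h (Nat.lt_one_iff.1 (h3 d hd))
  rw [← hP z hz, h4, h2, MvPolynomial.eval_C]

theorem LowP.euler {n : ℕ} {P : MvPolynomial (Fin N) ℂ} (hP : LowP n P) (J : Finset (Fin N)) :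
    LowP n (euler J P) := fun d hd => hP d (by
  rw [coeff_euler] at hd
  exact right_ne_zero_of_mul hd)

/-- Along rays the coefficients tend to products of `rho` and the spin part tends to zero, so the
top weight feels only Euler operators, for which monomials are eigenvectors. -/
theorem macdonald_leading {q : ℂ} (hq : q ≠ 0) (r : ℕ) {Ψ Ψ' : PolyState N}
    (h : ∀ z ∈ dom N q, evalV z Ψ' =
      ∑ J ∈ (Finset.univ : Finset (Fin N)).powersetCard r, coeffA N q J z •
        (evalV z (eulerV J Ψ) + (logDer N J (q⁻¹, ratio z)).mulVec (evalV z Ψ)))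
    {n : ℕ} (hΨ : ∀ σ, LowP (n + 1) (Ψ σ)) :
    (∀ σ, LowP (n + 1) (Ψ' σ)) ∧ ∀ σ d, wt d = n →
      (Ψ' σ).coeff d = (∑ j, rhoDer N q r j * (d j : ℂ)) * (Ψ σ).coeff d := by
  have key : ∀ σ, ∀ x ∈ dom N q, Filter.Tendsto (fun t : ℂ => (t ^ n)⁻¹ *
      MvPolynomial.eval (ray x t) (Ψ' σ)) (Bornology.cobounded ℂ)
      (𝓝 (MvPolynomial.eval x (∑ J ∈ (Finset.univ : Finset (Fin N)).powersetCard r,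
        MvPolynomial.C (∏ j ∈ J, rho N q j) * topPart n (euler J (Ψ σ))))) := by
    intro σ x hx
    have h1 : Filter.Tendsto (fun t : ℂ => ∑ J ∈ (Finset.univ : Finset (Fin N)).powersetCard r,
        coeffA N q J (ray x t) * ((t ^ n)⁻¹ * MvPolynomial.eval (ray x t) (euler J (Ψ σ)) +
          ∑ τ, logDer N J (q⁻¹, ratio (ray x t)) σ τ *
            ((t ^ n)⁻¹ * MvPolynomial.eval (ray x t) (Ψ τ)))) (Bornology.cobounded ℂ)
        (𝓝 (∑ J ∈ (Finset.univ : Finset (Fin N)).powersetCard r, (∏ j ∈ J, rho N q j) *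
          (MvPolynomial.eval x (topPart n (euler J (Ψ σ))) +
            ∑ τ, 0 * MvPolynomial.eval x (topPart n (Ψ τ))))) := by
      refine tendsto_finsetSum _ fun J _ => (tendsto_coeffA hq J hx.1).mul
        ((tendsto_eval_ray ((hΨ σ).euler J) x).add (tendsto_finsetSum _ fun τ _ =>
          (tendsto_logDer hq J hx.1 σ τ).mul (tendsto_eval_ray (hΨ τ) x)))
    simp only [zero_mul, Finset.sum_const_zero, add_zero] at h1
    simp only [map_sum, map_mul, MvPolynomial.eval_C]
    refine h1.congr' ?_
    filter_upwards [ray_mem_dom hq hx.1] with t ht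
    have h2 := congrFun (h _ ht) σ
    simp only [evalV, Finset.sum_apply, Pi.smul_apply, Pi.add_apply, smul_eq_mul, Matrix.mulVec,
      dotProduct, eulerV] at h2
    rw [h2, Finset.mul_sum]
    apply Finset.sum_congr rfl
    intro J _
    have e : ∑ τ, logDer N J (q⁻¹, ratio (ray x t)) σ τ *
        ((t ^ n)⁻¹ * MvPolynomial.eval (ray x t) (Ψ τ)) =
        (t ^ n)⁻¹ * ∑ τ, logDer N J (q⁻¹, ratio (ray x t)) σ τ *
          MvPolynomial.eval (ray x t) (Ψ τ) := by
      rw [Finset.mul_sum]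
      exact Finset.sum_congr rfl fun τ _ => mul_left_comm _ _ _
    rw [e]
    ring
  refine ⟨fun σ => low_of_tendsto hq _ (key σ), fun σ d hd => ?_⟩
  have h1 := congrArg (MvPolynomial.coeff d) (topPart_eq_of_tendsto hq (key σ))
  rw [coeff_topPart, if_pos hd] at h1
  rw [h1, MvPolynomial.coeff_sum]
  simp only [MvPolynomial.coeff_C_mul, coeff_topPart, hd, if_true, coeff_euler, ← mul_assoc]
  rw [← Finset.sum_mul]
  congr 1
  simp only [rhoDer, Finset.sum_mul, Finset.mul_sum, Finset.sum_filter]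
  rw [Finset.sum_comm]
  apply Finset.sum_congr rfl
  intro J _
  rw [← Finset.sum_filter_add_sum_filter_not Finset.univ (fun j => j ∈ J)]
  have e1 : Finset.univ.filter (fun j => j ∈ J) = J := by ext; simp
  rw [Finset.sum_eq_zero (s := Finset.univ.filter fun j => ¬ j ∈ J), add_zero, e1]
  · exact Finset.sum_congr rfl fun j hj => by simp [hj]
  · intro j hj
    simp [(Finset.mem_filter.1 hj).2]

end leading

/-! ### Lifting the Hamiltonians to polynomial vectors -/

section rotation
variable {N : ℕ}

theorem coeffA_smul {q c : ℂ} (hc : c ≠ 0) (J : Finset (Fin N)) (z : Fin N → ℂ) :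
    coeffA N q J (fun i => c * z i) = coeffA N q J z := by
  refine Finset.prod_congr rfl fun j _ => Finset.prod_congr rfl fun i _ => ?_
  have h1 : q * (c * z j) - q⁻¹ * (c * z i) = c * (q * z j - q⁻¹ * z i) := by ring
  rw [h1, ← mul_sub, mul_div_mul_left _ _ hc]

theorem evPoint_rotate (hN : 1 ≤ N) (j : Fin N) : evPoint N (finRotate N j) =
    Complex.exp (2 * Real.pi * Complex.I / N) * evPoint N j := by
  obtain ⟨n, rfl⟩ : ∃ n, N = n + 1 := ⟨N - 1, by omega⟩
  rw [evPoint_eq, evPoint_eq, ← pow_succ']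
  by_cases h : j = Fin.last n
  · rw [h, finRotate_last, Fin.val_zero, Fin.val_last, zero_add]
    rw [pow_succ' _ (n + 1), (isPrimitiveRoot_ev hN).pow_eq_one, pow_one, mul_one]
  · rw [coe_finRotate_of_ne_last h]

/-- The sums of the coefficients over the subsets that contain a given site. -/
def markedSum (N : ℕ) (q : ℂ) (r : ℕ) (j : Fin N) : ℂ :=
  ∑ J ∈ ((Finset.univ : Finset (Fin N)).powersetCard r).filter (fun J => j ∈ J),
    coeffA N q J (evPoint N)

theorem markedSum_perm {q : ℂ} {r : ℕ} (π : Equiv.Perm (Fin N))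
    (h : ∀ J, coeffA N q (J.map π.toEmbedding) (evPoint N) = coeffA N q J (evPoint N)) (j : Fin N) :
    markedSum N q r (π j) = markedSum N q r j := by
  symm
  refine Finset.sum_bij' (fun J _ => J.map π.toEmbedding)
    (fun J _ => J.map π.symm.toEmbedding) ?_ ?_ ?_ ?_ fun J _ => (h J).symm
  · intro J hJ
    simpa [Finset.mem_powersetCard] using hJ
  · intro J hJ
    simpa [Finset.mem_powersetCard] using hJ
  · intro J _; ext i; simp
  · intro J _; ext i; simp

/-- Rotating the sites multiplies all roots of unity by a common factor, and the coefficients are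
homogeneous of degree zero. This is the reason why the derivatives cancel on shell. -/
theorem markedSum_rotate (hN : 1 ≤ N) (q : ℂ) (r : ℕ) (j : Fin N) :
    markedSum N q r (finRotate N j) = markedSum N q r j := by
  refine markedSum_perm (finRotate N) (fun J => ?_) j
  have : evPoint N ∘ finRotate N =
      fun i => Complex.exp (2 * Real.pi * Complex.I / N) * evPoint N i :=
    funext fun i => evPoint_rotate hN i
  rw [← coeffA_perm, this, coeffA_smul (Complex.exp_ne_zero _)]

theorem sum_card_mul {r : ℕ} (f : Finset (Fin N) → ℂ) :
    ∑ j, ∑ J ∈ ((Finset.univ : Finset (Fin N)).powersetCard r).filter (fun J => j ∈ J), f J =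
      r * ∑ J ∈ (Finset.univ : Finset (Fin N)).powersetCard r, f J := by
  simp only [Finset.sum_filter]
  rw [Finset.sum_comm, Finset.mul_sum]
  apply Finset.sum_congr rfl
  intro J hJ
  rw [← Finset.sum_filter, Finset.sum_const, nsmul_eq_mul]
  congr 2
  rw [← (Finset.mem_powersetCard.1 hJ).2]
  congr 1
  ext; simp

theorem const_of_rotate (hN : 1 ≤ N) {f : Fin N → ℂ} (hf : ∀ j, f (finRotate N j) = f j)
    (j : Fin N) : f j = (∑ i, f i) / N := by
  obtain ⟨n, rfl⟩ : ∃ n, N = n + 1 := ⟨N - 1, by omega⟩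
  have h1 : ∀ k (hk : k < n + 1), f ⟨k, hk⟩ = f 0 := by
    intro k
    induction k with
    | zero => intro _; rfl
    | succ k ih =>
      intro hk
      rw [← ih (by omega), ← hf ⟨k, by omega⟩, finRotate_of_lt (by omega)]
  have h2 : ∀ i, f i = f j := fun i => (h1 i i.2).trans (h1 j j.2).symm
  rw [Finset.sum_congr rfl fun i _ => h2 i, Finset.sum_const, Finset.card_univ, Fintype.card_fin,
    nsmul_eq_mul, mul_div_cancel_left₀]
  exact Nat.cast_ne_zero.2 (by omega)

theorem markedSum_eq (hN : 1 ≤ N) {q : ℂ} (hq : Generic N q) (r : ℕ) (j : Fin N) :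
    markedSum N q r j = r * rhoSymm N q r / N := by
  rw [const_of_rotate hN (markedSum_rotate hN q r) j]
  congr 1
  rw [← sum_coeffA hq.1 (hq.sub_inv_ne_zero hN) r (evPoint_mem_dom hN hq), ← sum_card_mul]
  rfl

theorem sum_rhoDer (q : ℂ) (r : ℕ) : ∑ j, rhoDer N q r j = r * rhoSymm N q r :=
  sum_card_mul _

end rotation

/-! ### Operators induced from physical polynomials -/

section lifts
variable {N : ℕ} {q : ℂ}

theorem Phys.add {Ψ Ψ' : PolyState N} (h : Phys q Ψ) (h' : Phys q Ψ') :
    Phys q (fun σ => Ψ σ + Ψ' σ) := by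
  intro k hk z hz
  have e : ∀ z : Fin N → ℂ, evalV z (fun σ => Ψ σ + Ψ' σ) = evalV z Ψ + evalV z Ψ' := fun z => by
    funext σ; simp [evalV]
  have h1 := h k hk z hz
  have h2 := h' k hk z hz
  simp only at h1 h2
  simp only [e, Matrix.mulVec_add, h1, h2]

theorem evalV_smul (c : ℂ) (Ψ : PolyState N) (z : Fin N → ℂ) :
    evalV z (fun σ => MvPolynomial.C c * Ψ σ) = c • evalV z Ψ := by
  funext σ; simp [evalV]

theorem evalV_add (Ψ Ψ' : PolyState N) (z : Fin N → ℂ) :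
    evalV z (fun σ => Ψ σ + Ψ' σ) = evalV z Ψ + evalV z Ψ' := by
  funext σ; simp [evalV]

theorem Phys.smul (c : ℂ) {Ψ : PolyState N} (h : Phys q Ψ) :
    Phys q (fun σ => MvPolynomial.C c * Ψ σ) := by
  intro k hk z hz
  have h1 := h k hk z hz
  simp only at h1
  simp only [evalV_smul, h1, Matrix.mulVec_smul]

theorem LowP.add {n : ℕ} {P P' : MvPolynomial (Fin N) ℂ} (h : LowP n P) (h' : LowP n P') :
    LowP n (P + P') := by
  intro d hd
  rw [MvPolynomial.coeff_add] at hd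
  by_cases h0 : P.coeff d = 0
  · rw [h0, zero_add] at hd; exact h' d hd
  · exact h d h0

theorem LowP.smul {n : ℕ} {P : MvPolynomial (Fin N) ℂ} (h : LowP n P) (c : ℂ) :
    LowP n (MvPolynomial.C c * P) := by
  intro d hd
  rw [MvPolynomial.coeff_C_mul] at hd
  exact h d (right_ne_zero_of_mul hd)

theorem Phys.euler_univ {Ψ : PolyState N} (h : Phys q Ψ) :
    Phys q (eulerV Finset.univ Ψ) := by
  have : (Finset.univ : Finset (Fin N)) = initial N N := by
    ext i; simp [initial]
  intro k hk z hz
  rw [this]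
  exact h.euler_initial N k hk hk.ne hz

/-- The operator `A` lifts to physical polynomial vectors, acting on their leading monomials as
`μ`. -/
def Lifts (N : ℕ) (q : ℂ) (A : Op N) (μ : (Fin N →₀ ℕ) → ℂ) : Prop :=
  ∀ (n : ℕ) (Ψ : PolyState N), Phys q Ψ → (∀ σ, LowP (n + 1) (Ψ σ)) →
    ∃ Ψ' : PolyState N, Phys q Ψ' ∧ (∀ σ, LowP (n + 1) (Ψ' σ)) ∧
      evalV (evPoint N) Ψ' = A.mulVec (evalV (evPoint N) Ψ) ∧
      ∀ σ d, wt d = n → (Ψ' σ).coeff d = μ d * (Ψ σ).coeff d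

theorem Lifts.add {A B : Op N} {μ ν : (Fin N →₀ ℕ) → ℂ} (hA : Lifts N q A μ)
    (hB : Lifts N q B ν) : Lifts N q (A + B) (μ + ν) := by
  intro n Ψ hΨ hL
  obtain ⟨X, h1, h2, h3, h4⟩ := hA n Ψ hΨ hL
  obtain ⟨Y, g1, g2, g3, g4⟩ := hB n Ψ hΨ hL
  refine ⟨fun σ => X σ + Y σ, h1.add g1, fun σ => (h2 σ).add (g2 σ), ?_, fun σ d hd => ?_⟩
  · rw [evalV_add, h3, g3, Matrix.add_mulVec]
  · rw [MvPolynomial.coeff_add, h4 σ d hd, g4 σ d hd, Pi.add_apply, add_mul]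

theorem Lifts.smul {A : Op N} {μ : (Fin N →₀ ℕ) → ℂ} (hA : Lifts N q A μ) (c : ℂ) :
    Lifts N q (c • A) (c • μ) := by
  intro n Ψ hΨ hL
  obtain ⟨X, h1, h2, h3, h4⟩ := hA n Ψ hΨ hL
  refine ⟨fun σ => MvPolynomial.C c * X σ, h1.smul c, fun σ => (h2 σ).smul c, ?_,
    fun σ d hd => ?_⟩
  · rw [evalV_smul, h3, Matrix.smul_mulVec]
  · rw [MvPolynomial.coeff_C_mul, h4 σ d hd, Pi.smul_apply, smul_eq_mul, mul_assoc]

theorem Lifts.mul {A B : Op N} {μ ν : (Fin N →₀ ℕ) → ℂ} (hA : Lifts N q A μ)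
    (hB : Lifts N q B ν) : Lifts N q (A * B) (μ * ν) := by
  intro n Ψ hΨ hL
  obtain ⟨Y, g1, g2, g3, g4⟩ := hB n Ψ hΨ hL
  obtain ⟨X, h1, h2, h3, h4⟩ := hA n Y g1 g2
  refine ⟨X, h1, h2, ?_, fun σ d hd => ?_⟩
  · rw [h3, g3, Matrix.mulVec_mulVec]
  · rw [h4 σ d hd, g4 σ d hd, Pi.mul_apply, mul_assoc]

theorem Lifts.one : Lifts N q 1 1 := fun _ Ψ hΨ hL =>
  ⟨Ψ, hΨ, hL, by rw [Matrix.one_mulVec], fun _ _ _ => by rw [Pi.one_apply, one_mul]⟩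

theorem Lifts.zero : Lifts N q 0 0 := by
  simpa using (Lifts.one (N := N) (q := q)).smul 0

theorem Lifts.sum {ι : Type*} (s : Finset ι) {A : ι → Op N} {μ : ι → (Fin N →₀ ℕ) → ℂ}
    (h : ∀ i ∈ s, Lifts N q (A i) (μ i)) : Lifts N q (∑ i ∈ s, A i) (∑ i ∈ s, μ i) := by
  classical
  induction s using Finset.induction_on with
  | empty => simpa using Lifts.zero
  | insert i s hi ih =>
    rw [Finset.sum_insert hi, Finset.sum_insert hi]
    exact (h i (Finset.mem_insert_self i s)).add (ih fun j hj => h j (Finset.mem_insert_of_mem hj))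

/-- Leading multipliers are scalar functions of the monomial and therefore commute. Commutativity of
the operators themselves will follow from Hermiticity. -/
theorem Lifts.commutator {A B : Op N} {μ ν : (Fin N →₀ ℕ) → ℂ} (hA : Lifts N q A μ)
    (hB : Lifts N q B ν) : Lifts N q (A * B - B * A) 0 := by
  have := (hA.mul hB).add ((hB.mul hA).smul (-1))
  rw [neg_one_smul, ← sub_eq_add_neg, neg_one_smul, ← sub_eq_add_neg, mul_comm ν μ, sub_self] at this
  exact this

/-- The eigenvalues of a liftable operator are values of its leading multiplier. -/
theorem Lifts.eigenvalue (hN : 1 ≤ N) (hq : Generic N q) {A : Op N} {μ : (Fin N →₀ ℕ) → ℂ}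
    (hA : Lifts N q A μ) {v : State N} (hv : v ≠ 0) {c : ℂ} (hc : A.mulVec v = c • v) :
    ∃ d, μ d = c := by
  by_contra hne
  push Not at hne
  obtain ⟨Ψ, hΨ, hev⟩ := exists_physical hq.1 (evPoint_mem_dom hN hq) v
  -- Applying the lift of `A - μ d₀` kills the top monomial `d₀` in all components and multiplies
  -- the value at the evaluation point by the nonzero number `c - μ d₀`.
  have hkill : ∀ (n : ℕ) (S : Finset (Fin N →₀ ℕ)) (Ψ : PolyState N) (a : ℂ), a ≠ 0 →
      Phys q Ψ → (∀ σ, LowP (n + 1) (Ψ σ)) → evalV (evPoint N) Ψ = a • v →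
      (∀ σ d, wt d = n → (Ψ σ).coeff d ≠ 0 → d ∈ S) →
      ∃ (Ψ' : PolyState N) (a' : ℂ), a' ≠ 0 ∧ Phys q Ψ' ∧ (∀ σ, LowP n (Ψ' σ)) ∧
        evalV (evPoint N) Ψ' = a' • v := by
    classical
    intro n S
    induction S using Finset.induction_on with
    | empty =>
      intro Ψ a ha hΨ hL he hS
      refine ⟨Ψ, a, ha, hΨ, fun σ d hd => ?_, he⟩
      refine lt_of_le_of_ne (Nat.lt_succ_iff.1 (hL σ d hd)) fun e => ?_
      exact absurd (hS σ d e hd) (Finset.notMem_empty d)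
    | insert d₀ S _ ih =>
      intro Ψ a ha hΨ hL he hS
      obtain ⟨X, h1, h2, h3, h4⟩ := (hA.add (Lifts.one.smul (-μ d₀))) n Ψ hΨ hL
      refine ih X ((c - μ d₀) * a) (mul_ne_zero (sub_ne_zero.2 (hne d₀).symm) ha) h1 h2 ?_ ?_
      · rw [h3, he, Matrix.add_mulVec, Matrix.smul_mulVec, Matrix.one_mulVec, Matrix.mulVec_smul,
          hc, smul_smul, smul_smul, ← add_smul]
        congr 1
        ring
      · intro σ d hd hd0
        rw [h4 σ d hd] at hd0
        rcases Finset.mem_insert.1 (hS σ d hd (right_ne_zero_of_mul hd0)) with e | e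
        · subst e
          simp at hd0
        · exact e
  -- Lowering the weight until no monomial is left would make the zero polynomial take a nonzero
  -- value.
  have hdown : ∀ (n : ℕ) (Ψ : PolyState N) (a : ℂ), a ≠ 0 → Phys q Ψ → (∀ σ, LowP n (Ψ σ)) →
      evalV (evPoint N) Ψ = a • v → False := by
    classical
    intro n
    induction n with
    | zero =>
      intro Ψ a ha _ hL he
      have h0 : evalV (evPoint N) Ψ = 0 := by
        funext σ
        have : Ψ σ = 0 := by
          ext d
          by_contra hd
          exact absurd (hL σ d hd) (Nat.not_lt_zero _)
        simp [evalV, this]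
      rw [h0] at he
      exact hv ((smul_eq_zero.1 he.symm).resolve_left ha)
    | succ n ih =>
      intro Ψ a ha hΨ hL he
      obtain ⟨Ψ', a', h1, h2, h3, h4⟩ := hkill n
        (Finset.univ.biUnion fun σ => (Ψ σ).support) Ψ a ha hΨ hL he
        (fun σ d _ hd => Finset.mem_biUnion.2
          ⟨σ, Finset.mem_univ _, MvPolynomial.mem_support_iff.2 hd⟩)
      exact ih Ψ' a' h1 h2 h3 h4
  choose n hn using fun σ => exists_lowP (Ψ σ)
  refine hdown (Finset.univ.sup n) Ψ 1 one_ne_zero hΨ (fun σ d hd => ?_) (by rw [hev, one_smul])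
  exact lt_of_lt_of_le (hn σ d hd) (Finset.le_sup (Finset.mem_univ σ))

/-- At the evaluation point the derivative part of the first-order Macdonald operator is `κ` times
the total Euler operator. That operator preserves physical vectors, so subtracting `κ` times it
leaves a lift of the spin part. -/
theorem lifts_logSum (hN : 1 ≤ N) (hq : Generic N q) (r : ℕ) :
    Lifts N q (logSum N q r (evPoint N))
      (fun d => ∑ j, (rhoDer N q r j - r * rhoSymm N q r / N) * (d j : ℂ)) := by
  intro n Ψ hΨ hL
  have hev := evPoint_mem_dom hN hq
  obtain ⟨X, h1, h2⟩ := exists_macdonald hq.1 (hq.sub_inv_ne_zero hN) ⟨_, hev⟩ r hΨ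
  obtain ⟨h3, h4⟩ := macdonald_leading hq.1 r h2 hL
  set κ : ℂ := r * rhoSymm N q r / N with hκ
  refine ⟨fun σ => X σ + MvPolynomial.C (-κ) * eulerV Finset.univ Ψ σ,
    h1.add (hΨ.euler_univ.smul (-κ)), fun σ => (h3 σ).add (((hL σ).euler _).smul _), ?_,
    fun σ d hd => ?_⟩
  · rw [evalV_add, evalV_smul, h2 _ hev]
    simp only [smul_add, Finset.sum_add_distrib]
    have e1 : ∑ J ∈ (Finset.univ : Finset (Fin N)).powersetCard r, coeffA N q J (evPoint N) •
        (logDer N J (q⁻¹, ratio (evPoint N))).mulVec (evalV (evPoint N) Ψ) =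
        (logSum N q r (evPoint N)).mulVec (evalV (evPoint N) Ψ) := by
      rw [logSum, Matrix.sum_mulVec]
      exact Finset.sum_congr rfl fun J _ => (Matrix.smul_mulVec _ _ _).symm
    have e2 : ∑ J ∈ (Finset.univ : Finset (Fin N)).powersetCard r, coeffA N q J (evPoint N) •
        evalV (evPoint N) (eulerV J Ψ) = κ • evalV (evPoint N) (eulerV Finset.univ Ψ) := by
      funext σ
      simp only [Finset.sum_apply, Pi.smul_apply, smul_eq_mul, evalV, eulerV, euler, map_sum,
        Finset.mul_sum]
      have e3 : ∀ J : Finset (Fin N), ∑ j ∈ J, coeffA N q J (evPoint N) *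
          MvPolynomial.eval (evPoint N) (MvPolynomial.X j * MvPolynomial.pderiv j (Ψ σ)) =
          ∑ j, if j ∈ J then coeffA N q J (evPoint N) *
          MvPolynomial.eval (evPoint N) (MvPolynomial.X j * MvPolynomial.pderiv j (Ψ σ)) else 0 := by
        intro J
        rw [← Finset.sum_filter]
        congr 1
        ext; simp
      rw [Finset.sum_congr rfl fun J _ => e3 J, Finset.sum_comm]
      apply Finset.sum_congr rfl
      intro j _
      rw [← Finset.sum_filter, ← Finset.sum_mul, hκ, ← markedSum_eq hN hq r j]
      rfl
    rw [e1, e2, neg_smul]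
    abel
  · rw [MvPolynomial.coeff_add, h4 σ d hd, MvPolynomial.coeff_C_mul, eulerV, coeff_euler]
    simp only [sub_mul, Finset.sum_sub_distrib, ← Finset.mul_sum]
    ring

end lifts

/-! ### Inverting the Hamiltonians into single modes -/

section modes
variable {N : ℕ} {q : ℂ}

theorem sum_powerset_mem (f : Fin N → ℂ) (j : Fin N) (t : ℂ) :
    ∑ s : Fin N, t ^ (s : ℕ) *
      ∑ J ∈ ((Finset.univ : Finset (Fin N)).powersetCard ((s : ℕ) + 1)).filter (fun J => j ∈ J),
        ∏ i ∈ J, f i = f j * ∏ i ∈ Finset.univ.erase j, (1 + t * f i) := by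
  classical
  have h1 : ∀ s : Fin N, t ^ (s : ℕ) *
      ∑ J ∈ ((Finset.univ : Finset (Fin N)).powersetCard ((s : ℕ) + 1)).filter (fun J => j ∈ J),
        ∏ i ∈ J, f i =
      ∑ K ∈ (Finset.univ.erase j).powersetCard (s : ℕ), f j * ∏ i ∈ K, (t * f i) := by
    intro s
    rw [Finset.mul_sum]
    symm
    refine Finset.sum_bij' (fun K _ => insert j K) (fun J _ => J.erase j) ?_ ?_ ?_ ?_ ?_
    · intro K hK
      have h := Finset.mem_powersetCard.1 hK
      have hj : j ∉ K := fun hj => Finset.notMem_erase j _ (h.1 hj)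
      simp [Finset.mem_powersetCard, Finset.card_insert_of_notMem hj, h.2]
    · intro J hJ
      simp only [Finset.mem_filter, Finset.mem_powersetCard] at hJ
      rw [Finset.mem_powersetCard, Finset.card_erase_of_mem hJ.2, hJ.1.2]
      exact ⟨Finset.erase_subset_erase _ hJ.1.1, rfl⟩
    · intro K hK
      have h := Finset.mem_powersetCard.1 hK
      exact Finset.erase_insert fun hj => Finset.notMem_erase j _ (h.1 hj)
    · intro J hJ
      exact Finset.insert_erase (Finset.mem_filter.1 hJ).2
    · intro K hK
      have h := Finset.mem_powersetCard.1 hK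
      have hj : j ∉ K := fun hj => Finset.notMem_erase j _ (h.1 hj)
      rw [Finset.prod_insert hj, Finset.prod_mul_distrib, Finset.prod_const, h.2]
      ring
  rw [Finset.sum_congr rfl fun s _ => h1 s, Finset.prod_one_add, Finset.mul_sum,
    Finset.sum_powerset, Finset.card_erase_of_mem (Finset.mem_univ j), Finset.card_fin,
    Fin.sum_univ_eq_sum_range (fun s => ∑ K ∈ (Finset.univ.erase j).powersetCard s,
      f j * ∏ i ∈ K, (t * f i))]
  have := j.pos
  congr 2
  omega

/-- The normalization of the inverse of `rhoDer`. -/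
def modeNorm (N : ℕ) (q : ℂ) (m : Fin N) : ℂ :=
  rho N q m * ∏ i ∈ Finset.univ.erase m, (1 - rho N q i / rho N q m)

/-- The inverse of the matrix `rhoDer`. -/
def modeCoeff (N : ℕ) (q : ℂ) (m s : Fin N) : ℂ :=
  (-(rho N q m)⁻¹) ^ (s : ℕ) / modeNorm N q m

theorem rho_ne_zero (hq : q ≠ 0) (j : Fin N) : rho N q j ≠ 0 := zpow_ne_zero _ hq

theorem rho_div_rho (hq : q ≠ 0) (i m : Fin N) :
    rho N q i / rho N q m = q⁻¹ ^ (2 * ((i : ℤ) - (m : ℤ))) := by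
  rw [rho, rho, ← zpow_sub₀ hq, inv_zpow, ← zpow_neg]
  congr 1
  ring

theorem modeNorm_ne_zero (hq : Generic N q) (m : Fin N) : modeNorm N q m ≠ 0 := by
  refine mul_ne_zero (rho_ne_zero hq.1 m) (Finset.prod_ne_zero_iff.2 fun i hi => ?_)
  have hne : i ≠ m := Finset.ne_of_mem_erase hi
  intro h
  have h1 : rho N q i = rho N q m := by
    have h2 : rho N q i / rho N q m = 1 := (sub_eq_zero.1 h).symm
    exact (div_eq_one_iff_eq (rho_ne_zero hq.1 m)).1 h2
  have key : ∀ a b : Fin N, a < b → rho N q a ≠ rho N q b := by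
    intro a b hab e
    have hab' : (a : ℕ) < b := hab
    have := b.2
    apply hq.2 ((b : ℕ) - a) (by omega) (by omega)
    have h3 : rho N q a / rho N q b = 1 := by rw [e, div_self (rho_ne_zero hq.1 b)]
    rw [rho_div_rho hq.1, inv_zpow, ← zpow_neg] at h3
    rw [← h3, ← zpow_natCast]
    congr 1
    push_cast [hab'.le]
    ring
  rcases lt_or_gt_of_ne hne with h | h
  · exact key _ _ h h1
  · exact key _ _ h h1.symm

/-- The generating function of `rhoDer` in the order is `ρ_j ∏_{i ≠ j} (1 + t ρ_i)`. At `t = -1 /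
ρ_m` it vanishes for `j ≠ m` and equals the normalization for `j = m`. -/
theorem modeCoeff_mul_rhoDer (hq : Generic N q) (m j : Fin N) :
    ∑ s : Fin N, modeCoeff N q m s * rhoDer N q ((s : ℕ) + 1) j = if m = j then 1 else 0 := by
  have h1 := sum_powerset_mem (rho N q) j (-(rho N q m)⁻¹)
  have h2 : ∑ s : Fin N, modeCoeff N q m s * rhoDer N q ((s : ℕ) + 1) j =
      (rho N q j * ∏ i ∈ Finset.univ.erase j, (1 + -(rho N q m)⁻¹ * rho N q i)) /
        modeNorm N q m := by
    rw [← h1, Finset.sum_div]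
    apply Finset.sum_congr rfl
    intro s _
    rw [modeCoeff, rhoDer]
    ring
  rw [h2]
  split_ifs with h
  · subst h
    rw [div_eq_one_iff_eq (modeNorm_ne_zero hq m), modeNorm]
    congr 1
    apply Finset.prod_congr rfl
    intro i _
    ring
  · have : ∏ i ∈ Finset.univ.erase j, (1 + -(rho N q m)⁻¹ * rho N q i) = 0 := by
      apply Finset.prod_eq_zero (Finset.mem_erase.2 ⟨h, Finset.mem_univ m⟩)
      rw [neg_mul, inv_mul_cancel₀ (rho_ne_zero hq.1 m), add_neg_cancel]
    rw [this, mul_zero, zero_div]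

theorem rhoDer_mul_modeCoeff (hq : Generic N q) (s t : Fin N) :
    ∑ j : Fin N, rhoDer N q ((s : ℕ) + 1) j * modeCoeff N q j t = if s = t then 1 else 0 := by
  have h1 : (Matrix.of fun m s : Fin N => modeCoeff N q m s) *
      (Matrix.of fun s j : Fin N => rhoDer N q ((s : ℕ) + 1) j) = 1 := by
    ext m j
    rw [Matrix.mul_apply, Matrix.one_apply]
    exact modeCoeff_mul_rhoDer hq m j
  have h2 := mul_eq_one_comm.1 h1
  have h3 := congrFun (congrFun h2 s) t
  rwa [Matrix.mul_apply, Matrix.one_apply] at h3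

/-- The mode operators: the combinations of the Hamiltonians that lift to
`z_m ∂/∂z_m - N⁻¹ ∑_j z_j ∂/∂z_j`. -/
def mode (N : ℕ) (q : ℂ) (m : Fin N) : Op N :=
  ∑ s : Fin N, modeCoeff N q m s • logSum N q ((s : ℕ) + 1) (evPoint N)

theorem logSum_eq_sum_mode (hq : Generic N q) (s : Fin N) :
    logSum N q ((s : ℕ) + 1) (evPoint N) =
      ∑ j : Fin N, rhoDer N q ((s : ℕ) + 1) j • mode N q j := by
  simp only [mode, Finset.smul_sum, smul_smul]
  rw [Finset.sum_comm]
  simp only [← Finset.sum_smul, rhoDer_mul_modeCoeff hq, ite_smul, one_smul, zero_smul,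
    Finset.sum_ite_eq, Finset.mem_univ, if_true]

/-- The multiplier no longer depends on `q`, and `N` times it is an integer. This discreteness
drives the rigidity of the spectrum. -/
theorem lifts_mode (hN : 1 ≤ N) (hq : Generic N q) (m : Fin N) :
    Lifts N q (mode N q m) (fun d => (d m : ℂ) - (∑ j, (d j : ℂ)) / N) := by
  have h := Lifts.sum Finset.univ fun (s : Fin N) _ =>
    (lifts_logSum hN hq ((s : ℕ) + 1)).smul (modeCoeff N q m s)
  have hN0 : (N : ℂ) ≠ 0 := Nat.cast_ne_zero.2 (by omega)
  have e1 : ∑ s : Fin N, modeCoeff N q m s * ((((s : ℕ) + 1 : ℕ) : ℂ) *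
      rhoSymm N q ((s : ℕ) + 1) / N) = 1 / N := by
    have : ∀ s : Fin N, modeCoeff N q m s * ((((s : ℕ) + 1 : ℕ) : ℂ) *
        rhoSymm N q ((s : ℕ) + 1) / N) =
        (∑ j, modeCoeff N q m s * rhoDer N q ((s : ℕ) + 1) j) / N := by
      intro s
      rw [← Finset.mul_sum, sum_rhoDer]
      ring
    rw [Finset.sum_congr rfl fun s _ => this s, ← Finset.sum_div, Finset.sum_comm]
    simp [modeCoeff_mul_rhoDer hq]
  have e2 : ∑ s : Fin N, (modeCoeff N q m s • fun d : Fin N →₀ ℕ =>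
      ∑ j, (rhoDer N q ((s : ℕ) + 1) j - (((s : ℕ) + 1 : ℕ) : ℂ) *
        rhoSymm N q ((s : ℕ) + 1) / N) * (d j : ℂ)) =
      fun d => (d m : ℂ) - (∑ j, (d j : ℂ)) / N := by
    funext d
    simp only [Finset.sum_apply, Pi.smul_apply, smul_eq_mul, Finset.mul_sum]
    rw [Finset.sum_comm]
    have : ∀ j : Fin N, ∑ s : Fin N, modeCoeff N q m s * ((rhoDer N q ((s : ℕ) + 1) j -
        (((s : ℕ) + 1 : ℕ) : ℂ) * rhoSymm N q ((s : ℕ) + 1) / N) * (d j : ℂ)) =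
        ((if m = j then 1 else 0) - 1 / N) * (d j : ℂ) := by
      intro j
      rw [← modeCoeff_mul_rhoDer hq m j, ← e1, ← Finset.sum_sub_distrib, Finset.sum_mul]
      exact Finset.sum_congr rfl fun s _ => by ring
    rw [Finset.sum_congr rfl fun j _ => this j]
    simp only [sub_mul, Finset.sum_sub_distrib, ite_mul, one_mul, zero_mul, Finset.sum_ite_eq,
      Finset.mem_univ, if_true, ← Finset.mul_sum]
    ring
  rw [e2] at h
  exact h

end modes

/-! ### Hermiticity for real `q` -/

section cyclotomic
variable {N : ℕ}

theorem prod_sub_evPoint (hN : 1 ≤ N) (x : ℂ) : ∏ i, (x - evPoint N i) = x ^ N - 1 := by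
  have h := isPrimitiveRoot_ev hN
  have h1 : Finset.univ.image (evPoint N) = Polynomial.nthRootsFinset N (1 : ℂ) := by
    apply Finset.eq_of_subset_of_card_le
    · intro y hy
      obtain ⟨i, -, rfl⟩ := Finset.mem_image.1 hy
      rw [Polynomial.mem_nthRootsFinset (by omega)]
      exact evPoint_pow hN i
    · rw [h.card_nthRootsFinset, Finset.card_image_of_injective _ (evPoint_injective hN),
        Finset.card_fin]
  have h2 := congrArg (Polynomial.eval x) (Polynomial.X_pow_sub_one_eq_prod (by omega) h)
  rw [← h1, Finset.prod_image fun a _ b _ e => evPoint_injective hN e, Polynomial.eval_prod] at h2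
  simpa using h2.symm

theorem prod_linear_evPoint (hN : 1 ≤ N) {q : ℂ} (hq : q ≠ 0) (j : Fin N) :
    ∏ i, (q * evPoint N j - q⁻¹ * evPoint N i) = q ^ N - q⁻¹ ^ N := by
  have h1 : ∀ i, q * evPoint N j - q⁻¹ * evPoint N i =
      q⁻¹ * (q ^ 2 * evPoint N j - evPoint N i) := fun i => by
    field_simp
  rw [Finset.prod_congr rfl fun i _ => h1 i, Finset.prod_mul_distrib, Finset.prod_const,
    Finset.card_fin, prod_sub_evPoint hN, mul_pow, evPoint_pow hN, mul_one, mul_sub, mul_one,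
    ← pow_mul, mul_comm 2 N, pow_mul, pow_two, ← mul_assoc, ← mul_pow, inv_mul_cancel₀ hq, one_pow,
    one_mul]

/-- The quotient of the two sides is a product over `J × Jᶜ` of a weight `s` with `s j i * s i j =
1`, so each factor can be extended to all `i ≠ j`. The cyclotomic identity gives `-1` for the
product over all `i`, and the diagonal factor is also `-1`. -/
theorem coeffA_compl (hN : 1 ≤ N) {q : ℂ} (hq : Generic N q) (J : Finset (Fin N)) :
    coeffA N q Jᶜ (evPoint N) = coeffA N q J (evPoint N) := by
  classical
  have hdom := evPoint_mem_dom hN hq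
  have hne : ∀ i j, i ≠ j → q * evPoint N i - q⁻¹ * evPoint N j ≠ 0 := fun i j h =>
    (hdom.2 i j h).2
  have hne' : ∀ i j, i ≠ j → q⁻¹ * evPoint N i - q * evPoint N j ≠ 0 := fun i j h e =>
    hne j i h.symm (by linear_combination -e)
  set s : Fin N → Fin N → ℂ := fun j i =>
    (q * evPoint N j - q⁻¹ * evPoint N i) / (q⁻¹ * evPoint N j - q * evPoint N i) with hs
  have h1 := prod_compl_eq s (fun i j hij => by
    simp only [hs]
    rw [div_mul_div_comm, div_eq_one_iff_eq (mul_ne_zero (hne' j i hij.symm) (hne' i j hij))]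
    ring) J
  have h2 : ∀ j, ∏ i ∈ Finset.univ.erase j, s j i = 1 := by
    intro j
    have hqN : q ^ N - q⁻¹ ^ N ≠ 0 := by
      rw [← prod_linear_evPoint hN hq.1 j]
      refine Finset.prod_ne_zero_iff.2 fun i _ => ?_
      by_cases hij : j = i
      · rw [← hij, ← sub_mul]
        exact mul_ne_zero (hq.sub_inv_ne_zero hN) (evPoint_ne_zero j)
      · exact hne j i hij
    have h3 : ∏ i, s j i = -1 := by
      have h4 := prod_linear_evPoint hN (inv_ne_zero hq.1) j
      rw [inv_inv] at h4
      rw [hs, Finset.prod_div_distrib, prod_linear_evPoint hN hq.1 j, h4,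
        div_eq_iff (by rw [← neg_sub]; exact neg_ne_zero.2 hqN)]
      ring
    have h5 : s j j = -1 := by
      have : q * evPoint N j - q⁻¹ * evPoint N j = (q - q⁻¹) * evPoint N j := by ring
      have h0 : (q - q⁻¹) * evPoint N j ≠ 0 :=
        mul_ne_zero (hq.sub_inv_ne_zero hN) (evPoint_ne_zero j)
      simp only [hs]
      rw [div_eq_iff]
      · ring
      · intro e
        exact h0 (by linear_combination -e)
    rw [← Finset.mul_prod_erase _ _ (Finset.mem_univ j), h5] at h3
    linear_combination -h3
  rw [Finset.prod_congr rfl fun j _ => h2 j, Finset.prod_const_one] at h1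
  have h6 : coeffA N q J (evPoint N) = coeffA N q Jᶜ (evPoint N) * ∏ j ∈ J, ∏ i ∈ Jᶜ, s j i := by
    rw [coeffA, coeffA, compl_compl, Finset.prod_comm (s := Jᶜ), ← Finset.prod_mul_distrib]
    refine Finset.prod_congr rfl fun j hj => ?_
    rw [← Finset.prod_mul_distrib]
    refine Finset.prod_congr rfl fun i hi => ?_
    have hij : i ≠ j := fun e => Finset.mem_compl.1 hi (e ▸ hj)
    have a1 := hne' j i hij.symm
    have a2 : evPoint N j - evPoint N i ≠ 0 := sub_ne_zero.2 (hdom.2 j i hij.symm).1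
    have a3 : evPoint N i - evPoint N j ≠ 0 := sub_ne_zero.2 (hdom.2 i j hij).1
    simp only [hs]
    rw [div_mul_div_comm, div_eq_div_iff a2 (mul_ne_zero a3 a1)]
    ring
  rw [h6, h1, mul_one]

end cyclotomic

/-! ### Hermiticity and commutativity of the modes -/

section hermitian
variable {N : ℕ}

theorem star_eq_inv {z : ℂ} (hz : ‖z‖ = 1) : star z = z⁻¹ := by
  rw [Complex.inv_def, Complex.normSq_eq_norm_sq, hz]; simp

/-- On the unit circle conjugation inverts the coordinates, which exchanges the roles of `J` and its
complement; `coeffA_compl` undoes the exchange. -/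
theorem star_coeffA (hN : 1 ≤ N) {q : ℝ} (hq : Generic N q) (J : Finset (Fin N)) :
    star (coeffA N q J (evPoint N)) = coeffA N q J (evPoint N) := by
  rw [← coeffA_compl hN hq J]
  conv_rhs => rw [coeffA_compl hN hq J]
  rw [coeffA, coeffA, compl_compl, Finset.prod_comm, star_prod]
  refine Finset.prod_congr rfl fun j hj => ?_
  rw [star_prod]
  refine Finset.prod_congr rfl fun i hi => ?_
  have hij : i ≠ j := fun e => Finset.mem_compl.1 hi (e ▸ hj)
  have hdom := evPoint_mem_dom hN hq
  have h1 := evPoint_ne_zero i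
  have h2 := evPoint_ne_zero j
  have h3 : evPoint N j - evPoint N i ≠ 0 := sub_ne_zero.2 (hdom.2 j i hij.symm).1
  have hq1 : star (q : ℂ) = q := Complex.conj_ofReal q
  have hq2 : star ((q : ℂ)⁻¹) = (q : ℂ)⁻¹ := by rw [star_inv₀, hq1]
  simp only [star_div₀, star_sub, star_mul', hq1, hq2, star_eq_inv (norm_evPoint hN _)]
  rw [← mul_div_mul_right _ _ (mul_ne_zero h1 h2)]
  congr 1
  · field_simp
  · field_simp

theorem siteR_mem_unitary {q : ℝ} (hq : 1 < q) (k : ℕ) {u : ℂ} (hu : ‖u‖ = 1) :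
    siteR N q k u ∈ unitary (Op N) := by
  have hq0 : (q : ℂ) ≠ 0 := Complex.ofReal_ne_zero.2 (by linarith)
  have hne : ∀ w : ℂ, ‖w‖ = 1 → (q : ℂ) * w - (q : ℂ)⁻¹ ≠ 0 := by
    intro w hw e
    have h1 := congrArg norm (sub_eq_zero.1 e)
    rw [norm_mul, hw, mul_one, norm_inv, Complex.norm_real, Real.norm_of_nonneg (by linarith)] at h1
    have h2 : q⁻¹ < 1 := inv_lt_one_of_one_lt₀ hq
    linarith
  have hu0 : u ≠ 0 := fun e => by simp [e] at hu
  have hu1 : ‖u⁻¹‖ = 1 := by rw [norm_inv, hu, inv_one]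
  rw [Unitary.mem_iff, Matrix.star_eq_conjTranspose, siteR_conjTranspose k hu]
  refine ⟨?_, siteR_mul_inv k hq0 hu0 (hne u hu) (hne _ hu1)⟩
  have := siteR_mul_inv (N := N) k hq0 (inv_ne_zero hu0) (hne _ hu1)
    (by rw [inv_inv]; exact hne u hu)
  rwa [inv_inv] at this

theorem transport_mem_unitary {q : ℝ} (hq : 1 < q) (J : Finset (Fin N)) {z : Fin N → ℂ}
    (hz : ∀ i, ‖z i‖ = 1) : transport N q J z ∈ unitary (Op N) := by
  apply list_prod_mem
  intro A hA
  obtain ⟨j, -, rfl⟩ := List.mem_map.1 hA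
  apply list_prod_mem
  intro B hB
  obtain ⟨i, -, rfl⟩ := List.mem_map.1 hB
  exact siteR_mem_unitary hq _ (by rw [norm_div, hz, hz, div_one])

/-- Rotating the lines in `J` by a phase keeps the transport unitary. Differentiating unitarity in
the angle gives a skew-Hermitian logarithmic derivative, which is `i` times the one in `p`. -/
theorem logDer_isHermitian {q : ℝ} (hq : 1 < q) (J : Finset (Fin N)) {z : Fin N → ℂ}
    (hz : ∀ i, ‖z i‖ = 1) (hg : Good (((q : ℂ)⁻¹, ratio z) : Spec N)) :
    (logDer N J ((q : ℂ)⁻¹, ratio z)).IsHermitian := by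
  have hq0 : (q : ℂ) ≠ 0 := Complex.ofReal_ne_zero.2 (by linarith)
  have hz0 : ∀ i, z i ≠ 0 := fun i e => by have := hz i; simp [e] at this
  set D := dTransport N J ((q : ℂ)⁻¹, ratio z) with hD
  set T := transport N q J z with hT
  have hTV : transportV N J ((q : ℂ)⁻¹, ratio z) = T := (transport_eq_transportV hq0 J hz0).symm
  set F : ℝ → Op N := fun θ => transport N q J (shift N (Complex.exp (θ * Complex.I)) J z) with hF
  have hFu : ∀ θ, star (F θ) * F θ = 1 := by
    intro θ
    refine (Unitary.mem_iff.1 (transport_mem_unitary hq J fun i => ?_)).1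
    unfold shift
    split_ifs
    · rw [norm_mul, Complex.norm_exp_ofReal_mul_I, hz, one_mul]
    · exact hz i
  have hF0 : F 0 = T := by
    simp only [hF, Complex.ofReal_zero, zero_mul, Complex.exp_zero, shift_one]
    rfl
  have hexp : HasDerivAt (fun θ : ℝ => Complex.exp (θ * Complex.I)) Complex.I 0 := by
    have h1 : HasDerivAt (fun θ : ℝ => (θ : ℂ) * Complex.I) Complex.I 0 := by
      simpa using (Complex.ofRealCLM.hasDerivAt (x := (0 : ℝ))).mul_const Complex.I
    simpa using h1.cexp
  have hFd : ∀ σ τ, HasDerivAt (fun θ : ℝ => F θ σ τ) (D σ τ * Complex.I) 0 := by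
    intro σ τ
    have h1 := hasDerivAt_transport hq0 J hz0 hg σ τ
    have e : (1 : ℂ) = Complex.exp (((0 : ℝ) : ℂ) * Complex.I) := by simp
    rw [e] at h1
    exact h1.comp (0 : ℝ) hexp
  have key : star T * D = star D * T := by
    ext σ τ
    have h1 : HasDerivAt (fun θ : ℝ => (star (F θ) * F θ) σ τ)
        (∑ ρ, (star (D ρ σ * Complex.I) * F 0 ρ τ + star (F 0 ρ σ) * (D ρ τ * Complex.I))) 0 := by
      simp only [Matrix.mul_apply, Matrix.star_apply]
      exact HasDerivAt.fun_sum fun ρ _ => (hFd ρ σ).star.mul (hFd ρ τ)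
    have h2 : HasDerivAt (fun θ : ℝ => (star (F θ) * F θ) σ τ) 0 0 := by
      simp only [hFu]
      exact hasDerivAt_const _ _
    have h3 := h1.unique h2
    rw [hF0] at h3
    have hI : star Complex.I = -Complex.I := Complex.conj_I
    simp only [Matrix.mul_apply, Matrix.star_apply]
    rw [← sub_eq_zero, ← Finset.sum_sub_distrib]
    refine (mul_eq_zero.1 (?_ : Complex.I * _ = 0)).resolve_left Complex.I_ne_zero
    rw [← h3, Finset.mul_sum]
    refine Finset.sum_congr rfl fun ρ _ => ?_
    rw [star_mul', hI]
    ring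
  have hinv : T⁻¹ = star T := Matrix.inv_eq_left_inv (by rw [← hF0]; exact hFu 0)
  rw [logDer, hTV, hinv, ← hD, Matrix.IsHermitian, ← Matrix.star_eq_conjTranspose, star_mul,
    star_star, key]

theorem rho_real (q : ℝ) (j : Fin N) : ∃ r : ℝ, rho N q j = r :=
  ⟨q ^ ((N : ℤ) - 1 - 2 * (j : ℕ)), by rw [rho]; push_cast; rfl⟩

theorem modeCoeff_real (q : ℝ) (m s : Fin N) : star (modeCoeff N q m s) = modeCoeff N q m s := by
  choose r hr using fun j => rho_real (N := N) q j
  have : modeCoeff N q m s = (((-(r m)⁻¹) ^ (s : ℕ) /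
      (r m * ∏ i ∈ Finset.univ.erase m, (1 - r i / r m)) : ℝ) : ℂ) := by
    simp only [modeCoeff, modeNorm, hr]
    push_cast
    rfl
  rw [this]
  exact Complex.conj_ofReal _

theorem generic_of_one_lt {q : ℝ} (hq : 1 < q) : Generic N (q : ℂ) := by
  refine ⟨Complex.ofReal_ne_zero.2 (by linarith), fun k hk _ h => ?_⟩
  have h1 : q ^ (2 * k) = 1 := by exact_mod_cast h
  exact (one_lt_pow₀ hq (by omega : 2 * k ≠ 0)).ne' h1

theorem IsHermitian.sum_smul {ι : Type*} (S : Finset ι) {c : ι → ℂ} {A : ι → Op N}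
    (hc : ∀ i ∈ S, star (c i) = c i) (hA : ∀ i ∈ S, (A i).IsHermitian) :
    (∑ i ∈ S, c i • A i).IsHermitian := by
  rw [Matrix.IsHermitian, Matrix.conjTranspose_sum]
  refine Finset.sum_congr rfl fun i hi => ?_
  rw [Matrix.conjTranspose_smul, hc i hi, hA i hi]

theorem mode_isHermitian (hN : 1 ≤ N) {q : ℝ} (hq : 1 < q) (m : Fin N) :
    (mode N q m).IsHermitian := by
  have hgen := generic_of_one_lt (N := N) hq
  have hg := good_of_mem_dom hgen.1 (evPoint_mem_dom hN hgen)
  exact IsHermitian.sum_smul _ (fun s _ => modeCoeff_real q m s) fun s _ =>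
    IsHermitian.sum_smul _ (fun J _ => star_coeffA hN hgen J) fun J _ =>
      logDer_isHermitian hq J (norm_evPoint hN) hg

/-- Multiplied by `i` the commutator is Hermitian, and it lifts with multiplier zero, so it has no
nonzero eigenvalue. -/
theorem mode_comm_of_real (hN : 1 ≤ N) {q : ℝ} (hq : 1 < q) (m m' : Fin N) :
    mode N q m * mode N q m' = mode N q m' * mode N q m := by
  have hgen := generic_of_one_lt (N := N) hq
  have h1 := (lifts_mode hN hgen m).commutator (lifts_mode hN hgen m')
  have h2 := h1.smul Complex.I
  rw [smul_zero] at h2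
  have h3 : (Complex.I • (mode N q m * mode N q m' - mode N q m' * mode N q m)).IsHermitian := by
    rw [Matrix.IsHermitian, Matrix.conjTranspose_smul, Matrix.conjTranspose_sub,
      Matrix.conjTranspose_mul, Matrix.conjTranspose_mul, mode_isHermitian hN hq m,
      mode_isHermitian hN hq m']
    have hI : star Complex.I = -Complex.I := Complex.conj_I
    rw [hI, neg_smul, ← smul_neg, neg_sub]
  have h4 : Complex.I • (mode N q m * mode N q m' - mode N q m' * mode N q m) = 0 := by
    by_contra hne
    obtain ⟨v, t, ht, hv, he⟩ := h3.exists_eigenvector_of_ne_zero hne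
    obtain ⟨d, hd⟩ := h2.eigenvalue hN hgen hv (c := (t : ℂ)) (by rw [he]; rfl)
    exact ht (by simpa using hd.symm)
  exact sub_eq_zero.1 ((smul_eq_zero.1 h4).resolve_left Complex.I_ne_zero)

end hermitian

/-! ### The `q`-binomial formula and the dispersion relation -/

section qbinomial

theorem esymm_cons (a : ℂ) (s : Multiset ℂ) (n : ℕ) :
    (a ::ₘ s).esymm (n + 1) = s.esymm (n + 1) + a * s.esymm n := by
  simp only [Multiset.esymm, Multiset.powersetCard_cons, Multiset.map_add, Multiset.sum_add,
    Multiset.map_map, Function.comp_def, Multiset.prod_cons, Multiset.sum_map_mul_left]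

theorem esymm_smul (c : ℂ) (s : Multiset ℂ) (n : ℕ) :
    (s.map (c * ·)).esymm n = c ^ n * s.esymm n := by
  induction s using Multiset.induction_on generalizing n with
  | empty =>
    rw [Multiset.map_zero]
    cases n with
    | zero => simp
    | succ n => simp [Multiset.esymm, Multiset.powersetCard_zero_right]
  | cons a s ih =>
    cases n with
    | zero => simp [Multiset.esymm]
    | succ n =>
      rw [Multiset.map_cons, esymm_cons, esymm_cons, ih, ih]
      ring

theorem rhoSymm_eq_esymm (N : ℕ) (q : ℂ) (r : ℕ) :
    rhoSymm N q r =
      ((Multiset.range N).map fun j : ℕ => q ^ ((N : ℤ) - 1 - 2 * (j : ℤ))).esymm r := by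
  have h1 : (Finset.univ : Finset (Fin N)).val.map (rho N q) =
      (Multiset.range N).map fun j : ℕ => q ^ ((N : ℤ) - 1 - 2 * (j : ℤ)) := by
    have h2 := congrArg Finset.val (Fin.map_valEmbedding_univ (n := N))
    rw [Finset.map_val, Nat.Iio_eq_range, Finset.range_val] at h2
    rw [← h2, Multiset.map_map]
    rfl
  rw [← h1, Finset.esymm_map_val]
  rfl

theorem qInt_mul (q : ℂ) (h : q - q⁻¹ ≠ 0) (n : ℕ) :
    qInt q n * (q - q⁻¹) = q ^ n - q⁻¹ ^ n := div_mul_cancel₀ _ h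

theorem qBinom_succ_succ (q : ℂ) (n r : ℕ) :
    qBinom q (n + 1) (r + 1) = qInt q (n + 1) / qInt q (r + 1) * qBinom q n r := by
  rw [qBinom, qBinom, Finset.prod_range_succ', Finset.prod_range_succ, Nat.sub_zero]
  simp only [Nat.add_sub_add_right]
  rw [div_mul_div_comm]
  congr 1 <;> ring

theorem qBinom_succ (q : ℂ) (n r : ℕ) :
    qBinom q n (r + 1) = qInt q (n - r) / qInt q (r + 1) * qBinom q n r := by
  rw [qBinom, qBinom, Finset.prod_range_succ, Finset.prod_range_succ, div_mul_div_comm]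
  congr 1 <;> ring

theorem qInt_zero (q : ℂ) : qInt q 0 = 0 := by simp [qInt]

theorem qBinom_eq_zero (q : ℂ) {n r : ℕ} (h : n < r) : qBinom q n r = 0 := by
  rw [qBinom, Finset.prod_eq_zero (Finset.mem_range.2 h), zero_div]
  rw [Nat.sub_self, qInt_zero]

theorem qInt_split {q : ℂ} (hq : q ≠ 0) (h : q - q⁻¹ ≠ 0) (a b : ℕ) :
    qInt q (a + b) = q ^ b * qInt q a + q⁻¹ ^ a * qInt q b := by
  apply mul_right_cancel₀ h
  rw [add_mul, mul_assoc, mul_assoc, qInt_mul q h, qInt_mul q h, qInt_mul q h]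
  have : q⁻¹ ^ b * q ^ b = 1 := by rw [← mul_pow, inv_mul_cancel₀ hq, one_pow]
  ring

/-- The spectrum for `n + 1` is `q` times the spectrum for `n` together with one new element, and
the recursion is the `q`-Pascal rule. -/
theorem esymm_eq_qBinom {q : ℂ} (hq : q ≠ 0) (h : q - q⁻¹ ≠ 0) {R : ℕ}
    (hR : ∀ k, 1 ≤ k → k ≤ R → qInt q k ≠ 0) (n : ℕ) : ∀ r ≤ R,
    ((Multiset.range n).map fun j : ℕ => q ^ ((n : ℤ) - 1 - 2 * (j : ℤ))).esymm r =
      qBinom q n r := by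
  induction n with
  | zero =>
    intro r _
    cases r with
    | zero => simp [Multiset.esymm, qBinom]
    | succ r =>
      rw [qBinom_eq_zero q (Nat.succ_pos r)]
      simp [Multiset.esymm, Multiset.powersetCard_zero_right]
  | succ n ih =>
    intro r hr
    cases r with
    | zero => simp [Multiset.esymm, qBinom]
    | succ r =>
      have h1 : ((Multiset.range n).map fun j : ℕ =>
          q ^ (((n + 1 : ℕ) : ℤ) - 1 - 2 * (j : ℤ))) =
          ((Multiset.range n).map fun j : ℕ => q ^ ((n : ℤ) - 1 - 2 * (j : ℤ))).map (q * ·) := by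
        rw [Multiset.map_map]
        refine Multiset.map_congr rfl fun j _ => ?_
        simp only [Function.comp_apply]
        rw [← zpow_one_add₀ hq]
        congr 1
        push_cast
        ring
      rw [Multiset.range_succ, Multiset.map_cons, esymm_cons, h1, esymm_smul, esymm_smul,
        ih _ hr, ih r (by omega), qBinom_succ_succ, qBinom_succ]
      have hr0 : qInt q (r + 1) ≠ 0 := hR _ (by omega) hr
      by_cases hrn : r ≤ n
      · obtain ⟨a, rfl⟩ : ∃ a, n = a + r := ⟨n - r, by omega⟩
        have h2 := qInt_split hq h a (r + 1)
        rw [Nat.add_sub_cancel, show a + r + 1 = a + (r + 1) by ring, h2]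
        have h3 : q ^ (((a + (r + 1) : ℕ) : ℤ) - 1 - 2 * ((a + r : ℕ) : ℤ)) * q ^ r =
            q⁻¹ ^ a := by
          rw [← zpow_natCast q r, ← zpow_add₀ hq, inv_pow, ← zpow_natCast, ← zpow_neg]
          congr 1
          push_cast
          ring
        rw [← mul_assoc (q ^ (((a + (r + 1) : ℕ) : ℤ) - 1 - 2 * ((a + r : ℕ) : ℤ))), h3]
        field_simp
      · rw [qBinom_eq_zero q (by omega : n < r)]
        ring

theorem Generic.qInt_ne_zero {N : ℕ} {q : ℂ} (hq : Generic N q) (h : q - q⁻¹ ≠ 0) (k : ℕ)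
    (h1 : 1 ≤ k) (h2 : k ≤ N) : qInt q k ≠ 0 := by
  refine div_ne_zero (fun e => hq.2 k h1 h2 ?_) h
  rw [two_mul, pow_add]
  nth_rewrite 2 [sub_eq_zero.1 e]
  rw [← mul_pow, mul_inv_cancel₀ hq.1, one_pow]

theorem rhoSymm_eq_qBinom {N : ℕ} (hN : 1 ≤ N) {q : ℂ} (hq : Generic N q) {r : ℕ} (hr : r ≤ N) :
    rhoSymm N q r = qBinom q N r := by
  have h := hq.sub_inv_ne_zero hN
  rw [rhoSymm_eq_esymm, esymm_eq_qBinom hq.1 h (hq.qInt_ne_zero h) N r hr]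

end qbinomial

/-! ### The dispersion relation as a sum over modes -/

section dispersion
variable {N : ℕ} {q : ℂ}

theorem rhoDer_zero (q : ℂ) (j : Fin N) : rhoDer N q 0 j = 0 := by
  apply Finset.sum_eq_zero
  intro J hJ
  simp only [Finset.mem_filter, Finset.mem_powersetCard, Finset.card_eq_zero] at hJ
  exact absurd hJ.2 (by rw [hJ.1.2]; exact Finset.notMem_empty j)

/-- Removing `j` from a set that contains it leaves a set of size `r` avoiding `j`. Iterating gives
the alternating sum in the dispersion relation. -/
theorem rhoDer_succ (q : ℂ) (r : ℕ) (j : Fin N) :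
    rhoDer N q (r + 1) j = rho N q j * (rhoSymm N q r - rhoDer N q r j) := by
  classical
  have h1 : rhoSymm N q r - rhoDer N q r j =
      ∑ J ∈ ((Finset.univ : Finset (Fin N)).powersetCard r).filter (fun J => j ∉ J),
        ∏ i ∈ J, rho N q i := by
    rw [rhoSymm, rhoDer, ← Finset.sum_filter_add_sum_filter_not _ (fun J => j ∈ J)]
    ring
  rw [h1, rhoDer, Finset.mul_sum]
  symm
  refine Finset.sum_bij' (fun K _ => insert j K) (fun J _ => J.erase j) ?_ ?_ ?_ ?_ ?_
  · intro K hK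
    simp only [Finset.mem_filter, Finset.mem_powersetCard] at hK ⊢
    exact ⟨⟨Finset.subset_univ _, by rw [Finset.card_insert_of_notMem hK.2, hK.1.2]⟩,
      Finset.mem_insert_self _ _⟩
  · intro J hJ
    simp only [Finset.mem_filter, Finset.mem_powersetCard] at hJ ⊢
    exact ⟨⟨Finset.subset_univ _, by rw [Finset.card_erase_of_mem hJ.2, hJ.1.2]; rfl⟩,
      Finset.notMem_erase _ _⟩
  · intro K hK
    exact Finset.erase_insert (Finset.mem_filter.1 hK).2
  · intro J hJ
    exact Finset.insert_erase (Finset.mem_filter.1 hJ).2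
  · intro K hK
    rw [Finset.prod_insert (Finset.mem_filter.1 hK).2]

theorem rhoDer_eq_sum (q : ℂ) (r : ℕ) (j : Fin N) :
    rhoDer N q r j = ∑ s ∈ Finset.Icc 1 r, (-1) ^ (s - 1) * rhoSymm N q (r - s) *
      rho N q j ^ s := by
  induction r with
  | zero => rw [rhoDer_zero]; rfl
  | succ r ih =>
    rw [rhoDer_succ, ih, ← Finset.add_sum_Ioc_eq_sum_Icc (by omega : 1 ≤ r + 1)]
    have h1 : ∑ s ∈ Finset.Ioc 1 (r + 1), (-1 : ℂ) ^ (s - 1) * rhoSymm N q (r + 1 - s) *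
        rho N q j ^ s = ∑ s ∈ Finset.Icc 1 r, (-1 : ℂ) ^ s * rhoSymm N q (r - s) *
        rho N q j ^ (s + 1) := by
      symm
      refine Finset.sum_bij' (fun s _ => s + 1) (fun s _ => s - 1) ?_ ?_ ?_ ?_ ?_
      · intro s hs
        simp only [Finset.mem_Icc, Finset.mem_Ioc] at hs ⊢
        omega
      · intro s hs
        simp only [Finset.mem_Icc, Finset.mem_Ioc] at hs ⊢
        omega
      · intro s _; rfl
      · intro s hs
        simp only [Finset.mem_Ioc] at hs
        omega
      · intro s _
        simp only [Nat.add_sub_cancel, Nat.add_sub_add_right]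
    rw [h1, mul_sub, Finset.mul_sum, sub_eq_add_neg, ← Finset.sum_neg_distrib]
    congr 1
    · simp; ring
    · refine Finset.sum_congr rfl fun s hs => ?_
      obtain ⟨t, rfl⟩ : ∃ t, s = t + 1 := ⟨s - 1, by have := Finset.mem_Icc.1 hs; omega⟩
      rw [Nat.add_sub_cancel]
      ring

theorem sum_rho_pow (hN : 1 ≤ N) (hq : Generic N q) {s : ℕ} (h1 : 1 ≤ s) (h2 : s ≤ N) {n : ℕ}
    (hn : n ≤ N) :
    ∑ j ∈ Finset.univ.filter (fun j : Fin N => (j : ℕ) < n), rho N q j ^ s =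
      q ^ ((s : ℤ) * ((N : ℤ) - (n : ℤ))) * (qInt q (s * n) / qInt q s) := by
  have h := hq.sub_inv_ne_zero hN
  have hs := hq.qInt_ne_zero h s h1 h2
  have e1 : ∀ k, qInt q k * (q - q⁻¹) = q ^ (k : ℤ) - q ^ (-(k : ℤ)) := fun k => by
    rw [qInt_mul q h, zpow_natCast, zpow_neg, zpow_natCast, inv_pow]
  have key : ∀ m ≤ N, (∑ j ∈ Finset.univ.filter (fun j : Fin N => (j : ℕ) < m), rho N q j ^ s) *
      (qInt q s * (q - q⁻¹)) = q ^ ((s : ℤ) * N) - q ^ ((s : ℤ) * ((N : ℤ) - 2 * m)) := by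
    intro m
    induction m with
    | zero => intro _; simp
    | succ m ih =>
      intro hm
      have hs : Finset.univ.filter (fun p : Fin N => (p : ℕ) < m + 1) =
          insert ⟨m, hm⟩ (Finset.univ.filter (fun p : Fin N => (p : ℕ) < m)) := by
        ext p
        simp only [Finset.mem_filter, Finset.mem_univ, true_and, Finset.mem_insert, Fin.ext_iff]
        omega
      rw [hs, Finset.sum_insert (by simp), add_mul, ih (by omega), e1, rho, ← zpow_natCast,
        ← zpow_mul, mul_sub, ← zpow_add₀ hq.1, ← zpow_add₀ hq.1]
      have a1 : ((N : ℤ) - 1 - 2 * (m : ℤ)) * (s : ℤ) + (s : ℤ) = s * ((N : ℤ) - 2 * m) := by ring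
      have a2 : ((N : ℤ) - 1 - 2 * (m : ℤ)) * (s : ℤ) + -(s : ℤ) =
          s * ((N : ℤ) - 2 * ((m + 1 : ℕ) : ℤ)) := by push_cast; ring
      simp only
      rw [a1, a2]
      ring
  rw [← mul_div_assoc, eq_div_iff hs]
  apply mul_right_cancel₀ h
  rw [mul_assoc, key n hn, mul_assoc, e1, mul_sub (q ^ _), ← zpow_add₀ hq.1, ← zpow_add₀ hq.1]
  congr 2
  · push_cast; ring
  · push_cast; ring

/-- A particle at `n` occupies the first `n` modes, with the mean `n / N` removed. The power sums
over these modes are geometric. -/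
theorem dispersion_eq (hN : 1 ≤ N) (hq : Generic N q) {r : ℕ} (hr : r ≤ N) {n : ℕ} (hn : n ≤ N) :
    (q - q⁻¹) * dispersion N q r n =
      ∑ j : Fin N, rhoDer N q r j * ((if (j : ℕ) < n then 1 else 0) - (n : ℂ) / N) := by
  have h := hq.sub_inv_ne_zero hN
  rw [dispersion, mul_inv_cancel_left₀ h]
  simp only [mul_sub, Finset.sum_sub_distrib, mul_ite, mul_one, mul_zero, ← Finset.sum_mul]
  rw [sum_rhoDer, rhoSymm_eq_qBinom hN hq hr, ← Finset.sum_filter]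
  congr 1
  · simp only [rhoDer_eq_sum]
    rw [Finset.sum_comm]
    refine Finset.sum_congr rfl fun s hs => ?_
    have hs' := Finset.mem_Icc.1 hs
    rw [← Finset.mul_sum, sum_rho_pow hN hq hs'.1 (by omega) hn, rhoSymm_eq_qBinom hN hq (by omega)]
    rw [← mul_sub (s : ℤ)]
    simp only [mul_assoc]
  · ring

end dispersion

/-! ### The mode operators near the crystal limit -/

/-- The admissible values of `Q = q⁻¹`, including the crystal limit `Q = 0`. -/
def Adm (N : ℕ) : Set ℂ := {Q | ∀ k : ℕ, 1 ≤ k → k ≤ N → Q ^ (2 * k) ≠ 1}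

section adm
variable {N : ℕ}

theorem generic_iff {q : ℂ} : Generic N q ↔ q ≠ 0 ∧ q⁻¹ ∈ Adm N := by
  refine and_congr_right fun _ => forall_congr' fun k => forall_congr' fun _ =>
    forall_congr' fun _ => ?_
  rw [inv_pow, Ne, Ne, inv_eq_one]

theorem zero_mem_adm (N : ℕ) : (0 : ℂ) ∈ Adm N := fun k hk _ => by
  rw [zero_pow (by omega)]; exact zero_ne_one

theorem isOpen_adm (N : ℕ) : IsOpen (Adm N) := by
  have : Adm N = ⋂ k ∈ Finset.Icc 1 N, {Q : ℂ | Q ^ (2 * k) ≠ 1} := by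
    ext Q
    simp [Adm]
  rw [this]
  exact isOpen_biInter_finset fun k _ => isOpen_ne_fun (by fun_prop) continuous_const

theorem eventually_generic (N : ℕ) : ∀ᶠ Q in 𝓝[≠] (0 : ℂ), Q ≠ 0 ∧ Generic N Q⁻¹ := by
  filter_upwards [self_mem_nhdsWithin,
    mem_nhdsWithin_of_mem_nhds ((isOpen_adm N).mem_nhds (zero_mem_adm N))] with Q h1 h2
  exact ⟨h1, generic_iff.2 ⟨inv_ne_zero h1, by rwa [inv_inv]⟩⟩

/-- The regularized coefficients `∏_{j ∈ J ∌ i} (z_j - Q² z_i) / (z_j - z_i)`. -/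
def crossB (N : ℕ) (Q : ℂ) (J : Finset (Fin N)) : ℂ :=
  ∏ j ∈ J, ∏ i ∈ Jᶜ, (evPoint N j - Q ^ 2 * evPoint N i) / (evPoint N j - evPoint N i)

theorem analyticAt_crossB (J : Finset (Fin N)) (Q : ℂ) :
    AnalyticAt ℂ (fun Q => crossB N Q J) Q :=
  Finset.analyticAt_fun_prod _ fun _ _ => Finset.analyticAt_fun_prod _ fun _ _ =>
    (analyticAt_const.sub ((analyticAt_id.pow 2).mul analyticAt_const)).div_const

theorem coeffA_eq_crossB {q : ℂ} (hq : q ≠ 0) (J : Finset (Fin N)) :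
    coeffA N q J (evPoint N) = q ^ ((J.card : ℤ) * ((N : ℤ) - J.card)) * crossB N q⁻¹ J := by
  have h1 : ∀ i j : Fin N, (q * evPoint N j - q⁻¹ * evPoint N i) / (evPoint N j - evPoint N i) =
      q * ((evPoint N j - q⁻¹ ^ 2 * evPoint N i) / (evPoint N j - evPoint N i)) := by
    intro i j
    rw [← mul_div_assoc]
    congr 1
    field_simp
  rw [coeffA, crossB]
  simp only [h1, Finset.prod_mul_distrib, Finset.prod_const]
  congr 1
  have hJ : J.card ≤ N := by simpa using J.card_le_univ
  rw [Finset.card_compl, Fintype.card_fin, ← pow_mul, ← zpow_natCast]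
  congr 1
  push_cast [hJ]
  ring

theorem prod_zpow_range {Q : ℂ} (hQ : Q ≠ 0) (N r : ℕ) :
    ∏ k ∈ Finset.range r, Q ^ ((N : ℤ) - 1 - 2 * (k : ℤ)) = Q ^ ((r : ℤ) * ((N : ℤ) - r)) := by
  induction r with
  | zero => simp
  | succ r ih =>
    rw [Finset.prod_range_succ, ih, ← zpow_add₀ hQ]
    congr 1
    push_cast
    ring

theorem qInt_div {Q : ℂ} (hQ : Q ≠ 0) (h : Q⁻¹ - Q ≠ 0) {k : ℕ} (hk : k < N) :
    qInt Q⁻¹ (N - k) / qInt Q⁻¹ (k + 1) = Q⁻¹ ^ ((N : ℤ) - 1 - 2 * (k : ℤ)) *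
      ((1 - Q ^ (2 * (N - k))) / (1 - Q ^ (2 * (k + 1)))) := by
  have h1 : ∀ n, qInt Q⁻¹ n = Q⁻¹ ^ (n : ℤ) * (1 - Q ^ (2 * n)) / (Q⁻¹ - Q) := by
    intro n
    rw [qInt, inv_inv, zpow_natCast, mul_sub, mul_one, two_mul, pow_add, ← mul_assoc, ← mul_pow,
      inv_mul_cancel₀ hQ, one_pow, one_mul]
  rw [h1, h1, div_div_div_cancel_right₀ h, mul_div_mul_comm, ← zpow_sub₀ (inv_ne_zero hQ)]
  congr 2
  push_cast [hk.le]
  ring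

theorem sum_crossB_of_ne (hN : 1 ≤ N) {Q : ℂ} (hQ : Q ≠ 0) (hg : Generic N Q⁻¹) {r : ℕ}
    (hr : r ≤ N) :
    ∑ J ∈ (Finset.univ : Finset (Fin N)).powersetCard r, crossB N Q J =
      ∏ k ∈ Finset.range r, (1 - Q ^ (2 * (N - k))) / (1 - Q ^ (2 * (k + 1))) := by
  have h := hg.sub_inv_ne_zero hN
  have h1 := sum_coeffA hg.1 h r (evPoint_mem_dom hN hg)
  rw [rhoSymm_eq_qBinom hN hg hr, qBinom, ← Finset.prod_div_distrib] at h1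
  rw [inv_inv] at h
  rw [Finset.prod_congr rfl fun k hk =>
    qInt_div hQ h (lt_of_lt_of_le (Finset.mem_range.1 hk) hr), Finset.prod_mul_distrib,
    prod_zpow_range (inv_ne_zero hQ)] at h1
  apply mul_left_cancel₀ (zpow_ne_zero ((r : ℤ) * ((N : ℤ) - r)) (inv_ne_zero hQ))
  rw [← h1, Finset.mul_sum]
  refine Finset.sum_congr rfl fun J hJ => ?_
  rw [coeffA_eq_crossB hg.1, (Finset.mem_powersetCard.1 hJ).2, inv_inv]

theorem marked_crossB_of_ne (hN : 1 ≤ N) {Q : ℂ} (hQ : Q ≠ 0) (hg : Generic N Q⁻¹) (r : ℕ)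
    (j : Fin N) :
    ∑ J ∈ ((Finset.univ : Finset (Fin N)).powersetCard r).filter (fun J => j ∈ J), crossB N Q J =
      r / N * ∑ J ∈ (Finset.univ : Finset (Fin N)).powersetCard r, crossB N Q J := by
  have h1 := sum_coeffA hg.1 (hg.sub_inv_ne_zero hN) r (evPoint_mem_dom hN hg)
  have h2 := markedSum_eq hN hg r j
  apply mul_left_cancel₀ (zpow_ne_zero ((r : ℤ) * ((N : ℤ) - r)) (inv_ne_zero hQ))
  rw [mul_left_comm]
  have e : ∀ s ⊆ (Finset.univ : Finset (Fin N)).powersetCard r,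
      Q⁻¹ ^ ((r : ℤ) * ((N : ℤ) - r)) * ∑ J ∈ s, crossB N Q J =
      ∑ J ∈ s, coeffA N Q⁻¹ J (evPoint N) := by
    intro s hs
    rw [Finset.mul_sum]
    refine Finset.sum_congr rfl fun J hJ => ?_
    rw [coeffA_eq_crossB hg.1, (Finset.mem_powersetCard.1 (hs hJ)).2, inv_inv]
  rw [e _ (Finset.filter_subset _ _), e _ subset_rfl, h1, ← markedSum, h2]
  ring

/-- Used to carry the summation identities for the coefficients to the crystal point, where `q =
Q⁻¹` is not available. -/
theorem eq_at_zero {f g : ℂ → ℂ} (hf : ContinuousAt f 0) (hg : ContinuousAt g 0)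
    (h : ∀ Q, Q ≠ 0 → Generic N Q⁻¹ → f Q = g Q) : f 0 = g 0 := by
  have h1 : Filter.Tendsto f (𝓝[≠] 0) (𝓝 (f 0)) := hf.tendsto.mono_left nhdsWithin_le_nhds
  have h2 : Filter.Tendsto g (𝓝[≠] 0) (𝓝 (g 0)) := hg.tendsto.mono_left nhdsWithin_le_nhds
  refine tendsto_nhds_unique (h1.congr' ?_) h2
  filter_upwards [eventually_generic N] with Q hQ
  exact h Q hQ.1 hQ.2

theorem continuousAt_sum_crossB (s : Finset (Finset (Fin N))) (Q : ℂ) :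
    ContinuousAt (fun Q => ∑ J ∈ s, crossB N Q J) Q :=
  (Finset.analyticAt_fun_sum s fun J _ => analyticAt_crossB J Q).continuousAt

theorem sum_crossB_zero (hN : 1 ≤ N) {r : ℕ} (hr : r ≤ N) :
    ∑ J ∈ (Finset.univ : Finset (Fin N)).powersetCard r, crossB N 0 J = 1 := by
  have h1 := eq_at_zero (N := N) (continuousAt_sum_crossB
    ((Finset.univ : Finset (Fin N)).powersetCard r) 0)
    (g := fun Q => ∏ k ∈ Finset.range r, (1 - Q ^ (2 * (N - k))) / (1 - Q ^ (2 * (k + 1))))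
    ?_ fun Q hQ hg => sum_crossB_of_ne hN hQ hg hr
  · rw [h1]
    refine Finset.prod_eq_one fun k hk => ?_
    have := Finset.mem_range.1 hk
    rw [zero_pow (by omega), zero_pow (by omega)]
    simp
  · refine AnalyticAt.continuousAt (𝕜 := ℂ) (Finset.analyticAt_fun_prod _ fun k _ => ?_)
    exact (analyticAt_const.sub (analyticAt_id.pow _)).div
      (analyticAt_const.sub (analyticAt_id.pow _)) (by simp)

theorem marked_crossB_zero (hN : 1 ≤ N) {r : ℕ} (hr : r ≤ N) (j : Fin N) :
    ∑ J ∈ ((Finset.univ : Finset (Fin N)).powersetCard r).filter (fun J => j ∈ J), crossB N 0 J =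
      r / N := by
  have h1 := eq_at_zero (N := N) (continuousAt_sum_crossB
    (((Finset.univ : Finset (Fin N)).powersetCard r).filter (fun J => j ∈ J)) 0)
    (g := fun Q => r / N * ∑ J ∈ (Finset.univ : Finset (Fin N)).powersetCard r, crossB N Q J)
    (continuousAt_const.mul (continuousAt_sum_crossB _ 0))
    fun Q hQ hg => marked_crossB_of_ne hN hQ hg r j
  rw [h1, sum_crossB_zero hN hr, mul_one]

end adm

/-! ### Analytic modes and their crystal values -/

section modeQ
variable {N : ℕ}

/-- The regularized normalization of the modes. -/
def modeDen (N : ℕ) (Q : ℂ) (m : Fin N) : ℂ :=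
  (∏ i ∈ Finset.Iio m, (Q ^ (2 * ((m : ℕ) - (i : ℕ))) - 1)) *
    ∏ i ∈ Finset.Ioi m, (1 - Q ^ (2 * ((i : ℕ) - (m : ℕ))))

/-- The regularized weights of the modes. -/
def modeWeight (N : ℕ) (Q : ℂ) (m : Fin N) (r : ℕ) : ℂ :=
  (-1) ^ (r + 1) * Q ^ (((r : ℤ) - (m : ℕ)) * ((r : ℤ) - (m : ℕ) - 1)).toNat / modeDen N Q m

/-- The mode operators as functions of `Q = q⁻¹`. -/
def modeQ (N : ℕ) (Q : ℂ) (m : Fin N) : Op N :=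
  ∑ J : Finset (Fin N), (modeWeight N Q m J.card * crossB N Q J) •
    logDer N J (Q, ratio (evPoint N))

theorem modeDen_ne_zero {Q : ℂ} (hQ : Q ∈ Adm N) (m : Fin N) : modeDen N Q m ≠ 0 := by
  refine mul_ne_zero (Finset.prod_ne_zero_iff.2 fun i hi => ?_)
    (Finset.prod_ne_zero_iff.2 fun i hi => ?_)
  · have h1 : (i : ℕ) < m := Fin.lt_def.1 (Finset.mem_Iio.1 hi)
    have := m.2
    exact sub_ne_zero.2 (hQ _ (by omega) (by omega))
  · have h1 : (m : ℕ) < i := Fin.lt_def.1 (Finset.mem_Ioi.1 hi)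
    have := i.2
    exact sub_ne_zero.2 (hQ _ (by omega) (by omega)).symm

theorem good_adm (hN : 1 ≤ N) {Q : ℂ} (hQ : Q ∈ Adm N) :
    Good ((Q, ratio (evPoint N)) : Spec N) := good_evPoint hN (hQ N hN le_rfl)

theorem anOp_modeQ (hN : 1 ≤ N) {Q : ℂ} (hQ : Q ∈ Adm N) (m : Fin N) :
    AnOp (fun Q => modeQ N Q m) Q := by
  refine AnOp.sum _ fun J _ => AnOp.smul (AnalyticAt.mul ?_ (analyticAt_crossB J Q))
    (AnOp.comp (f := fun Q => (Q, ratio (evPoint N))) (anOp_logDer J (good_adm hN hQ))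
      (analyticAt_id.prod analyticAt_const))
  refine (analyticAt_const.mul (analyticAt_id.pow _)).div ?_ (modeDen_ne_zero hQ m)
  exact (Finset.analyticAt_fun_prod _ fun i _ => (analyticAt_id.pow _).sub analyticAt_const).mul
    (Finset.analyticAt_fun_prod _ fun i _ => analyticAt_const.sub (analyticAt_id.pow _))

theorem sum_Iio (m : Fin N) :
    ∑ i ∈ Finset.Iio m, 2 * ((i : ℤ) - (m : ℤ)) = -((m : ℤ) * ((m : ℤ) + 1)) := by
  have h1 : ∑ i ∈ Finset.Iio m, 2 * (((i : ℕ) : ℤ) - (m : ℤ)) =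
      ∑ k ∈ Finset.range m, 2 * ((k : ℤ) - (m : ℤ)) := by
    rw [← Nat.Iio_eq_range, ← Fin.map_valEmbedding_Iio, Finset.sum_map]
    rfl
  have h2 : ∀ n : ℕ, ∑ k ∈ Finset.range n, 2 * ((k : ℤ) - (m : ℤ)) =
      (n : ℤ) * ((n : ℤ) - 1) - 2 * n * m := by
    intro n
    induction n with
    | zero => simp
    | succ n ih =>
      rw [Finset.sum_range_succ, ih]
      push_cast
      ring
  rw [h1, h2]
  ring

theorem modeNorm_eq {q : ℂ} (hq : q ≠ 0) (m : Fin N) :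
    modeNorm N q m = rho N q m * (q⁻¹ ^ (-((m : ℤ) * ((m : ℤ) + 1))) * modeDen N q⁻¹ m) := by
  have hQ : q⁻¹ ≠ 0 := inv_ne_zero hq
  have hs : Finset.univ.erase m = Finset.Iio m ∪ Finset.Ioi m := by
    ext i
    simp only [Finset.mem_erase, Finset.mem_univ, and_true, Finset.mem_union, Finset.mem_Iio,
      Finset.mem_Ioi]
    exact ne_iff_lt_or_gt
  have hd : Disjoint (Finset.Iio m) (Finset.Ioi m) := by
    rw [Finset.disjoint_left]
    intro i h1 h2
    exact lt_asymm (Finset.mem_Iio.1 h1) (Finset.mem_Ioi.1 h2)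
  rw [modeNorm, hs, Finset.prod_union hd, modeDen, ← mul_assoc (q⁻¹ ^ _), ← sum_Iio]
  congr 2
  · have h1 : ∀ s : Finset (Fin N), q⁻¹ ^ (∑ i ∈ s, 2 * ((i : ℤ) - (m : ℤ))) =
        ∏ i ∈ s, q⁻¹ ^ (2 * ((i : ℤ) - (m : ℤ))) := by
      classical
      intro s
      induction s using Finset.induction_on with
      | empty => simp
      | insert i s hi ih => rw [Finset.sum_insert hi, Finset.prod_insert hi, zpow_add₀ hQ, ih]
    rw [h1, ← Finset.prod_mul_distrib]
    refine Finset.prod_congr rfl fun i hi => ?_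
    have him : (i : ℕ) < m := Fin.lt_def.1 (Finset.mem_Iio.1 hi)
    rw [rho_div_rho hq, mul_sub (q⁻¹ ^ (2 * ((i : ℤ) - (m : ℤ)))), mul_one, ← zpow_natCast, ← zpow_add₀ hQ]
    push_cast [him.le]
    rw [← mul_add, sub_add_sub_cancel, sub_self, mul_zero, zpow_zero]
  · refine Finset.prod_congr rfl fun i hi => ?_
    have him : (m : ℕ) < i := Fin.lt_def.1 (Finset.mem_Ioi.1 hi)
    rw [rho_div_rho hq, ← zpow_natCast]
    push_cast [him.le]
    rfl

theorem logDer_empty (hN : 1 ≤ N) {Q : ℂ} (hQ : Q ∈ Adm N) :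
    logDer N ∅ (Q, ratio (evPoint N)) = 0 := by
  have : dTransport N ∅ (Q, ratio (evPoint N)) = 0 := by
    ext σ τ
    refine (hasDerivAt_transportV ∅ (good_adm hN hQ) σ τ).unique ?_
    simpa [transportV, transportS] using hasDerivAt_const (1 : ℂ) _
  rw [logDer, this, mul_zero]

/-- The powers of `q` from the inverse matrix, its normalization and `A_J` combine to `Q ^ ((r - m)
(r - m - 1))` with `r = J.card`. This exponent is a product of consecutive integers, hence
nonnegative, so the modes extend to `Q = 0`. -/
theorem mode_eq_modeQ (hN : 1 ≤ N) {q : ℂ} (hq : Generic N q) (m : Fin N) :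
    mode N q m = modeQ N q⁻¹ m := by
  have hQ := (generic_iff.1 hq).2
  have hQ0 : q⁻¹ ≠ 0 := inv_ne_zero hq.1
  set F : Finset (Fin N) → Op N := fun J => (modeWeight N q⁻¹ m J.card * crossB N q⁻¹ J) •
    logDer N J (q⁻¹, ratio (evPoint N)) with hF
  have h1 : modeQ N q⁻¹ m = ∑ s : Fin N,
      ∑ J ∈ (Finset.univ : Finset (Fin N)).powersetCard ((s : ℕ) + 1), F J := by
    rw [modeQ, ← Finset.powerset_univ, Finset.sum_powerset, Finset.card_fin,
      Finset.sum_range_succ', Finset.powersetCard_zero, Finset.sum_singleton,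
      logDer_empty hN hQ, smul_zero, add_zero,
      Fin.sum_univ_eq_sum_range (fun s =>
        ∑ J ∈ (Finset.univ : Finset (Fin N)).powersetCard (s + 1), F J)]
  rw [h1, mode]
  refine Finset.sum_congr rfl fun s _ => ?_
  rw [logSum, Finset.smul_sum]
  refine Finset.sum_congr rfl fun J hJ => ?_
  have hJc := (Finset.mem_powersetCard.1 hJ).2
  simp only [hF]
  rw [smul_smul, coeffA_eq_crossB hq.1, hJc, ← mul_assoc]
  congr 2
  have hpos : 0 ≤ (((s : ℕ) + 1 : ℕ) - (m : ℕ) : ℤ) * ((((s : ℕ) + 1 : ℕ) : ℤ) - (m : ℕ) - 1) := by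
    rcases le_or_gt (((s : ℕ) + 1 : ℕ) : ℤ) (m : ℕ) with h | h
    · exact mul_nonneg_of_nonpos_of_nonpos (by omega) (by omega)
    · exact mul_nonneg (by omega) (by omega)
  have hrho : rho N q m = q⁻¹ ^ (-((N : ℤ) - 1 - 2 * (m : ℕ))) := by
    rw [rho, inv_zpow, ← zpow_neg, neg_neg]
  have hq' : q = q⁻¹⁻¹ := (inv_inv q).symm
  rw [modeCoeff, modeNorm_eq hq.1, modeWeight, neg_pow, hrho, ← zpow_neg, neg_neg, ← zpow_natCast q⁻¹,
    Int.toNat_of_nonneg hpos]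
  nth_rewrite 5 [hq']
  rw [inv_zpow q⁻¹, ← zpow_neg q⁻¹, ← zpow_natCast (q⁻¹ ^ _) (s : ℕ), ← zpow_mul, ← mul_assoc,
    ← zpow_add₀ hQ0, ← div_div, div_mul_eq_mul_div, div_eq_mul_inv _ (q⁻¹ ^ _), ← zpow_neg,
    mul_assoc, mul_assoc, ← zpow_add₀ hQ0, ← zpow_add₀ hQ0, pow_add (-1 : ℂ) ((s : ℕ) + 1) 1,
    pow_succ (-1 : ℂ) (s : ℕ)]
  congr 1
  rw [pow_one, mul_assoc ((-1 : ℂ) ^ (s : ℕ)) (-1) (-1), neg_mul_neg, one_mul, mul_one]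
  congr 2
  push_cast
  ring

/-- The eigenvalues of the mode operators. -/
def chi (N : ℕ) (μ : Finset ℕ) (m : Fin N) : ℂ :=
  ∑ n ∈ μ, ((if (m : ℕ) < n then 1 else 0) - (n : ℂ) / N)

/-- The exponent `(r - m) (r - m - 1)` vanishes only for `r = m` and `r = m + 1`. -/
theorem modeWeight_zero (m : Fin N) (r : ℕ) : modeWeight N 0 m r =
    (if r = m + 1 then 1 else 0) - if r = m then 1 else 0 := by
  have h1 : modeDen N 0 m = (-1) ^ (m : ℕ) := by
    have e1 : ∏ i ∈ Finset.Iio m, ((0 : ℂ) ^ (2 * ((m : ℕ) - (i : ℕ))) - 1) = (-1) ^ (m : ℕ) := by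
      rw [Finset.prod_congr rfl (g := fun _ => (-1 : ℂ)), Finset.prod_const, Fin.card_Iio]
      intro i hi
      have : (i : ℕ) < m := Fin.lt_def.1 (Finset.mem_Iio.1 hi)
      rw [zero_pow (by omega), zero_sub]
    have e2 : ∏ i ∈ Finset.Ioi m, (1 - (0 : ℂ) ^ (2 * ((i : ℕ) - (m : ℕ)))) = 1 := by
      refine Finset.prod_eq_one fun i hi => ?_
      have : (m : ℕ) < i := Fin.lt_def.1 (Finset.mem_Ioi.1 hi)
      rw [zero_pow (by omega), sub_zero]
    rw [modeDen, e1, e2, mul_one]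
  have h2 : ((-1 : ℂ) ^ (m : ℕ)) ≠ 0 := pow_ne_zero _ (by norm_num)
  rw [modeWeight, h1]
  by_cases e1 : r = m + 1
  · subst e1
    simp only [if_true]
    rw [if_neg (by omega)]
    push_cast
    rw [show ((m : ℤ) + 1 - (m : ℤ)) * ((m : ℤ) + 1 - (m : ℤ) - 1) = 0 by ring, Int.toNat_zero,
      pow_zero, mul_one, pow_add, pow_add]
    field_simp
    norm_num
  · by_cases e2 : r = m
    · subst e2
      rw [if_neg e1, if_pos rfl, sub_self, zero_mul, Int.toNat_zero, pow_zero, mul_one, pow_succ]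
      field_simp
      norm_num
    · rw [if_neg e1, if_neg e2, sub_zero, zero_pow, mul_zero, zero_div]
      have : 0 < ((r : ℤ) - (m : ℕ)) * ((r : ℤ) - (m : ℕ) - 1) := by
        rcases lt_or_gt_of_ne e2 with h | h
        · exact mul_pos_of_neg_of_neg (by omega) (by omega)
        · exact mul_pos (by omega) (by omega)
      omega

theorem sum_wallShift (hN : 1 ≤ N) {r : ℕ} (hr : r ≤ N) (σ : Config N) :
    ∑ J ∈ (Finset.univ : Finset (Fin N)).powersetCard r, crossB N 0 J * wallShift J σ =
      ∑ n ∈ domainWalls N σ, (((min r n : ℕ) : ℂ) - n * (r / N)) := by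
  simp only [wallShift, Finset.mul_sum]
  rw [Finset.sum_comm]
  refine Finset.sum_congr rfl fun n hn => ?_
  have hnN : n < N := Finset.mem_range.1 (Finset.mem_filter.1 hn).1
  simp only [mul_sub, Finset.sum_sub_distrib]
  congr 1
  · rw [← one_mul ((min r n : ℕ) : ℂ), ← sum_crossB_zero hN hr, Finset.sum_mul]
    exact Finset.sum_congr rfl fun J hJ => by rw [(Finset.mem_powersetCard.1 hJ).2]
  · have h1 : ∀ J : Finset (Fin N), crossB N 0 J *
        ((J.filter fun i : Fin N => (i : ℕ) < n).card : ℂ) =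
        ∑ i ∈ Finset.univ.filter (fun i : Fin N => (i : ℕ) < n),
          if i ∈ J then crossB N 0 J else 0 := by
      intro J
      rw [← Finset.sum_filter, Finset.sum_const, nsmul_eq_mul, mul_comm]
      congr 3
      ext i
      simp [and_comm]
    rw [Finset.sum_congr rfl fun J _ => h1 J, Finset.sum_comm]
    simp only [← Finset.sum_filter]
    rw [Finset.sum_congr rfl fun j _ => marked_crossB_zero hN hr j, Finset.sum_const,
      nsmul_eq_mul, Fin.card_filter_val_lt, min_eq_right hnN.le]

/-- Only subsets of sizes `m` and `m + 1` survive. The difference of `min r n - n r / N` at these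
two sizes is `1` or `0`, according to whether `m < n`, minus `n / N`. -/
theorem modeQ_zero (hN : 1 ≤ N) (m : Fin N) :
    modeQ N 0 m = Matrix.diagonal fun σ => chi N (domainWalls N σ) m := by
  have h0 : ∀ J, logDer N J (0, ratio (evPoint N)) = Matrix.diagonal (wallShift J) := fun J =>
    logDer_crystal J evPoint_ne_zero
  ext σ τ
  simp only [modeQ, h0, Matrix.sum_apply, Matrix.smul_apply, Matrix.diagonal_apply, smul_eq_mul]
  by_cases hst : σ = τ
  swap
  · simp [hst]
  simp only [hst, if_true]
  have hm := m.2
  rw [← Finset.powerset_univ, Finset.sum_powerset, Finset.card_fin]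
  have h1 : ∀ r ∈ Finset.range (N + 1), ∑ J ∈ (Finset.univ : Finset (Fin N)).powersetCard r,
      modeWeight N 0 m J.card * crossB N 0 J * wallShift J τ =
      ((if r = m + 1 then 1 else 0) - if r = m then 1 else 0) *
        ∑ n ∈ domainWalls N τ, (((min r n : ℕ) : ℂ) - n * (r / N)) := by
    intro r hr
    rw [← sum_wallShift hN (by have := Finset.mem_range.1 hr; omega), Finset.mul_sum]
    refine Finset.sum_congr rfl fun J hJ => ?_
    rw [(Finset.mem_powersetCard.1 hJ).2, modeWeight_zero, mul_assoc]
  rw [Finset.sum_congr rfl h1]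
  simp only [sub_mul, Finset.sum_sub_distrib, ite_mul, one_mul, zero_mul, Finset.sum_ite_eq',
    Finset.mem_range]
  rw [if_pos (by omega), if_pos (by omega), chi, ← Finset.sum_sub_distrib, ← Finset.sum_sub_distrib,
    ← Finset.sum_sub_distrib]
  refine Finset.sum_congr rfl fun n _ => ?_
  by_cases hmn : (m : ℕ) < n
  · rw [if_pos hmn, min_eq_left (by omega), min_eq_left (by omega)]
    push_cast
    ring
  · rw [if_neg hmn, min_eq_right (by omega), min_eq_right (by omega)]
    push_cast
    ring

end modeQ

/-! ### Rigidity of the spectrum -/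

theorem eq_of_integral {α : Type*} [TopologicalSpace α] {S : Set α} (hS : IsPreconnected S)
    {f : α → ℂ} (hc : ContinuousOn f S) (hf : ∀ x ∈ S, ∃ n : ℤ, f x = n) {x y : α} (hx : x ∈ S)
    (hy : y ∈ S) : f x = f y := by
  have hd : DiscreteTopology (Set.range ((↑) : ℤ → ℂ)) := by
    refine DiscreteTopology.of_forall_le_dist one_pos ?_
    rintro ⟨_, a, rfl⟩ ⟨_, b, rfl⟩ hab
    have hab' : a - b ≠ 0 := fun e => hab (by rw [sub_eq_zero.1 e])
    rw [Subtype.dist_eq, Complex.dist_eq, ← Int.cast_sub, Complex.norm_intCast]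
    exact_mod_cast Int.one_le_abs hab'
  refine hS.constant_of_mapsTo (T := Set.range ((↑) : ℤ → ℂ)) ⟨hd⟩ hc (fun z hz => ?_) hx hy
  obtain ⟨n, hn⟩ := hf z hz
  exact ⟨n, hn.symm⟩

section adm
variable {N : ℕ}

theorem finite_compl_adm (N : ℕ) : (Adm N)ᶜ.Finite := by
  have : (Adm N)ᶜ ⊆ ⋃ k ∈ Finset.Icc 1 N, (Polynomial.nthRootsFinset (2 * k) (1 : ℂ) : Set ℂ) := by
    intro Q hQ
    simp only [Adm, Set.mem_compl_iff, Set.mem_ofPred_eq, not_forall, not_not] at hQ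
    obtain ⟨k, h1, h2, h3⟩ := hQ
    simp only [Set.mem_iUnion]
    refine ⟨k, Finset.mem_Icc.2 ⟨h1, h2⟩, ?_⟩
    rw [Finset.mem_coe, Polynomial.mem_nthRootsFinset (by omega)]
    exact h3
  exact Set.Finite.subset (Set.Finite.biUnion (Finset.finite_toSet _) fun k _ =>
    Finset.finite_toSet _) this

theorem isPreconnected_compl_finite {S : Set ℂ} (hS : S.Finite) : IsPreconnected Sᶜ :=
  (hS.countable.isConnected_compl_of_one_lt_rank
    (by rw [Complex.rank_real_complex]; norm_num)).isPreconnected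

theorem isPreconnected_adm (N : ℕ) : IsPreconnected (Adm N) := by
  have := isPreconnected_compl_finite (finite_compl_adm N)
  rwa [compl_compl] at this

theorem isPreconnected_generic (N : ℕ) : IsPreconnected {q : ℂ | Generic N q} := by
  have h : {q : ℂ | Generic N q} = ({0} ∪ (Adm N)ᶜ)ᶜ := by
    ext q
    rw [Set.mem_ofPred_eq, Set.compl_union, compl_compl, Set.mem_inter_iff, Set.mem_compl_singleton_iff]
    rfl
  rw [h]
  exact isPreconnected_compl_finite ((Set.finite_singleton 0).union (finite_compl_adm N))

theorem real_mem_adm {t : ℝ} (h0 : 0 ≤ t) (h1 : t < 1) : (t : ℂ) ∈ Adm N := by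
  intro k hk _ h
  have h2 : t ^ (2 * k) = 1 := by exact_mod_cast h
  exact (pow_lt_one₀ h0 h1 (by omega : 2 * k ≠ 0)).ne h2

/-- The admissible set is the plane minus finitely many points, hence connected, and the interval
`(0, 1)` accumulates at the admissible point `0`. Identities proved by Hermiticity thus extend to
complex `Q`. -/
theorem eqOn_adm {f g : ℂ → ℂ} (hf : ∀ Q ∈ Adm N, AnalyticAt ℂ f Q)
    (hg : ∀ Q ∈ Adm N, AnalyticAt ℂ g Q)
    (h : ∀ t : ℝ, 0 < t → t < 1 → f t = g t) {Q : ℂ} (hQ : Q ∈ Adm N) : f Q = g Q := by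
  refine AnalyticOnNhd.eqOn_of_preconnected_of_frequently_eq (𝕜 := ℂ) hf hg (isPreconnected_adm N)
    (zero_mem_adm N) ?_ hQ
  have h1 : Filter.Tendsto (fun t : ℝ => (t : ℂ)) (𝓝[>] 0) (𝓝[≠] 0) := by
    refine tendsto_nhdsWithin_iff.2 ⟨?_, ?_⟩
    · have := (Complex.continuous_ofReal.tendsto (0 : ℝ)).mono_left
        (nhdsWithin_le_nhds (s := Set.Ioi 0))
      rwa [Complex.ofReal_zero] at this
    · filter_upwards [self_mem_nhdsWithin] with t ht
      exact Complex.ofReal_ne_zero.2 (ne_of_gt ht)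
  refine h1.frequently (Filter.Eventually.frequently ?_)
  filter_upwards [Ioo_mem_nhdsGT (zero_lt_one' ℝ)] with t ht
  exact h t ht.1 ht.2

end adm

/-! ### Constancy of the joint moments -/

section words
variable {N : ℕ}

theorem AnOp.trace {E : Type*} [NormedAddCommGroup E] [NormedSpace ℂ E] {F : E → Op N} {x : E}
    (hF : AnOp F x) : AnalyticAt ℂ (fun y => (F y).trace) x :=
  Finset.analyticAt_fun_sum _ fun σ _ => hF σ σ

theorem AnOp.aeval {E : Type*} [NormedAddCommGroup E] [NormedSpace ℂ E] {F : E → Op N} {x : E}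
    (hF : AnOp F x) (p : Polynomial ℝ) : AnOp (fun y => Polynomial.aeval (F y) p) x := by
  simp only [Polynomial.aeval_eq_sum_range]
  refine AnOp.sum _ fun i _ σ τ => ?_
  exact (analyticAt_const (v := ((p.coeff i : ℝ) : ℂ))).mul ((hF.pow i) σ τ)

/-- The potential of the level operator. -/
def levelPot (N k : ℕ) : ℤ := if 0 < k ∧ k < N then 2 ^ k else 0

/-- A combination of the mode operators that separates the motifs. -/
def levelQ (N : ℕ) (Q : ℂ) : Op N :=
  ∑ m : Fin N, ((levelPot N ((m : ℕ) + 1) - levelPot N m : ℤ) : ℂ) • modeQ N Q m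

/-- The level of a motif. -/
def level (μ : Finset ℕ) : ℝ := ∑ k ∈ μ, 2 ^ k

theorem level_injective : Function.Injective level := by
  intro μ ν h
  apply Finset.geomSum_injective le_rfl
  simp only [level] at h
  exact_mod_cast h

theorem sum_levelPot {n : ℕ} (hn : n ≤ N) :
    ∑ m : Fin N, (if (m : ℕ) < n then levelPot N ((m : ℕ) + 1) - levelPot N m else 0) =
      levelPot N n := by
  rw [Fin.sum_univ_eq_sum_range (fun k => if k < n then levelPot N (k + 1) - levelPot N k else 0),
    ← Finset.sum_filter]
  have : (Finset.range N).filter (fun k => k < n) = Finset.range n := by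
    ext k; simp only [Finset.mem_filter, Finset.mem_range]; omega
  rw [this, Finset.sum_range_sub]
  simp [levelPot]

/-- The coefficients telescope to the potential at each wall. The potential vanishes at both ends,
which removes the terms `n / N`; its binary values elsewhere make the level determine the motif. -/
theorem sum_levelPot_chi {μ : Finset ℕ} (hμ : ∀ n ∈ μ, 1 ≤ n ∧ n < N) :
    ∑ m : Fin N, ((levelPot N ((m : ℕ) + 1) - levelPot N m : ℤ) : ℂ) * chi N μ m = level μ := by
  simp only [chi, Finset.mul_sum]
  rw [Finset.sum_comm, level, Complex.ofReal_sum]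
  refine Finset.sum_congr rfl fun n hn => ?_
  have h1 := sum_levelPot (N := N) (hμ n hn).2.le
  have h2 := sum_levelPot (N := N) le_rfl
  simp only [Fin.is_lt, if_true] at h2
  simp only [mul_sub, Finset.sum_sub_distrib, ← Finset.sum_mul]
  have h3 := congrArg (Int.cast (R := ℂ)) h1
  have h4 := congrArg (Int.cast (R := ℂ)) h2
  push_cast at h3 h4 ⊢
  simp only [mul_ite, mul_one, mul_zero]
  rw [h3, h4]
  simp [levelPot, show 0 < n from (hμ n hn).1, (hμ n hn).2]

theorem domainWalls_bounds (σ : Config N) : ∀ n ∈ domainWalls N σ, 1 ≤ n ∧ n < N := by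
  intro n hn
  obtain ⟨h1, i, j, h2, -, -⟩ := Finset.mem_filter.1 hn
  exact ⟨by omega, Finset.mem_range.1 h1⟩

theorem levelQ_zero (hN : 1 ≤ N) :
    levelQ N 0 = Matrix.diagonal fun σ => (level (domainWalls N σ) : ℂ) := by
  ext σ τ
  simp only [levelQ, modeQ_zero hN, Matrix.sum_apply, Matrix.smul_apply, Matrix.diagonal_apply,
    smul_eq_mul, mul_ite, mul_zero]
  by_cases h : σ = τ
  · simp only [h, if_true]
    exact sum_levelPot_chi (domainWalls_bounds τ)
  · simp [h]

theorem anOp_levelQ (hN : 1 ≤ N) {Q : ℂ} (hQ : Q ∈ Adm N) : AnOp (levelQ N) Q :=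
  AnOp.sum _ fun m _ => AnOp.smul analyticAt_const (anOp_modeQ hN hQ m)

theorem modeQ_real (hN : 1 ≤ N) {t : ℝ} (h0 : 0 < t) (h1 : t < 1) (m : Fin N) :
    modeQ N t m = mode N ((t⁻¹ : ℝ) : ℂ) m := by
  rw [mode_eq_modeQ hN (generic_of_one_lt ((one_lt_inv₀ h0).2 h1)), Complex.ofReal_inv, inv_inv]

theorem modeQ_comm (hN : 1 ≤ N) {Q : ℂ} (hQ : Q ∈ Adm N) (m m' : Fin N) :
    Commute (modeQ N Q m) (modeQ N Q m') := by
  ext σ τ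
  refine eqOn_adm (N := N) (f := fun Q => (modeQ N Q m * modeQ N Q m') σ τ)
    (g := fun Q => (modeQ N Q m' * modeQ N Q m) σ τ)
    (fun Q hQ => (anOp_modeQ hN hQ m).mul (anOp_modeQ hN hQ m') σ τ)
    (fun Q hQ => (anOp_modeQ hN hQ m').mul (anOp_modeQ hN hQ m) σ τ) (fun t h0 h1 => ?_) hQ
  rw [modeQ_real hN h0 h1, modeQ_real hN h0 h1,
    mode_comm_of_real hN ((one_lt_inv₀ h0).2 h1)]

theorem modeQ_comm_levelQ (hN : 1 ≤ N) {Q : ℂ} (hQ : Q ∈ Adm N) (m : Fin N) :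
    Commute (modeQ N Q m) (levelQ N Q) :=
  Commute.sum_right _ _ _ fun m' _ => (modeQ_comm hN hQ m m').smul_right _

theorem modeQ_isHermitian (hN : 1 ≤ N) {t : ℝ} (h0 : 0 < t) (h1 : t < 1) (m : Fin N) :
    (modeQ N t m).IsHermitian := by
  rw [modeQ_real hN h0 h1]
  exact mode_isHermitian hN ((one_lt_inv₀ h0).2 h1) m

theorem levelQ_isHermitian (hN : 1 ≤ N) {t : ℝ} (h0 : 0 < t) (h1 : t < 1) :
    (levelQ N t).IsHermitian :=
  IsHermitian.sum_smul _ (fun m _ => by simp) fun m _ => modeQ_isHermitian hN h0 h1 m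

theorem isHermitian_mul_of_commute {A B : Op N} (hA : A.IsHermitian) (hB : B.IsHermitian)
    (h : Commute A B) : (A * B).IsHermitian := by
  rw [Matrix.IsHermitian, Matrix.conjTranspose_mul, hA, hB, h.eq]

theorem isHermitian_aeval {A : Op N} (hA : A.IsHermitian) (p : Polynomial ℝ) :
    (Polynomial.aeval A p).IsHermitian := by
  rw [Matrix.IsHermitian, Polynomial.aeval_eq_sum_range, Matrix.conjTranspose_sum]
  refine Finset.sum_congr rfl fun i _ => ?_
  rw [Matrix.conjTranspose_smul, (hA.pow i), star_trivial]

theorem Lifts.pow {q : ℂ} {A : Op N} {μ : (Fin N →₀ ℕ) → ℂ} (hA : Lifts N q A μ) (n : ℕ) :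
    Lifts N q (A ^ n) (μ ^ n) := by
  induction n with
  | zero => exact Lifts.one
  | succ n ih => rw [pow_succ, pow_succ]; exact ih.mul hA

/-- A Hermitian matrix has as trace the sum of its eigenvalues, and each of these is a value of the
multiplier. -/
theorem trace_integral (hN : 1 ≤ N) {q : ℂ} (hq : Generic N q) {A : Op N} (hA : A.IsHermitian)
    {μ : (Fin N →₀ ℕ) → ℂ} (hL : Lifts N q A μ) {c : ℂ} (hc : ∀ d, ∃ n : ℤ, c * μ d = n) :
    ∃ n : ℤ, c * A.trace = n := by
  have h1 : ∀ σ, ∃ n : ℤ, c * (hA.eigenvalues σ : ℂ) = n := by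
    intro σ
    obtain ⟨d, hd⟩ := hL.eigenvalue hN hq (v := (hA.eigenvectorBasis σ).ofLp)
      (c := (hA.eigenvalues σ : ℂ))
      (fun e => hA.eigenvectorBasis.orthonormal.ne_zero σ ((WithLp.ofLp_eq_zero 2).1 e))
      (hA.mulVec_eigenvectorBasis σ)
    rw [← hd]
    exact hc d
  choose n hn using h1
  refine ⟨∑ σ, n σ, ?_⟩
  rw [hA.trace_eq_sum_eigenvalues, Finset.mul_sum, Int.cast_sum]
  exact Finset.sum_congr rfl fun σ _ => hn σ

theorem integral_mul {a b : ℂ} (ha : ∃ n : ℤ, a = n) (hb : ∃ n : ℤ, b = n) : ∃ n : ℤ, a * b = n := by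
  obtain ⟨m, rfl⟩ := ha
  obtain ⟨n, rfl⟩ := hb
  exact ⟨m * n, by push_cast; rfl⟩

theorem integral_pow {a : ℂ} (ha : ∃ n : ℤ, a = n) (k : ℕ) : ∃ n : ℤ, a ^ k = n := by
  obtain ⟨m, rfl⟩ := ha
  exact ⟨m ^ k, by push_cast; rfl⟩

theorem integral_sum {ι : Type*} (s : Finset ι) {f : ι → ℂ} (hf : ∀ i ∈ s, ∃ n : ℤ, f i = n) :
    ∃ n : ℤ, ∑ i ∈ s, f i = n := by
  choose! n hn using hf
  exact ⟨∑ i ∈ s, n i, by rw [Int.cast_sum]; exact Finset.sum_congr rfl hn⟩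

theorem integral_mode (hN : 1 ≤ N) (m : Fin N) (d : Fin N →₀ ℕ) :
    ∃ n : ℤ, (N : ℂ) * ((d m : ℂ) - (∑ j, (d j : ℂ)) / N) = n := by
  have hN0 : (N : ℂ) ≠ 0 := Nat.cast_ne_zero.2 (by omega)
  refine ⟨N * d m - ∑ j, (d j : ℤ), ?_⟩
  rw [mul_sub, mul_div_cancel₀ _ hN0]
  push_cast
  rfl

theorem integral_chi (hN : 1 ≤ N) (μ : Finset ℕ) (m : Fin N) : ∃ n : ℤ, (N : ℂ) * chi N μ m = n := by
  have hN0 : (N : ℂ) ≠ 0 := Nat.cast_ne_zero.2 (by omega)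
  rw [chi, Finset.mul_sum]
  refine integral_sum _ fun n _ => ⟨(if (m : ℕ) < n then N else 0) - n, ?_⟩
  rw [mul_sub, mul_div_cancel₀ _ hN0]
  push_cast
  split_ifs <;> simp

/-- The joint moments of the mode and level operators do not depend on `Q`. -/
theorem trace_word (hN : 1 ≤ N) {Q : ℂ} (hQ : Q ∈ Adm N) (m : Fin N) (a b : ℕ) :
    (modeQ N Q m ^ a * levelQ N Q ^ b).trace =
      ∑ σ : Config N, chi N (domainWalls N σ) m ^ a * (level (domainWalls N σ) : ℂ) ^ b := by
  have hN0 : (N : ℂ) ≠ 0 := Nat.cast_ne_zero.2 (by omega)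
  have han : ∀ Q ∈ Adm N, AnalyticAt ℂ (fun Q => (modeQ N Q m ^ a * levelQ N Q ^ b).trace) Q :=
    fun Q hQ => (((anOp_modeQ hN hQ m).pow a).mul ((anOp_levelQ hN hQ).pow b)).trace
  have h0 : (modeQ N 0 m ^ a * levelQ N 0 ^ b).trace =
      ∑ σ : Config N, chi N (domainWalls N σ) m ^ a * (level (domainWalls N σ) : ℂ) ^ b := by
    rw [modeQ_zero hN, levelQ_zero hN, Matrix.diagonal_pow, Matrix.diagonal_pow,
      Matrix.diagonal_mul_diagonal, Matrix.trace_diagonal]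
    rfl
  -- Including `t = 0` lets the integer be compared directly with the crystal value. The factor `N ^
  -- a` clears the denominators of the mode eigenvalues.
  have hint : ∀ t ∈ Set.Ico (0 : ℝ) 1, ∃ n : ℤ, (N : ℂ) ^ a *
      (modeQ N t m ^ a * levelQ N t ^ b).trace = n := by
    intro t ht
    rcases eq_or_lt_of_le ht.1 with e | e
    · rw [← e, Complex.ofReal_zero, h0, Finset.mul_sum]
      refine integral_sum _ fun σ _ => ?_
      rw [← mul_assoc, ← mul_pow]
      refine integral_mul (integral_pow (integral_chi hN _ m) a) (integral_pow ?_ b)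
      refine ⟨∑ k ∈ domainWalls N σ, 2 ^ k, ?_⟩
      rw [level]
      push_cast
      rfl
    · have hq := (one_lt_inv₀ e).2 ht.2
      have hgen := generic_of_one_lt (N := N) hq
      have hcomm := modeQ_comm_levelQ hN (real_mem_adm (N := N) ht.1 ht.2) m
      have hlev : levelQ N t = ∑ m : Fin N, ((levelPot N ((m : ℕ) + 1) - levelPot N m : ℤ) : ℂ) •
          mode N ((t⁻¹ : ℝ) : ℂ) m :=
        Finset.sum_congr rfl fun m _ => by rw [modeQ_real hN e ht.2]
      have hL := Lifts.sum Finset.univ fun (m : Fin N) _ => (lifts_mode hN hgen m).smul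
        ((levelPot N ((m : ℕ) + 1) - levelPot N m : ℤ) : ℂ)
      rw [← hlev] at hL
      have hM := lifts_mode hN hgen m
      rw [← modeQ_real hN e ht.2] at hM
      refine trace_integral hN hgen (isHermitian_mul_of_commute
        ((modeQ_isHermitian hN e ht.2 m).pow a) ((levelQ_isHermitian hN e ht.2).pow b)
        (hcomm.pow_pow a b)) ((hM.pow a).mul (hL.pow b)) fun d => ?_
      rw [Pi.mul_apply, Pi.pow_apply, Pi.pow_apply, ← mul_assoc, ← mul_pow]
      refine integral_mul (integral_pow (integral_mode hN m d) a) (integral_pow ?_ b)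
      rw [Finset.sum_apply]
      -- The coefficients of `levelQ` sum to zero, so the term `(∑ d) / N` drops out and the level
      -- operator needs no factor `N`.
      have h2 := sum_levelPot (N := N) le_rfl
      simp only [Fin.is_lt, if_true] at h2
      have h4 := congrArg (Int.cast (R := ℂ)) h2
      rw [Int.cast_sum] at h4
      refine ⟨∑ m : Fin N, (levelPot N ((m : ℕ) + 1) - levelPot N m) * (d m : ℤ), ?_⟩
      simp only [Pi.smul_apply, smul_eq_mul, mul_sub, Finset.sum_sub_distrib, ← Finset.sum_mul]
      simp only [h4]
      simp [levelPot]
  have hconst : ∀ t : ℝ, 0 < t → t < 1 → (modeQ N t m ^ a * levelQ N t ^ b).trace =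
      ∑ σ : Config N, chi N (domainWalls N σ) m ^ a * (level (domainWalls N σ) : ℂ) ^ b := by
    intro t h1 h2
    have hcont : ContinuousOn (fun t : ℝ => (N : ℂ) ^ a *
        (modeQ N t m ^ a * levelQ N t ^ b).trace) (Set.Ico 0 1) := by
      intro s hs
      refine ContinuousAt.continuousWithinAt (ContinuousAt.mul continuousAt_const ?_)
      exact ContinuousAt.comp (g := fun Q => (modeQ N Q m ^ a * levelQ N Q ^ b).trace)
        (f := fun s : ℝ => (s : ℂ)) (han s (real_mem_adm hs.1 hs.2)).continuousAt
        Complex.continuous_ofReal.continuousAt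
    have h3 := eq_of_integral isPreconnected_Ico hcont hint (x := t) (y := 0) ⟨h1.le, h2⟩
      ⟨le_rfl, one_pos⟩
    simp only [Complex.ofReal_zero] at h3
    rw [h0] at h3
    exact mul_left_cancel₀ (pow_ne_zero a hN0) h3
  exact eqOn_adm (N := N) han (fun _ _ => analyticAt_const) hconst hQ

theorem trace_mode_aeval (hN : 1 ≤ N) {Q : ℂ} (hQ : Q ∈ Adm N) (m : Fin N) (a : ℕ)
    (p : Polynomial ℝ) :
    (modeQ N Q m ^ a * Polynomial.aeval (levelQ N Q) p).trace = ∑ σ : Config N,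
      chi N (domainWalls N σ) m ^ a * ((p.eval (level (domainWalls N σ)) : ℝ) : ℂ) := by
  simp only [Polynomial.aeval_eq_sum_range, Finset.mul_sum, Matrix.trace_sum, mul_smul_comm,
    Matrix.trace_smul, trace_word hN hQ, Polynomial.eval_eq_sum_range, Complex.ofReal_sum,
    Finset.smul_sum]
  rw [Finset.sum_comm]
  refine Finset.sum_congr rfl fun σ _ => Finset.sum_congr rfl fun i _ => ?_
  rw [Complex.real_smul]
  push_cast
  ring

theorem trace_aeval (hN : 1 ≤ N) {Q : ℂ} (hQ : Q ∈ Adm N) (p : Polynomial ℝ) :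
    (Polynomial.aeval (levelQ N Q) p).trace =
      ∑ σ : Config N, ((p.eval (level (domainWalls N σ)) : ℝ) : ℂ) := by
  have := trace_mode_aeval hN hQ ⟨0, hN⟩ 0 p
  simpa using this

theorem eq_zero_of_trace_sq {A : Op N} (hA : A.IsHermitian) (h : (A * A).trace = 0) : A = 0 := by
  open ComplexOrder in
  refine Matrix.trace_conjTranspose_mul_self_eq_zero_iff.1 ?_
  rwa [hA]

/-- For `0 < Q < 1` the matrix is Hermitian and the trace of its square is a moment, which is zero.
Continuation then shows that the level operator is diagonalizable with the crystal spectrum even for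
complex `Q`. -/
theorem aeval_levelQ_eq_zero (hN : 1 ≤ N) {Q : ℂ} (hQ : Q ∈ Adm N) {p : Polynomial ℝ}
    (hp : ∀ σ, p.eval (level (domainWalls N σ)) = 0) : Polynomial.aeval (levelQ N Q) p = 0 := by
  ext σ τ
  refine eqOn_adm (N := N) (f := fun Q => Polynomial.aeval (levelQ N Q) p σ τ) (g := fun _ => 0)
    (fun Q hQ => (anOp_levelQ hN hQ).aeval p σ τ) (fun _ _ => analyticAt_const)
    (fun t h0 h1 => ?_) hQ
  have h2 := eq_zero_of_trace_sq (isHermitian_aeval (levelQ_isHermitian hN h0 h1) p) (by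
    rw [← map_mul, trace_aeval hN (real_mem_adm h0.le h1)]
    exact Finset.sum_eq_zero fun σ _ => by rw [Polynomial.eval_mul, hp, mul_zero, Complex.ofReal_zero])
  simp only [h2, Matrix.zero_apply]

theorem star_chi (μ : Finset ℕ) (m : Fin N) : star (chi N μ m) = chi N μ m := by
  rw [chi, star_sum]
  refine Finset.sum_congr rfl fun n _ => ?_
  split_ifs <;> simp

/-- For `0 < Q < 1` the difference of the two sides is Hermitian. The trace of its square is a
combination of joint moments, and each configuration contributes either a perfect square `(χ - χ)²`
or a vanishing value of `p`. -/
theorem modeQ_mul_aeval (hN : 1 ≤ N) {Q : ℂ} (hQ : Q ∈ Adm N) (m : Fin N) {μ : Finset ℕ}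
    {p : Polynomial ℝ} (hp : ∀ σ, domainWalls N σ ≠ μ → p.eval (level (domainWalls N σ)) = 0) :
    modeQ N Q m * Polynomial.aeval (levelQ N Q) p =
      chi N μ m • Polynomial.aeval (levelQ N Q) p := by
  set c := chi N μ m with hc
  ext σ τ
  refine eqOn_adm (N := N) (f := fun Q => (modeQ N Q m * Polynomial.aeval (levelQ N Q) p) σ τ)
    (g := fun Q => (c • Polynomial.aeval (levelQ N Q) p) σ τ)
    (fun Q hQ => ((anOp_modeQ hN hQ m).mul ((anOp_levelQ hN hQ).aeval p)) σ τ)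
    (fun Q hQ => (((anOp_levelQ hN hQ).aeval p).smul analyticAt_const) σ τ)
    (fun t h0 h1 => ?_) hQ
  have hadm := real_mem_adm (N := N) h0.le h1
  have hcomm : Commute (modeQ N t m) (Polynomial.aeval (levelQ N t) p) := by
    rw [Polynomial.aeval_eq_sum_range]
    exact Commute.sum_right _ _ _ fun i _ =>
      ((modeQ_comm_levelQ hN hadm m).pow_right i).smul_right _
  have hherm := isHermitian_aeval (levelQ_isHermitian hN h0 h1) p
  set A := modeQ N t m with hA
  set P := Polynomial.aeval (levelQ N t) p with hP
  have h2 : A * P - c • P = 0 := by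
    apply eq_zero_of_trace_sq
    · rw [Matrix.IsHermitian, Matrix.conjTranspose_sub, Matrix.conjTranspose_smul, star_chi,
        hherm, isHermitian_mul_of_commute (modeQ_isHermitian hN h0 h1 m) hherm hcomm]
    · have e1 : (A * P - c • P) * (A * P - c • P) =
          A ^ 2 * (P * P) - (2 * c) • (A ^ 1 * (P * P)) + c ^ 2 • (A ^ 0 * (P * P)) := by
        have e2 : A * P * (A * P) = A ^ 2 * (P * P) := by
          rw [pow_two, mul_assoc, ← mul_assoc P A P, ← hcomm.eq]
          simp only [mul_assoc]
        have e3 : P * (A * P) = A * (P * P) := by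
          rw [← mul_assoc, ← hcomm.eq, mul_assoc]
        rw [sub_mul, mul_sub, mul_sub, e2, smul_mul_assoc, smul_mul_assoc, mul_smul_comm, mul_smul_comm, e3,
          pow_one, pow_zero, one_mul, two_mul, add_smul, pow_two c, smul_smul, mul_assoc A P P]
        abel
      rw [e1, Matrix.trace_add, Matrix.trace_sub, Matrix.trace_smul, Matrix.trace_smul, hP,
        ← map_mul, trace_mode_aeval hN hadm, trace_mode_aeval hN hadm, trace_mode_aeval hN hadm,
        smul_eq_mul, smul_eq_mul, Finset.mul_sum, Finset.mul_sum, ← Finset.sum_sub_distrib,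
        ← Finset.sum_add_distrib]
      refine Finset.sum_eq_zero fun σ _ => ?_
      by_cases hσ : domainWalls N σ = μ
      · rw [hσ, ← hc]
        ring
      · rw [Polynomial.eval_mul, hp σ hσ]
        simp
  exact congrFun (congrFun (sub_eq_zero.1 h2) σ) τ

end words

/-! ### The spectral projections -/

section projections
variable {N : ℕ}

instance (N : ℕ) : Finite (Motif N) := by
  refine Finite.of_injective (β := (Finset.range N).powerset)
    (fun μ => ⟨μ.1, Finset.mem_powerset.2 fun n hn => Finset.mem_range.2 (μ.2.1 n hn).2⟩) ?_
  intro μ ν h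
  exact Subtype.ext (Subtype.mk.inj h)

instance (N : ℕ) : Fintype (Motif N) := Fintype.ofFinite _

/-- The motif of a configuration. -/
def wallMotif (σ : Config N) : Motif N :=
  ⟨domainWalls N σ, domainWalls_bounds σ, fun n hn hn' => by
    obtain ⟨-, -, j, -, h2, -, h3⟩ := Finset.mem_filter.1 hn
    obtain ⟨-, i, -, h4, -, h5, -⟩ := Finset.mem_filter.1 hn'
    have : i = j := Fin.ext (by omega)
    rw [this, h3] at h5
    exact absurd h5 (by decide)⟩

theorem wallMotif_surjective : Function.Surjective (wallMotif (N := N)) := by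
  intro μ
  -- Spins are down exactly at the sites to the left of the walls. Since motifs have no consecutive
  -- elements, the next spin is up.
  refine ⟨fun i => if (i : ℕ) + 1 ∈ μ.1 then 1 else 0, Subtype.ext ?_⟩
  ext n
  simp only [wallMotif, domainWalls, Finset.mem_filter, Finset.mem_range]
  constructor
  · rintro ⟨-, i, j, rfl, -, h, -⟩
    by_contra hn
    simp [hn] at h
  · intro hn
    obtain ⟨h1, h2⟩ := μ.2.1 n hn
    have e : n - 1 + 1 = n := by omega
    exact ⟨h2, ⟨n - 1, by omega⟩, ⟨n, h2⟩, e, rfl, by simp [e, hn], by simp [μ.2.2 n hn]⟩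

/-- The polynomial that is `1` at the level of `μ` and `0` at the levels of the other motifs. -/
def motifPoly (N : ℕ) (μ : Motif N) : Polynomial ℝ :=
  Lagrange.basis Finset.univ (fun ν : Motif N => level ν.1) μ

theorem eval_motifPoly (μ ν : Motif N) :
    (motifPoly N μ).eval (level ν.1) = if ν = μ then 1 else 0 := by
  split_ifs with h
  · subst h
    refine Lagrange.eval_basis_self (s := Finset.univ) (v := fun ν : Motif N => level ν.1)
      (fun a _ b _ hab => ?_) (Finset.mem_univ ν)
    exact Subtype.ext (level_injective hab)
  · exact Lagrange.eval_basis_of_ne (s := Finset.univ) (v := fun ν : Motif N => level ν.1)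
      (Ne.symm h) (Finset.mem_univ ν)

theorem eval_motifPoly_walls (μ : Motif N) (σ : Config N) :
    (motifPoly N μ).eval (level (domainWalls N σ)) = if wallMotif σ = μ then 1 else 0 :=
  eval_motifPoly μ (wallMotif σ)

/-- The projection onto the joint eigenspace labelled by `μ`, as a function of `Q = q⁻¹`. -/
def motifProj (N : ℕ) (Q : ℂ) (μ : Motif N) : Op N :=
  Polynomial.aeval (levelQ N Q) (motifPoly N μ)

theorem motifProj_mul (hN : 1 ≤ N) {Q : ℂ} (hQ : Q ∈ Adm N) (μ ν : Motif N) :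
    motifProj N Q μ * motifProj N Q ν = if μ = ν then motifProj N Q μ else 0 := by
  have h := aeval_levelQ_eq_zero hN hQ
    (p := motifPoly N μ * motifPoly N ν - if μ = ν then motifPoly N μ else 0) fun σ => by
      rw [Polynomial.eval_sub, Polynomial.eval_mul, eval_motifPoly_walls, eval_motifPoly_walls]
      split_ifs with h1 h2 h3 h3 <;> simp_all [eval_motifPoly_walls]
  rw [map_sub, map_mul, sub_eq_zero] at h
  rw [motifProj, motifProj, h]
  split_ifs <;> simp

theorem sum_motifProj (hN : 1 ≤ N) {Q : ℂ} (hQ : Q ∈ Adm N) :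
    ∑ μ, motifProj N Q μ = 1 := by
  have h := aeval_levelQ_eq_zero hN hQ (p := ∑ μ, motifPoly N μ - 1) fun σ => by
    simp [Polynomial.eval_finsetSum, eval_motifPoly_walls]
  rw [map_sub, map_sum, map_one, sub_eq_zero] at h
  exact h

theorem motifProj_ne_zero (hN : 1 ≤ N) {Q : ℂ} (hQ : Q ∈ Adm N) (μ : Motif N) :
    motifProj N Q μ ≠ 0 := by
  intro h
  have h1 := trace_aeval hN hQ (motifPoly N μ)
  rw [show Polynomial.aeval (levelQ N Q) (motifPoly N μ) = 0 from h, Matrix.trace_zero,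
    ← Complex.ofReal_sum, eq_comm, Complex.ofReal_eq_zero,
    Finset.sum_eq_zero_iff_of_nonneg fun σ _ => by
      rw [eval_motifPoly_walls]; split_ifs <;> norm_num] at h1
  obtain ⟨σ, hσ⟩ := wallMotif_surjective μ
  have h2 := h1 σ (Finset.mem_univ _)
  rw [eval_motifPoly_walls, if_pos hσ] at h2
  exact one_ne_zero h2

/-- At `Q = 0` the level operator is diagonal, so the polynomial acts entrywise. -/
theorem motifProj_zero (hN : 1 ≤ N) (μ : Motif N) : motifProj N 0 μ = crystalProj N μ := by
  rw [motifProj, levelQ_zero hN, crystalProj,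
    show (Matrix.diagonal fun σ : Config N => (level (domainWalls N σ) : ℂ)) =
      Matrix.diagonalAlgHom ℝ (fun σ : Config N => (level (domainWalls N σ) : ℂ)) from rfl,
    Polynomial.aeval_algHom_apply]
  refine congrArg Matrix.diagonal (funext fun σ => ?_)
  have h0 := (Polynomial.aeval_algHom_apply (Pi.evalAlgHom ℝ (fun _ : Config N => ℂ) σ)
    (fun σ : Config N => (level (domainWalls N σ) : ℂ)) (motifPoly N μ)).symm
  refine h0.trans ?_
  have h := Polynomial.aeval_algebraMap_apply_eq_algebraMap_eval (A := ℂ)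
    (level (domainWalls N σ)) (motifPoly N μ)
  refine h.trans ?_
  rw [eval_motifPoly_walls]
  have e : wallMotif σ = μ ↔ domainWalls N σ = μ.1 := Subtype.ext_iff
  by_cases h1 : domainWalls N σ = μ.1
  · rw [if_pos (e.2 h1), if_pos h1, map_one]
  · rw [if_neg (mt e.1 h1), if_neg h1, map_zero]

theorem continuousAt_motifProj (hN : 1 ≤ N) {Q : ℂ} (hQ : Q ∈ Adm N) (μ : Motif N) :
    ContinuousAt (fun Q => motifProj N Q μ) Q :=
  continuousAt_pi.2 fun σ => continuousAt_pi.2 fun τ =>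
    ((anOp_levelQ hN hQ).aeval (motifPoly N μ) σ τ).continuousAt

theorem mode_mul_motifProj (hN : 1 ≤ N) {q : ℂ} (hq : Generic N q) (m : Fin N) (μ : Motif N) :
    mode N q m * motifProj N q⁻¹ μ = chi N μ.1 m • motifProj N q⁻¹ μ := by
  rw [mode_eq_modeQ hN hq]
  refine modeQ_mul_aeval hN (generic_iff.1 hq).2 m fun σ hσ => ?_
  rw [eval_motifPoly_walls, if_neg fun h => hσ (congrArg Subtype.val h)]

theorem commute_mode_motifProj (hN : 1 ≤ N) {q : ℂ} (hq : Generic N q) (m : Fin N)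
    (μ : Motif N) : Commute (mode N q m) (motifProj N q⁻¹ μ) := by
  rw [mode_eq_modeQ hN hq, motifProj, Polynomial.aeval_eq_sum_range]
  exact Commute.sum_right _ _ _ fun i _ =>
    ((modeQ_comm_levelQ hN (generic_iff.1 hq).2 m).pow_right i).smul_right _

/-! ### The action of the Hamiltonians -/

/-- The additive energy of a motif. -/
def energy (N : ℕ) (q : ℂ) (r : ℕ) (μ : Motif N) : ℂ := ∑ n ∈ μ.1, dispersion N q r n

theorem energy_eq (hN : 1 ≤ N) {q : ℂ} (hq : Generic N q) {r : ℕ} (hr : r ≤ N) (μ : Motif N) :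
    energy N q r μ = (q - q⁻¹)⁻¹ * ∑ j : Fin N, rhoDer N q r j * chi N μ.1 j := by
  rw [eq_inv_mul_iff_mul_eq₀ (hq.sub_inv_ne_zero hN), energy, Finset.mul_sum]
  simp only [chi, Finset.mul_sum]
  rw [Finset.sum_comm]
  exact Finset.sum_congr rfl fun n hn => dispersion_eq hN hq hr (μ.2.1 n hn).2.le

theorem ham_eq_sum_mode (hN : 1 ≤ N) {q : ℂ} (hq : Generic N q) {r : ℕ} (h1 : 1 ≤ r)
    (hr : r ≤ N) : ham N q r = (q - q⁻¹)⁻¹ • ∑ j : Fin N, rhoDer N q r j • mode N q j := by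
  obtain ⟨s, rfl⟩ := Nat.exists_eq_add_of_le' h1
  rw [ham_eq hN hq, logSum_eq_sum_mode hq ⟨s, hr⟩]

theorem ham_mul_motifProj (hN : 1 ≤ N) {q : ℂ} (hq : Generic N q) {r : ℕ} (h1 : 1 ≤ r)
    (hr : r ≤ N) (μ : Motif N) :
    ham N q r * motifProj N q⁻¹ μ = energy N q r μ • motifProj N q⁻¹ μ := by
  rw [ham_eq_sum_mode hN hq h1 hr, energy_eq hN hq hr, smul_mul_assoc, Finset.sum_mul, mul_smul,
    Finset.sum_smul]
  congr 1
  refine Finset.sum_congr rfl fun j _ => ?_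
  rw [smul_mul_assoc, mode_mul_motifProj hN hq, smul_smul]

theorem commute_ham_motifProj (hN : 1 ≤ N) {q : ℂ} (hq : Generic N q) {r : ℕ} (h1 : 1 ≤ r)
    (hr : r ≤ N) (μ : Motif N) : Commute (ham N q r) (motifProj N q⁻¹ μ) := by
  rw [ham_eq_sum_mode hN hq h1 hr]
  exact (Commute.sum_left _ _ _ fun j _ =>
    (commute_mode_motifProj hN hq j μ).smul_left _).smul_left _

theorem mode_eq_sum_ham (hN : 1 ≤ N) {q : ℂ} (hq : Generic N q) (m : Fin N) :
    mode N q m = ∑ s : Fin N, (modeCoeff N q m s * (q - q⁻¹)) • ham N q ((s : ℕ) + 1) := by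
  refine Finset.sum_congr rfl fun s _ => ?_
  rw [ham_eq hN hq, smul_smul, mul_inv_cancel_right₀ (hq.sub_inv_ne_zero hN)]

/-- Both sides are the eigenvalue of the same operator on the nonzero range of `motifProj`. -/
theorem chi_eq_sum_energy (hN : 1 ≤ N) {q : ℂ} (hq : Generic N q) (m : Fin N) (μ : Motif N) :
    chi N μ.1 m =
      ∑ s : Fin N, modeCoeff N q m s * (q - q⁻¹) * energy N q ((s : ℕ) + 1) μ := by
  have h := mode_mul_motifProj hN hq m μ
  rw [mode_eq_sum_ham hN hq, Finset.sum_mul] at h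
  simp only [smul_mul_assoc] at h
  rw [Finset.sum_congr rfl fun (s : Fin N) _ => by
    rw [ham_mul_motifProj hN hq (Nat.le_add_left 1 s) s.2, smul_smul], ← Finset.sum_smul] at h
  exact (smul_left_injective ℂ (motifProj_ne_zero hN (generic_iff.1 hq).2 μ) h).symm

theorem aeval_mulVec {A : Op N} {v : State N} {c : ℝ} (h : A.mulVec v = (c : ℂ) • v)
    (p : Polynomial ℝ) : (Polynomial.aeval A p).mulVec v = ((p.eval c : ℝ) : ℂ) • v := by
  have hpow : ∀ n : ℕ, (A ^ n).mulVec v = (c : ℂ) ^ n • v := by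
    intro n
    induction n with
    | zero => simp
    | succ n ih => rw [pow_succ, ← Matrix.mulVec_mulVec, h, Matrix.mulVec_smul, ih, smul_smul,
        pow_succ, mul_comm]
  rw [Polynomial.aeval_eq_sum_range, Matrix.sum_mulVec, Polynomial.eval_eq_sum_range,
    Complex.ofReal_sum, Finset.sum_smul]
  refine Finset.sum_congr rfl fun i _ => ?_
  rw [Matrix.smul_mulVec, hpow, Complex.ofReal_mul, Complex.ofReal_pow, mul_smul]
  rfl

/-- For the converse direction the modes are combinations of the Hamiltonians, so the energies
determine the mode eigenvalues and hence the level, on which the Lagrange polynomial is `1`. The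
range of the projection is therefore the full joint eigenspace. -/
theorem motifProj_mulVec_eq_self_iff (hN : 1 ≤ N) {q : ℂ} (hq : Generic N q) (μ : Motif N)
    (v : State N) : (motifProj N q⁻¹ μ).mulVec v = v ↔
      ∀ r : ℕ, 1 ≤ r → r ≤ N → (ham N q r).mulVec v = energy N q r μ • v := by
  constructor
  · intro h r h1 hr
    rw [← h, Matrix.mulVec_mulVec, ham_mul_motifProj hN hq h1 hr, Matrix.smul_mulVec]
  · intro h
    have h1 : ∀ m, (mode N q m).mulVec v = chi N μ.1 m • v := by
      intro m
      rw [mode_eq_sum_ham hN hq, chi_eq_sum_energy hN hq, Matrix.sum_mulVec, Finset.sum_smul]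
      refine Finset.sum_congr rfl fun s _ => ?_
      rw [Matrix.smul_mulVec, h _ (Nat.le_add_left 1 s) s.2, smul_smul]
    have h2 : (levelQ N q⁻¹).mulVec v = (level μ.1 : ℂ) • v := by
      rw [levelQ, Matrix.sum_mulVec, ← sum_levelPot_chi μ.2.1, Finset.sum_smul]
      refine Finset.sum_congr rfl fun m _ => ?_
      rw [Matrix.smul_mulVec, ← mode_eq_modeQ hN hq, h1, smul_smul]
    rw [motifProj, aeval_mulVec h2, eval_motifPoly, if_pos rfl, Complex.ofReal_one, one_smul]

/-- The joint eigenspace labelled by `μ`. -/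
def motifSpace (N : ℕ) (q : ℂ) (μ : Motif N) : Submodule ℂ (State N) :=
  LinearMap.eqLocus (motifProj N q⁻¹ μ).mulVecLin LinearMap.id

theorem mem_motifSpace {q : ℂ} {μ : Motif N} {v : State N} :
    v ∈ motifSpace N q μ ↔ (motifProj N q⁻¹ μ).mulVec v = v := Iff.rfl

theorem motifProj_mulVec_mem (hN : 1 ≤ N) {q : ℂ} (hq : Generic N q) (μ : Motif N)
    (v : State N) : (motifProj N q⁻¹ μ).mulVec v ∈ motifSpace N q μ := by
  rw [mem_motifSpace, Matrix.mulVec_mulVec, motifProj_mul hN (generic_iff.1 hq).2, if_pos rfl]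

theorem motifProj_mulVec_of_mem (hN : 1 ≤ N) {q : ℂ} (hq : Generic N q) {μ ν : Motif N}
    {v : State N} (hv : v ∈ motifSpace N q ν) :
    (motifProj N q⁻¹ μ).mulVec v = if ν = μ then v else 0 := by
  rw [← mem_motifSpace.1 hv, Matrix.mulVec_mulVec, motifProj_mul hN (generic_iff.1 hq).2]
  by_cases h : μ = ν
  · rw [if_pos h, if_pos h.symm, h]
  · rw [if_neg h, if_neg (Ne.symm h), Matrix.zero_mulVec]

theorem mulVec_coeAddMonoidHom {W : Motif N → Submodule ℂ (State N)} {P : Op N} {μ : Motif N}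
    (hP : ∀ ν, ∀ v ∈ W ν, P.mulVec v = if ν = μ then v else 0)
    (x : DirectSum (Motif N) fun ν => W ν) :
    P.mulVec (DirectSum.coeAddMonoidHom W x) = x μ := by
  induction x using DirectSum.induction_on with
  | zero => simp
  | of ν v =>
    rw [DirectSum.coeAddMonoidHom_of, hP ν v v.2]
    split_ifs with h
    · subst h
      rw [DirectSum.of_eq_same]
    · rw [DirectSum.of_eq_of_ne _ _ _ (Ne.symm h)]
      rfl
  | add x y hx hy =>
    rw [map_add, Matrix.mulVec_add, hx, hy]
    rfl

theorem isInternal_motifSpace (hN : 1 ≤ N) {q : ℂ} (hq : Generic N q) :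
    DirectSum.IsInternal (motifSpace N q) := by
  constructor
  · refine (injective_iff_map_eq_zero _).2 fun x hx => DFinsupp.ext fun μ => Subtype.ext ?_
    rw [← mulVec_coeAddMonoidHom (P := motifProj N q⁻¹ μ)
      (fun ν v hv => motifProj_mulVec_of_mem hN hq hv) x, hx, Matrix.mulVec_zero]
    rfl
  · intro v
    refine ⟨∑ μ, DirectSum.of (fun μ => motifSpace N q μ) μ
      ⟨(motifProj N q⁻¹ μ).mulVec v, motifProj_mulVec_mem hN hq μ v⟩, ?_⟩
    rw [map_sum]
    simp only [DirectSum.coeAddMonoidHom_of]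
    rw [← Matrix.sum_mulVec, sum_motifProj hN (generic_iff.1 hq).2, Matrix.one_mulVec]

theorem isJointEigenspace_motifSpace (hN : 1 ≤ N) {q : ℂ} (hq : Generic N q) (μ : Motif N) :
    IsJointEigenspace N q (motifSpace N q μ) := by
  refine ⟨fun h => motifProj_ne_zero hN (generic_iff.1 hq).2 μ ?_, fun r => energy N q r μ,
    motifProj_mulVec_eq_self_iff hN hq μ⟩
  refine Matrix.ext_of_mulVec_single fun σ => ?_
  rw [Matrix.zero_mulVec]
  exact (Submodule.eq_bot_iff _).1 h _ (motifProj_mulVec_mem hN hq μ _)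

theorem tendsto_motifProj (hN : 1 ≤ N) (μ : Motif N) :
    Filter.Tendsto (fun q => motifProj N q⁻¹ μ) (Bornology.cobounded ℂ)
      (𝓝 (crystalProj N μ)) := by
  rw [← motifProj_zero hN]
  exact (continuousAt_motifProj hN (zero_mem_adm N) μ).tendsto.comp
    Filter.tendsto_inv₀_cobounded

theorem continuousOn_motifProj (hN : 1 ≤ N) (μ : Motif N) :
    ContinuousOn (fun q => motifProj N q⁻¹ μ) {q | Generic N q} := fun _ hq =>
  (ContinuousAt.comp (f := fun q : ℂ => q⁻¹) (g := fun Q => motifProj N Q μ)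
    (continuousAt_motifProj hN (generic_iff.1 hq).2 μ)
    (continuousAt_inv₀ hq.1)).continuousWithinAt

theorem isMotifDecomposition_motifSpace (hN : 1 ≤ N) :
    IsMotifDecomposition N (motifSpace N) where
  internal _ hq := isInternal_motifSpace hN hq
  jointEigenspace _ hq μ := isJointEigenspace_motifSpace hN hq μ
  continuity := ⟨fun q μ => motifProj N q⁻¹ μ,
    fun _ hq _ _ _ hv => motifProj_mulVec_of_mem hN hq hv,
    continuousOn_motifProj hN, tendsto_motifProj hN⟩

/-! ### Uniqueness of the labelling -/

theorem trace_integral_of_idempotent {A : Op N} (hA : A * A = A) : ∃ n : ℤ, A.trace = n := by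
  have h1 : IsIdempotentElem (Matrix.toLin' A) := by
    rw [IsIdempotentElem, Module.End.mul_eq_comp, ← Matrix.toLin'_mul, hA]
  have h2 := ((LinearMap.isProj_range_iff_isIdempotentElem _).2 h1).trace
  rw [Matrix.trace_toLin'_eq] at h2
  exact ⟨Module.finrank ℂ (LinearMap.range (Matrix.toLin' A)), by rw [h2]; push_cast; rfl⟩

theorem generic_eventually (N : ℕ) : ∀ᶠ q in Bornology.cobounded ℂ, Generic N q := by
  have h := Filter.tendsto_inv₀_cobounded.eventually
    ((isOpen_adm N).mem_nhds (zero_mem_adm N))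
  filter_upwards [h, Bornology.eventually_ne_cobounded 0] with q h1 h2
  exact generic_iff.2 ⟨h2, h1⟩

theorem trace_mul_eq_sum (A B : Op N) : (A * B).trace = ∑ σ, ∑ τ, A σ τ * B τ σ := by
  simp only [Matrix.trace, Matrix.diag_apply, Matrix.mul_apply]

theorem tendsto_trace_mul {F G : ℂ → Op N} {l : Filter ℂ} {A B : Op N}
    (hF : Filter.Tendsto F l (𝓝 A)) (hG : Filter.Tendsto G l (𝓝 B)) :
    Filter.Tendsto (fun q => (F q * G q).trace) l (𝓝 (A * B).trace) := by
  simp only [trace_mul_eq_sum]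
  exact tendsto_finsetSum _ fun σ _ => tendsto_finsetSum _ fun τ _ =>
    (tendsto_pi_nhds.1 (tendsto_pi_nhds.1 hF σ) τ).mul
      (tendsto_pi_nhds.1 (tendsto_pi_nhds.1 hG τ) σ)

theorem continuousOn_trace_mul {F G : ℂ → Op N} {S : Set ℂ} (hF : ContinuousOn F S)
    (hG : ContinuousOn G S) : ContinuousOn (fun q => (F q * G q).trace) S := fun q hq =>
  tendsto_trace_mul (hF q hq) (hG q hq)

/-- An integer-valued continuous function on the connected set of generic `q` is constant, and this
set contains a neighbourhood of infinity. -/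
theorem eq_limit_of_integral {f : ℂ → ℂ} (hc : ContinuousOn f {q | Generic N q})
    (hf : ∀ q, Generic N q → ∃ n : ℤ, f q = n) {a : ℂ}
    (hlim : Filter.Tendsto f (Bornology.cobounded ℂ) (𝓝 a)) {q : ℂ} (hq : Generic N q) :
    f q = a := by
  refine tendsto_nhds_unique (tendsto_const_nhds.congr' ?_) hlim
  filter_upwards [generic_eventually N] with q' hq'
  exact eq_of_integral (isPreconnected_generic N) hc hf hq hq'

theorem crystalProj_mul_self_trace (μ : Motif N) :
    (crystalProj N μ * crystalProj N μ).trace ≠ 0 := by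
  rw [crystalProj, Matrix.diagonal_mul_diagonal, Matrix.trace_diagonal]
  simp only [mul_ite, mul_one, mul_zero]
  obtain ⟨σ, hσ⟩ := wallMotif_surjective μ
  rw [Finset.sum_congr rfl fun σ _ => ite_eq_left_iff.2 fun h => by rw [if_neg h],
    Finset.sum_boole, Nat.cast_ne_zero, Finset.card_ne_zero]
  exact ⟨σ, Finset.mem_filter.2 ⟨Finset.mem_univ _, congrArg Subtype.val hσ⟩⟩

/-- Every joint eigenspace is one of the spaces `motifSpace N q ν`. -/
theorem exists_eq_motifSpace (hN : 1 ≤ N) {q : ℂ} (hq : Generic N q)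
    {V : Submodule ℂ (State N)} (hV : IsJointEigenspace N q V) : ∃ ν, V = motifSpace N q ν := by
  obtain ⟨hne, χ, hχ⟩ := hV
  obtain ⟨v, hv, hv0⟩ := (Submodule.ne_bot_iff _).1 hne
  obtain ⟨ν, hν⟩ : ∃ ν, (motifProj N q⁻¹ ν).mulVec v ≠ 0 := by
    by_contra! h
    apply hv0
    rw [← Matrix.one_mulVec v, ← sum_motifProj hN (generic_iff.1 hq).2, Matrix.sum_mulVec]
    exact Finset.sum_eq_zero fun ν _ => h ν
  -- The projection commutes with the Hamiltonians and does not kill `v`, so the eigenvalues of `v`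
  -- can be read off on the range of the projection.
  have hχν : ∀ r, 1 ≤ r → r ≤ N → χ r = energy N q r ν := by
    intro r h1 hr
    have h2 := congrArg (motifProj N q⁻¹ ν).mulVec ((hχ v).1 hv r h1 hr)
    rw [Matrix.mulVec_mulVec, ← (commute_ham_motifProj hN hq h1 hr ν).eq,
      ham_mul_motifProj hN hq h1 hr, Matrix.smul_mulVec, Matrix.mulVec_smul] at h2
    exact (smul_left_injective ℂ hν h2).symm
  refine ⟨ν, Submodule.ext fun w => ?_⟩
  rw [hχ, mem_motifSpace, motifProj_mulVec_eq_self_iff hN hq]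
  exact forall_congr' fun r => forall_congr' fun h1 => forall_congr' fun hr => by
    rw [hχν r h1 hr]

theorem mulVec_mem_of_isInternal {W : Motif N → Submodule ℂ (State N)}
    (hW : DirectSum.IsInternal W) {P : Op N} {μ : Motif N}
    (hP : ∀ ν, ∀ v ∈ W ν, P.mulVec v = if ν = μ then v else 0) (v : State N) :
    P.mulVec v ∈ W μ := by
  obtain ⟨x, rfl⟩ := hW.2 v
  rw [mulVec_coeAddMonoidHom hP]
  exact (x μ).2

theorem exists_motifProj_mul (hN : 1 ≤ N) {q : ℂ} (hq : Generic N q)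
    {V : Submodule ℂ (State N)} (hV : IsJointEigenspace N q V) {P : Op N}
    (hP : ∀ v, P.mulVec v ∈ V) (μ : Motif N) : ∃ ν, V = motifSpace N q ν ∧
      motifProj N q⁻¹ μ * P = if ν = μ then P else 0 := by
  obtain ⟨ν, rfl⟩ := exists_eq_motifSpace hN hq hV
  refine ⟨ν, rfl, Matrix.ext_of_mulVec_single fun σ => ?_⟩
  rw [← Matrix.mulVec_mulVec, motifProj_mulVec_of_mem hN hq (hP _)]
  split_ifs
  · rfl
  · rw [Matrix.zero_mulVec]

/-- At each `q` the product of the two projections labelled `μ` is either zero or an idempotent, so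
its trace is an integer. By continuity it equals its nonzero crystal value, which rules out a
different label. -/
theorem IsMotifDecomposition.eq_motifSpace {W : ℂ → Motif N → Submodule ℂ (State N)}
    (hN : 1 ≤ N) (hW : IsMotifDecomposition N W) {q : ℂ} (hq : Generic N q) (μ : Motif N) :
    W q μ = motifSpace N q μ := by
  obtain ⟨P, hP, hcont, hlim⟩ := hW.continuity
  have hmem : ∀ q, Generic N q → ∀ v, (P q μ).mulVec v ∈ W q μ := fun q hq =>
    mulVec_mem_of_isInternal (hW.internal q hq) (hP q hq μ)
  have hcases : ∀ q, Generic N q → ∃ ν, W q μ = motifSpace N q ν ∧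
      motifProj N q⁻¹ μ * P q μ = if ν = μ then P q μ else 0 := fun q hq =>
    exists_motifProj_mul hN hq (hW.jointEigenspace q hq μ) (hmem q hq) μ
  have hint : ∀ q, Generic N q → ∃ n : ℤ, (motifProj N q⁻¹ μ * P q μ).trace = n := by
    intro q hq
    obtain ⟨ν, -, h⟩ := hcases q hq
    rw [h]
    split_ifs
    · refine trace_integral_of_idempotent (Matrix.ext_of_mulVec_single fun σ => ?_)
      rw [← Matrix.mulVec_mulVec, hP q hq μ μ _ (hmem q hq _), if_pos rfl]
    · exact ⟨0, by rw [Matrix.trace_zero, Int.cast_zero]⟩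
  have htc : ContinuousOn (fun q => (motifProj N q⁻¹ μ * P q μ).trace) {q | Generic N q} :=
    continuousOn_trace_mul (continuousOn_motifProj hN μ) (hcont μ)
  have htl : Filter.Tendsto (fun q => (motifProj N q⁻¹ μ * P q μ).trace)
      (Bornology.cobounded ℂ) (𝓝 (crystalProj N μ * crystalProj N μ).trace) :=
    tendsto_trace_mul (tendsto_motifProj hN μ) (hlim μ)
  have hne : (motifProj N q⁻¹ μ * P q μ).trace ≠ 0 := by
    rw [eq_limit_of_integral htc hint htl hq]
    exact crystalProj_mul_self_trace μ
  obtain ⟨ν, hν, h⟩ := hcases q hq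
  by_cases e : ν = μ
  · rw [hν, e]
  · rw [h, if_neg e, Matrix.trace_zero] at hne
    exact (hne rfl).elim

end projections

end QHS

end

theorem theorem1p13 (N : ℕ) (hN : 1 ≤ N) :
    (∃ W : ℂ → QHS.Motif N → Submodule ℂ (QHS.State N), QHS.IsMotifDecomposition N W) ∧
    ∀ W : ℂ → QHS.Motif N → Submodule ℂ (QHS.State N), QHS.IsMotifDecomposition N W →
      ∀ q : ℂ, QHS.Generic N q → ∀ (μ : QHS.Motif N) (r : ℕ), 1 ≤ r → r ≤ N →
        ∀ v ∈ W q μ,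
          (QHS.ham N q r).mulVec v = (∑ n ∈ μ.1, QHS.dispersion N q r n) • v := by
  refine ⟨⟨QHS.motifSpace N, QHS.isMotifDecomposition_motifSpace hN⟩, ?_⟩
  intro W hW q hq μ r h1 hr v hv
  rw [hW.eq_motifSpace hN hq] at hv
  exact (QHS.motifProj_mulVec_eq_self_iff hN hq μ v).1 hv r h1 hr
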